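/- Let $A$ be a unital $C^*$-algebra and let $E$ be a $C^*$-correspondence over $A$: a right Hilbert $A$-module with a faithful nondegenerate left action $\phi\colon A\to\mathcal L_A(E)$ by adjointable operators. Put $E^0=A$, let $E^n$ be the $n$-fold internal tensor product of $E$ over $A$, let $\Gamma_E=\bigoplus_{n\ge0}E^n$ be the Fock module, and write $|\mu|=r$ if $\mu\in E^r$. For $\mu\in E^r$ ($r\ge 0$) let $t_\mu\in\mathcal L_A(\Gamma_E)$ be the operator $t_\mu\eta=\mu\otimes\eta$; for $a\in E^0=A$ this is the left action of $a$. Let $\mathcal T_E\subseteq\mathcal L_A(\Gamma_E)$ be the $C^*$-algebra generated by $A$ and the operators $t_\xi$, $\xi\in E$. For $N\in\mathbb N$ let $P_N\in\mathcal L_A(\Gamma_E)$ be the projection onto $\Gamma_E^{(N)}=A\oplus E\oplus\dots\oplus E^N$ and put $\phi_N(x)=P_NxP_N\in\mathcal L_A(\Gamma_E^{(N)})$. For $x=\sum_{i,j=0}^Nx_{i,j}\in\mathcal L_A(\Gamma_E^{(N)})$ with $x_{i,j}\in\mathcal L_A(E^j,E^i)$ put $x\otimes I_{E^k}=\sum_{i,j}x_{i,j}\otimes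 I_{E^k}$, where $x_{i,j}\otimes I_{E^k}\in\mathcal L_A(E^{j+k},E^{i+k})$, and $$\Psi_N(x)=\frac1{N+1}\sum_{k=0}^\infty x\otimes I_{E^k}\in\mathcal L_A(\Gamma_E).$$ (1) For every $N\in\mathbb N$ the series defining $\Psi_N$ converges in the strict topology of $\mathcal L_A(\Gamma_E)$, and $\Psi_N\circ\phi_N\colon\mathcal L_A(\Gamma_E)\to\mathcal L_A(\Gamma_E)$ is a completely positive contraction. (2) Suppose that $E$ is finitely generated as a right $A$-module. Then the algebra $\mathcal K(\Gamma_E)$ of compact operators of the Hilbert module $\Gamma_E$ is contained in $\mathcal T_E$; let $p\colon\mathcal T_E\to\mathcal O_E=\mathcal T_E/\mathcal K(\Gamma_E)$ be the quotient map onto the Cuntz–Pimsner algebra, and put $s_\mu=p(t_\mu)$. For every $N\in\mathbb N$ the map $\Psi_N\circ\phi_N$ maps $\mathcal T_E$ into $\mathcal T_E$, and $V_N=p\circ\Psi_N\circ\phi_N\colon\mathcal T_E\to\mathcal O_E$ satisfies, for all $\mu\in E^{|\mu|}$ and $\nu\in E^{|\nu|}$ (with $|\mu|,|\nu|\ge 0$),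 $$V_N(t_\mu t_\nu^*)=\begin{cases}\dfrac{\min(N-|\mu|,\,N-|\nu|)+1}{N+1}\,s_\mu s_\nu^*&\text{if }|\mu|,|\nu|\le N,\\[1ex]0&\text{otherwise.}\end{cases}$$ Moreover $V_N(x)\to p(x)$ in norm as $N\to\infty$, for each $x\in\mathcal T_E$. -/

import Mathlib

open MulOpposite Filter Topology

universe u

noncomputable section

/-- A right pre-Hilbert module over the C⋆-algebra `A`: a right `A`-module with a semi-definite
`A`-valued inner product, linear in the second variable. -/
structure PreHilbertModule (A : Type u) [CStarAlgebra A] [PartialOrder A] [StarOrderedRing A] where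
  carrier : Type u
  [addCommGroup : AddCommGroup carrier]
  [module : Module ℂ carrier]
  [rightModule : Module Aᵐᵒᵖ carrier]
  inner : carrier → carrier → A
  inner_add_right : ∀ x y z, inner x (y + z) = inner x y + inner x z
  inner_smul_right : ∀ x y (c : ℂ), inner x (c • y) = c • inner x y
  inner_op_smul_right : ∀ x y (a : A), inner x (op a • y) = inner x y * a
  star_inner : ∀ x y, star (inner x y) = inner y x
  inner_self_nonneg : ∀ x, 0 ≤ inner x x

/-- A right Hilbert module over the C⋆-algebra `A`, with the inner product linear in the second
variable. -/
structure HilbertModule (A : Type u) [CStarAlgebra A] [PartialOrder A] [StarOrderedRing A] where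
  carrier : Type u
  [normedAddCommGroup : NormedAddCommGroup carrier]
  [normedSpace : NormedSpace ℂ carrier]
  [completeSpace : CompleteSpace carrier]
  [rightModule : Module Aᵐᵒᵖ carrier]
  inner : carrier → carrier → A
  inner_add_right : ∀ x y z, inner x (y + z) = inner x y + inner x z
  inner_smul_right : ∀ x y (c : ℂ), inner x (c • y) = c • inner x y
  inner_op_smul_right : ∀ x y (a : A), inner x (op a • y) = inner x y * a
  star_inner : ∀ x y, star (inner x y) = inner y x
  inner_self_nonneg : ∀ x, 0 ≤ inner x x
  norm_sq_eq : ∀ x, ‖x‖ ^ 2 = ‖inner x x‖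

variable {A : Type u} [CStarAlgebra A] [PartialOrder A] [StarOrderedRing A]

instance : CoeSort (PreHilbertModule A) (Type u) := ⟨PreHilbertModule.carrier⟩
instance : CoeSort (HilbertModule A) (Type u) := ⟨HilbertModule.carrier⟩

attribute [instance] PreHilbertModule.addCommGroup PreHilbertModule.module
  PreHilbertModule.rightModule HilbertModule.normedAddCommGroup HilbertModule.normedSpace
  HilbertModule.completeSpace HilbertModule.rightModule

namespace PreHilbertModule

variable (V : PreHilbertModule A)

/-- The inner product as a biadditive map. -/
def innerAdd : V →+ V →+ A :=
  AddMonoidHom.mk' (fun x => AddMonoidHom.mk' (V.inner x) (V.inner_add_right x)) (by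
    intro x y; ext z
    simp only [AddMonoidHom.mk'_apply, AddMonoidHom.add_apply]
    rw [← V.star_inner, V.inner_add_right, star_add, V.star_inner, V.star_inner])

theorem innerAdd_apply (x y : V) : V.innerAdd x y = V.inner x y := rfl

theorem inner_add_left (x y z : V) : V.inner (x + y) z = V.inner x z + V.inner y z := by
  simp [← innerAdd_apply]

theorem inner_sub_left (x y z : V) : V.inner (x - y) z = V.inner x z - V.inner y z := by
  simp [← innerAdd_apply]

theorem inner_sub_right (x y z : V) : V.inner x (y - z) = V.inner x y - V.inner x z := by
  simp [← innerAdd_apply]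

theorem inner_zero_left (x : V) : V.inner 0 x = 0 := by simp [← innerAdd_apply]
theorem inner_zero_right (x : V) : V.inner x 0 = 0 := by simp [← innerAdd_apply]

theorem inner_smul_left (x y : V) (c : ℂ) : V.inner (c • x) y = star c • V.inner x y := by
  rw [← V.star_inner, V.inner_smul_right, star_smul, V.star_inner]

theorem inner_op_smul_left (x y : V) (a : A) : V.inner (op a • x) y = star a * V.inner x y := by
  rw [← V.star_inner, V.inner_op_smul_right, star_mul, V.star_inner]

theorem cauchy_schwarz_aux (x y : V) {t : ℝ} (ht : 0 < t) (hx : ‖V.inner x x‖ ≤ t) :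
    star (V.inner x y) * V.inner x y ≤ t • V.inner y y := by
  set b := V.inner x y with hb
  have h0 := V.inner_self_nonneg (op b • x - (t : ℂ) • y)
  have h1 : V.inner (op b • x - (t : ℂ) • y) (op b • x - (t : ℂ) • y)
      = star b * V.inner x x * b - (2 * t) • (star b * b) + (t * t) • V.inner y y := by
    have hyx : V.inner y x = star b := by rw [hb, V.star_inner]
    simp only [inner_sub_left, inner_sub_right, inner_op_smul_left, V.inner_op_smul_right,
      inner_smul_left, V.inner_smul_right, hyx, ← hb]
    simp only [Complex.star_def, Complex.conj_ofReal, Complex.coe_smul, mul_assoc, smul_smul,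
      smul_mul_assoc, two_mul, add_smul, sub_mul, smul_sub]
    abel
  have hsa : IsSelfAdjoint (V.inner x x) := V.star_inner x x
  have h2 : star b * V.inner x x * b ≤ t • (star b * b) := by
    refine (CStarAlgebra.star_left_conjugate_le_norm_smul hsa).trans ?_
    exact smul_le_smul_of_nonneg_right hx (star_mul_self_nonneg b)
  rw [h1] at h0
  have h3 : (0 : A) ≤ t • (t • V.inner y y - star b * b) := by
    refine h0.trans ?_
    calc _ ≤ t • (star b * b) - (2 * t) • (star b * b) + (t * t) • V.inner y y := by gcongr
      _ = _ := by rw [smul_sub, smul_smul, two_mul, add_smul]; abel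
  have h4 := smul_nonneg (inv_nonneg.2 ht.le) h3
  rw [inv_smul_smul₀ ht.ne'] at h4
  exact sub_nonneg.1 h4

/-- The Cauchy–Schwarz inequality. -/
theorem norm_inner_sq_le (x y : V) :
    ‖V.inner x y‖ ^ 2 ≤ ‖V.inner x x‖ * ‖V.inner y y‖ := by
  have key : ∀ t : ℝ, 0 < t → ‖V.inner x x‖ ≤ t → ‖V.inner x y‖ ^ 2 ≤ t * ‖V.inner y y‖ := by
    intro t ht hx
    have h := CStarAlgebra.norm_le_norm_of_nonneg_of_le (star_mul_self_nonneg _)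
      (V.cauchy_schwarz_aux x y ht hx)
    rwa [CStarRing.norm_star_mul_self, norm_smul, Real.norm_of_nonneg ht.le, ← sq] at h
  have hcont : Tendsto (fun t : ℝ => t * ‖V.inner y y‖) (𝓝[>] ‖V.inner x x‖)
      (𝓝 (‖V.inner x x‖ * ‖V.inner y y‖)) :=
    ((continuous_id.mul continuous_const).tendsto _).mono_left nhdsWithin_le_nhds
  refine ge_of_tendsto hcont ?_
  filter_upwards [self_mem_nhdsWithin] with t ht
  exact key t ((norm_nonneg _).trans_lt ht) (le_of_lt ht)

instance : Norm V := ⟨fun x => √‖V.inner x x‖⟩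

theorem norm_def (x : V) : ‖x‖ = √‖V.inner x x‖ := rfl

theorem norm_sq_eq (x : V) : ‖x‖ ^ 2 = ‖V.inner x x‖ := by
  rw [norm_def, Real.sq_sqrt (norm_nonneg _)]

theorem norm_inner_le (x y : V) : ‖V.inner x y‖ ≤ ‖x‖ * ‖y‖ := by
  rw [norm_def, norm_def, ← Real.sqrt_mul (norm_nonneg _)]
  exact Real.le_sqrt_of_sq_le (V.norm_inner_sq_le x y)

theorem core : SeminormedSpace.Core ℂ V where
  norm_nonneg x := Real.sqrt_nonneg _
  norm_smul c x := by
    rw [norm_def, norm_def, inner_smul_left, V.inner_smul_right, norm_smul, norm_smul, norm_star,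
      ← mul_assoc, Real.sqrt_mul (by positivity), Real.sqrt_mul_self (norm_nonneg _)]
  norm_triangle x y := by
    have hn : ∀ z : V, 0 ≤ ‖z‖ := fun z => Real.sqrt_nonneg _
    refine abs_le_of_sq_le_sq' ?_ (add_nonneg (hn x) (hn y)) |>.2
    rw [norm_sq_eq, inner_add_left, V.inner_add_right, V.inner_add_right, add_sq, norm_sq_eq,
      norm_sq_eq]
    have h1 := V.norm_inner_le x y
    have h2 := V.norm_inner_le y x
    have h3 := norm_add_le (V.inner x x + V.inner x y) (V.inner y x + V.inner y y)
    have h4 := norm_add_le (V.inner x x) (V.inner x y)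
    have h5 := norm_add_le (V.inner y x) (V.inner y y)
    nlinarith

instance : SeminormedAddCommGroup V := SeminormedAddCommGroup.ofCore V.core

instance : NormedSpace ℂ V where
  norm_smul_le c x := (V.core.norm_smul c x).le

theorem norm_op_smul_le (a : A) (x : V) : ‖op a • x‖ ≤ ‖a‖ * ‖x‖ := by
  rw [norm_def, norm_def, inner_op_smul_left, V.inner_op_smul_right]
  rw [← Real.sqrt_sq (norm_nonneg a), ← Real.sqrt_mul (sq_nonneg _)]
  refine Real.sqrt_le_sqrt ?_
  refine (norm_mul_le _ _).trans ?_
  have := norm_mul_le (V.inner x x) a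
  rw [norm_star]
  nlinarith [norm_nonneg a]

instance : UniformContinuousConstSMul Aᵐᵒᵖ V where
  uniformContinuous_const_smul c := by
    have : ⇑(DistribSMul.toAddMonoidHom V c) = fun x : V => c • x := rfl
    rw [← this]
    refine AddMonoidHomClass.uniformContinuous_of_bound _ ‖c.unop‖ fun x => ?_
    simpa using V.norm_op_smul_le c.unop x

theorem continuous_inner : Continuous fun p : V × V => V.innerAdd p.1 p.2 := by
  have h : IsBoundedBilinearMap ℝ fun p : V × V => V.inner p.1 p.2 :=
    { add_left := V.inner_add_left
      smul_left := fun c x y => by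
        rw [← Complex.coe_smul, inner_smul_left]; simp
      add_right := V.inner_add_right
      smul_right := fun c x y => by
        rw [← Complex.coe_smul, V.inner_smul_right]; simp
      bound := ⟨1, one_pos, fun x y => by simpa using V.norm_inner_le x y⟩ }
  exact h.continuous

open UniformSpace in
/-- The inner product on the completion, extended by continuity. -/
def complInner (x y : Completion V) : A :=
  ((Completion.isDenseInducing_toCompl V).prodMap (Completion.isDenseInducing_toCompl V)).extend
    (fun p : V × V => V.innerAdd p.1 p.2) (x, y)

open UniformSpace in
theorem complInner_coe (x y : V) : V.complInner (x : Completion V) (y : Completion V)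
    = V.inner x y :=
  ((Completion.isDenseInducing_toCompl V).prodMap
    (Completion.isDenseInducing_toCompl V)).extend_eq V.continuous_inner (x, y)

open UniformSpace in
theorem continuous_complInner :
    Continuous fun p : Completion V × Completion V => V.complInner p.1 p.2 :=
  (Completion.isDenseInducing_toCompl V).extend_Z_bilin (Completion.isDenseInducing_toCompl V)
    V.continuous_inner

open UniformSpace in
theorem continuous_complInner' {α : Type*} [TopologicalSpace α] {f g : α → Completion V}
    (hf : Continuous f) (hg : Continuous g) : Continuous fun a => V.complInner (f a) (g a) :=
  V.continuous_complInner.comp (hf.prodMk hg)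

open UniformSpace in
theorem complInner_op_smul_right (x y : Completion V) (a : A) :
    V.complInner x (op a • y) = V.complInner x y * a := by
  have h1 : Continuous fun y : Completion V => op a • y :=
    UniformSpace.Completion.continuous_map
  refine Completion.induction_on₂ x y (isClosed_eq ?_ ?_) fun x y => ?_
  · exact V.continuous_complInner' continuous_fst (h1.comp continuous_snd)
  · exact (V.continuous_complInner' continuous_fst continuous_snd).mul continuous_const
  · rw [← Completion.coe_smul]; simp only [complInner_coe, V.inner_op_smul_right]

open UniformSpace in
theorem complInner_smul_right (x y : Completion V) (c : ℂ) :
    V.complInner x (c • y) = c • V.complInner x y := by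
  have h1 : Continuous fun y : Completion V => c • y :=
    UniformSpace.Completion.continuous_map
  refine Completion.induction_on₂ x y (isClosed_eq ?_ ?_) fun x y => ?_
  · exact V.continuous_complInner' continuous_fst (h1.comp continuous_snd)
  · exact (V.continuous_complInner' continuous_fst continuous_snd).const_smul c
  · rw [← Completion.coe_smul]; simp only [complInner_coe, V.inner_smul_right]

open UniformSpace in
/-- The Hilbert module obtained from a pre-Hilbert module by dividing out the vectors of length
zero and completing (`UniformSpace.Completion` is the Hausdorff completion). -/
def completion : HilbertModule A where
  carrier := Completion V
  inner := V.complInner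
  inner_add_right x y z := by
    refine Completion.induction_on₃ x y z (isClosed_eq ?_ ?_) fun a b c => ?_
    · exact V.continuous_complInner' (by fun_prop) (by fun_prop)
    · exact (V.continuous_complInner' (by fun_prop) (by fun_prop)).add
        (V.continuous_complInner' (by fun_prop) (by fun_prop))
    · rw [← Completion.coe_add]; simp only [complInner_coe, V.inner_add_right]
  inner_smul_right x y c := V.complInner_smul_right x y c
  inner_op_smul_right x y a := V.complInner_op_smul_right x y a
  star_inner x y := by
    refine Completion.induction_on₂ x y (isClosed_eq ?_ ?_) fun a b => ?_
    · exact (V.continuous_complInner' (by fun_prop) (by fun_prop)).star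
    · exact V.continuous_complInner' (by fun_prop) (by fun_prop)
    · simp only [complInner_coe, V.star_inner]
  inner_self_nonneg x := by
    refine Completion.induction_on x (isClosed_le continuous_const ?_) fun a => ?_
    · exact V.continuous_complInner' (by fun_prop) (by fun_prop)
    · simp only [complInner_coe, V.inner_self_nonneg]
  norm_sq_eq x := by
    refine Completion.induction_on x (isClosed_eq (by fun_prop) ?_) fun a => ?_
    · exact (V.continuous_complInner' (by fun_prop) (by fun_prop)).norm
    · simp only [complInner_coe, Completion.norm_coe, V.norm_sq_eq]

theorem complInner_completion {V W : PreHilbertModule A} (T : V →L[ℂ] W) (S : W →L[ℂ] V)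
    (h : ∀ v w, W.inner (T v) w = V.inner v (S w)) (x : UniformSpace.Completion V)
    (y : UniformSpace.Completion W) :
    W.complInner (T.completion x) y = V.complInner x (S.completion y) := by
  refine UniformSpace.Completion.induction_on₂ x y (isClosed_eq ?_ ?_) fun a b => ?_
  · exact W.continuous_complInner' (T.completion.continuous.comp continuous_fst) continuous_snd
  · exact V.continuous_complInner' continuous_fst (S.completion.continuous.comp continuous_snd)
  · rw [ContinuousLinearMap.completion_apply_coe, ContinuousLinearMap.completion_apply_coe,
      complInner_coe, complInner_coe, h]

end PreHilbertModule

namespace HilbertModule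

variable (F G H : HilbertModule A)

/-- A Hilbert module seen as a pre-Hilbert module. -/
def toPre : PreHilbertModule A where
  carrier := F
  inner := F.inner
  inner_add_right := F.inner_add_right
  inner_smul_right := F.inner_smul_right
  inner_op_smul_right := F.inner_op_smul_right
  star_inner := F.star_inner
  inner_self_nonneg := F.inner_self_nonneg

variable {F} in
theorem norm_eq (x : F) : ‖x‖ = √‖F.inner x x‖ := by
  rw [← F.norm_sq_eq, Real.sqrt_sq (norm_nonneg _)]

theorem inner_add_left (x y z : F) : F.inner (x + y) z = F.inner x z + F.inner y z :=
  F.toPre.inner_add_left x y z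
theorem inner_sub_left (x y z : F) : F.inner (x - y) z = F.inner x z - F.inner y z :=
  F.toPre.inner_sub_left x y z
theorem inner_sub_right (x y z : F) : F.inner x (y - z) = F.inner x y - F.inner x z :=
  F.toPre.inner_sub_right x y z
theorem inner_zero_left (x : F) : F.inner 0 x = 0 := F.toPre.inner_zero_left x
theorem inner_zero_right (x : F) : F.inner x 0 = 0 := F.toPre.inner_zero_right x
theorem inner_neg_right (x y : F) : F.inner x (-y) = -F.inner x y := by
  rw [← zero_sub, inner_sub_right, inner_zero_right, zero_sub]
theorem inner_neg_left (x y : F) : F.inner (-x) y = -F.inner x y := by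
  rw [← zero_sub, inner_sub_left, inner_zero_left, zero_sub]
theorem inner_smul_left (x y : F) (c : ℂ) : F.inner (c • x) y = star c • F.inner x y :=
  F.toPre.inner_smul_left x y c
theorem inner_op_smul_left (x y : F) (a : A) : F.inner (op a • x) y = star a * F.inner x y :=
  F.toPre.inner_op_smul_left x y a

theorem inner_sum_right {ι : Type*} (s : Finset ι) (x : F) (y : ι → F) :
    F.inner x (∑ i ∈ s, y i) = ∑ i ∈ s, F.inner x (y i) :=
  map_sum (AddMonoidHom.mk' (F.inner x) (F.inner_add_right x)) y s
theorem inner_sum_left {ι : Type*} (s : Finset ι) (x : ι → F) (y : F) :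
    F.inner (∑ i ∈ s, x i) y = ∑ i ∈ s, F.inner (x i) y :=
  map_sum (AddMonoidHom.mk' (fun x => F.inner x y) fun a b => F.inner_add_left a b y) x s

theorem norm_inner_le (x y : F) : ‖F.inner x y‖ ≤ ‖x‖ * ‖y‖ := by
  rw [norm_eq, norm_eq]; exact F.toPre.norm_inner_le x y

theorem norm_op_smul_le (a : A) (x : F) : ‖op a • x‖ ≤ ‖a‖ * ‖x‖ := by
  rw [norm_eq, norm_eq]; exact F.toPre.norm_op_smul_le a x

theorem inner_self_eq_zero {x : F} (h : F.inner x x = 0) : x = 0 := by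
  rw [← norm_eq_zero, norm_eq, h, norm_zero, Real.sqrt_zero]

theorem ext_inner {x y : F} (h : ∀ z, F.inner z x = F.inner z y) : x = y := by
  rw [← sub_eq_zero]
  exact F.inner_self_eq_zero (by rw [inner_sub_right, h, sub_self])

theorem continuous_inner : Continuous fun p : F × F => F.inner p.1 p.2 := by
  have h : IsBoundedBilinearMap ℝ fun p : F × F => F.inner p.1 p.2 :=
    { add_left := F.inner_add_left
      smul_left := fun c x y => by
        rw [← Complex.coe_smul, inner_smul_left]; simp
      add_right := F.inner_add_right
      smul_right := fun c x y => by
        rw [← Complex.coe_smul, F.inner_smul_right]; simp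
      bound := ⟨1, one_pos, fun x y => by simpa using F.norm_inner_le x y⟩ }
  exact h.continuous

/-- The C⋆-algebra `A` as a right Hilbert module over itself, `⟪a, b⟫ = a⋆ b`. -/
def self (A : Type u) [CStarAlgebra A] [PartialOrder A] [StarOrderedRing A] :
    HilbertModule A where
  carrier := A
  inner a b := star a * b
  inner_add_right := by intros; simp [mul_add]
  inner_smul_right := by intros; simp
  inner_op_smul_right := by intros; simp [mul_assoc]
  star_inner := by intros; simp
  inner_self_nonneg a := star_mul_self_nonneg a
  norm_sq_eq a := by rw [CStarRing.norm_star_mul_self, sq]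

/-- An adjointable operator `F → G` between Hilbert modules, together with its (unique) adjoint. -/
structure Adjointable where
  toCLM : F →L[ℂ] G
  adj : G →L[ℂ] F
  inner_adj : ∀ x y, G.inner (toCLM x) y = F.inner x (adj y)

namespace Adjointable

variable {F G H}

theorem inner_adj' (T : Adjointable F G) (x : G) (y : F) :
    F.inner (T.adj x) y = G.inner x (T.toCLM y) := by
  rw [← F.star_inner, ← T.inner_adj, G.star_inner]

theorem toCLM_injective : Function.Injective (toCLM : Adjointable F G → (F →L[ℂ] G)) := by
  intro S T h
  have : S.adj = T.adj := by
    ext y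
    exact F.ext_inner fun x => by rw [← S.inner_adj, ← T.inner_adj, h]
  cases S; cases T; simp_all

instance : FunLike (Adjointable F G) F G where
  coe T := T.toCLM
  coe_injective := DFunLike.coe_injective.comp toCLM_injective

@[ext] theorem ext {S T : Adjointable F G} (h : ∀ x, S x = T x) : S = T := DFunLike.ext _ _ h

theorem coe_toCLM (T : Adjointable F G) (x : F) : T.toCLM x = T x := rfl

/-- The adjoint operator. -/
def adjoint (T : Adjointable F G) : Adjointable G F where
  toCLM := T.adj
  adj := T.toCLM
  inner_adj := T.inner_adj'

/-- Composition of adjointable operators. -/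
def comp (S : Adjointable G H) (T : Adjointable F G) : Adjointable F H where
  toCLM := S.toCLM.comp T.toCLM
  adj := T.adj.comp S.adj
  inner_adj x y := by simp [S.inner_adj, T.inner_adj]

instance : Zero (Adjointable F G) :=
  ⟨⟨0, 0, by intros; simp [inner_zero_left, inner_zero_right]⟩⟩
instance : One (Adjointable F F) := ⟨⟨1, 1, by intros; simp⟩⟩
instance : Add (Adjointable F G) := ⟨fun S T => ⟨S.toCLM + T.toCLM, S.adj + T.adj, by
  intros; simp [inner_add_left, inner_add_right, S.inner_adj, T.inner_adj]⟩⟩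
instance : Neg (Adjointable F G) := ⟨fun S => ⟨-S.toCLM, -S.adj, by
  intros; simp [inner_neg_left, inner_neg_right, S.inner_adj]⟩⟩
instance : Sub (Adjointable F G) := ⟨fun S T => ⟨S.toCLM - T.toCLM, S.adj - T.adj, by
  intros; simp [inner_sub_left, inner_sub_right, S.inner_adj, T.inner_adj]⟩⟩
instance : SMul ℂ (Adjointable F G) := ⟨fun c S => ⟨c • S.toCLM, star c • S.adj, by
  intros; simp [inner_smul_left, inner_smul_right, S.inner_adj]⟩⟩
instance : Mul (Adjointable F F) := ⟨comp⟩
instance : Star (Adjointable F F) := ⟨adjoint⟩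

instance : AddCommGroup (Adjointable F G) where
  add_assoc _ _ _ := toCLM_injective (add_assoc _ _ _)
  zero_add _ := toCLM_injective (zero_add _)
  add_zero _ := toCLM_injective (add_zero _)
  add_comm _ _ := toCLM_injective (add_comm _ _)
  neg_add_cancel _ := toCLM_injective (neg_add_cancel _)
  sub_eq_add_neg _ _ := toCLM_injective (sub_eq_add_neg _ _)
  nsmul := nsmulRec
  zsmul := zsmulRec

/-- `toCLM` as an additive map. -/
def toCLMHom : Adjointable F G →+ (F →L[ℂ] G) where
  toFun := toCLM
  map_zero' := rfl
  map_add' _ _ := rfl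

instance : Module ℂ (Adjointable F G) where
  one_smul _ := toCLM_injective (one_smul ℂ _)
  mul_smul _ _ _ := toCLM_injective (mul_smul _ _ _)
  smul_zero _ := toCLM_injective (smul_zero _)
  smul_add _ _ _ := toCLM_injective (smul_add _ _ _)
  add_smul _ _ _ := toCLM_injective (add_smul _ _ _)
  zero_smul _ := toCLM_injective (zero_smul ℂ _)

instance : NormedAddCommGroup (Adjointable F G) :=
  NormedAddCommGroup.induced (Adjointable F G) (F →L[ℂ] G) toCLMHom toCLM_injective

instance : Ring (Adjointable F F) where
  __ := (inferInstance : AddCommGroup (Adjointable F F))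
  mul_assoc _ _ _ := rfl
  one_mul _ := rfl
  mul_one _ := rfl
  zero_mul T := toCLM_injective T.toCLM.zero_comp
  mul_zero T := toCLM_injective T.toCLM.comp_zero
  left_distrib R S T := toCLM_injective (R.toCLM.comp_add S.toCLM T.toCLM)
  right_distrib R S T := toCLM_injective (ContinuousLinearMap.add_comp R.toCLM S.toCLM T.toCLM)

theorem norm_def (T : Adjointable F G) : ‖T‖ = ‖T.toCLM‖ := rfl

theorem norm_apply_le (T : Adjointable F G) (x : F) : ‖T x‖ ≤ ‖T‖ * ‖x‖ := T.toCLM.le_opNorm x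

theorem norm_le_of (T : Adjointable F G) {c : ℝ} (hc : 0 ≤ c) (h : ∀ x, ‖T x‖ ≤ c * ‖x‖) :
    ‖T‖ ≤ c := T.toCLM.opNorm_le_bound hc h

/-- `‖T‖² ≤ ‖T⋆ T‖`. -/
theorem norm_sq_le (T : Adjointable F G) : ‖T‖ ^ 2 ≤ ‖T.adjoint.comp T‖ := by
  have h : ‖T‖ ≤ √‖T.adjoint.comp T‖ := by
    refine T.norm_le_of (Real.sqrt_nonneg _) fun x => ?_
    refine abs_le_of_sq_le_sq' ?_ (by positivity) |>.2
    rw [mul_pow, Real.sq_sqrt (norm_nonneg _), G.norm_sq_eq]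
    have : G.inner (T x) (T x) = F.inner x (T.adjoint.comp T x) := T.inner_adj x _
    rw [this]
    refine (F.norm_inner_le _ _).trans ?_
    have := (T.adjoint.comp T).norm_apply_le x
    nlinarith [norm_nonneg x]
  calc ‖T‖ ^ 2 ≤ (√‖T.adjoint.comp T‖) ^ 2 := by gcongr
    _ = _ := Real.sq_sqrt (norm_nonneg _)

theorem norm_comp_le (S : Adjointable G H) (T : Adjointable F G) : ‖S.comp T‖ ≤ ‖S‖ * ‖T‖ :=
  S.toCLM.opNorm_comp_le T.toCLM

theorem norm_le_norm_adjoint (T : Adjointable F G) : ‖T‖ ≤ ‖T.adjoint‖ := by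
  have h := T.norm_sq_le.trans (norm_comp_le _ _)
  rcases (norm_nonneg T).eq_or_lt with h0 | h0
  · exact h0.symm.le.trans (norm_nonneg _)
  · rw [sq] at h; exact le_of_mul_le_mul_right h h0

theorem norm_adjoint (T : Adjointable F G) : ‖T.adjoint‖ = ‖T‖ :=
  le_antisymm T.adjoint.norm_le_norm_adjoint T.norm_le_norm_adjoint

instance : NormedRing (Adjointable F F) :=
  { (inferInstance : NormedAddCommGroup (Adjointable F F)),
    (inferInstance : Ring (Adjointable F F)) with
    norm_mul_le := norm_comp_le }

instance : Algebra ℂ (Adjointable F F) :=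
  Algebra.ofModule (fun c S T => toCLM_injective (ContinuousLinearMap.smul_comp c S.toCLM T.toCLM)) (fun c S T => by
    apply toCLM_injective
    exact (ContinuousLinearMap.comp_smul S.toCLM c T.toCLM))

instance : NormedAlgebra ℂ (Adjointable F F) where
  norm_smul_le c T := norm_smul_le c T.toCLM

instance : NormedSpace ℂ (Adjointable F G) where
  norm_smul_le c T := norm_smul_le c T.toCLM

instance : StarRing (Adjointable F F) where
  star_involutive _ := rfl
  star_mul _ _ := rfl
  star_add _ _ := toCLM_injective rfl

instance : StarModule ℂ (Adjointable F F) where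
  star_smul _ _ := toCLM_injective rfl

instance : CStarRing (Adjointable F F) where
  norm_mul_self_le T := by
    have := T.norm_sq_le
    rwa [sq] at this

instance : CompleteSpace (Adjointable F G) := by
  let f : Adjointable F G → (F →L[ℂ] G) × (G →L[ℂ] F) := fun T => (T.toCLM, T.adj)
  have hf : Isometry f := by
    refine Isometry.of_dist_eq fun S T => ?_
    rw [Prod.dist_eq, dist_eq_norm, dist_eq_norm, dist_eq_norm]
    change max ‖S - T‖ ‖(S - T).adjoint‖ = _
    rw [norm_adjoint, max_self]
  have hr : IsClosed (Set.range f) := by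
    have : Set.range f = {p | ∀ x y, G.inner (p.1 x) y = F.inner x (p.2 y)} := by
      ext p
      constructor
      · rintro ⟨T, rfl⟩; exact T.inner_adj
      · intro h; exact ⟨⟨p.1, p.2, h⟩, rfl⟩
    rw [this]
    simp only [Set.ofPred_forall]
    refine isClosed_iInter fun x => isClosed_iInter fun y => isClosed_eq ?_ ?_
    · exact G.continuous_inner.comp (Continuous.prodMk (by fun_prop) continuous_const)
    · exact F.continuous_inner.comp (Continuous.prodMk continuous_const (by fun_prop))
  rw [completeSpace_iff_isComplete_range hf.isUniformInducing]
  exact hr.isComplete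

/-- The adjointable operators on a Hilbert module form a C⋆-algebra. -/
instance : CStarAlgebra (Adjointable F F) where

instance : PartialOrder (Adjointable F F) := CStarAlgebra.spectralOrder _
instance : StarOrderedRing (Adjointable F F) := CStarAlgebra.spectralOrderedRing _

theorem comp_apply (S : Adjointable G H) (T : Adjointable F G) (x : F) : S.comp T x = S (T x) := rfl
theorem mul_apply (S T : Adjointable F F) (x : F) : (S * T) x = S (T x) := rfl
theorem one_apply (x : F) : (1 : Adjointable F F) x = x := rfl
theorem add_apply (S T : Adjointable F G) (x : F) : (S + T) x = S x + T x := rfl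
theorem sub_apply (S T : Adjointable F G) (x : F) : (S - T) x = S x - T x := rfl
theorem smul_apply (c : ℂ) (T : Adjointable F G) (x : F) : (c • T) x = c • T x := rfl
theorem sum_apply {ι : Type*} (s : Finset ι) (T : ι → Adjointable F G) (x : F) :
    (∑ i ∈ s, T i) x = ∑ i ∈ s, T i x :=
  map_sum (AddMonoidHom.mk' (fun T : Adjointable F G => T x) fun _ _ => rfl) T s
theorem map_zero (T : Adjointable F G) : T 0 = 0 := T.toCLM.map_zero
theorem map_add (T : Adjointable F G) (x y : F) : T (x + y) = T x + T y := T.toCLM.map_add x y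
theorem map_smul (T : Adjointable F G) (c : ℂ) (x : F) : T (c • x) = c • T x := T.toCLM.map_smul c x

theorem inner_left (T : Adjointable F G) (x : F) (y : G) :
    G.inner (T x) y = F.inner x (T.adjoint y) := T.inner_adj x y

theorem inner_right (T : Adjointable F G) (x : G) (y : F) :
    G.inner x (T y) = F.inner (T.adjoint x) y := (T.inner_adj' x y).symm

theorem map_op_smul (T : Adjointable F G) (a : A) (x : F) : T (op a • x) = op a • T x :=
  G.ext_inner fun z => by
    rw [inner_right, F.inner_op_smul_right, G.inner_op_smul_right, inner_right]

/-- For `c ≥ ‖T‖`, `c² - T⋆ T` is a square `S⋆ S`. -/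
theorem exists_sq_sub (T : Adjointable F G) {c : ℝ} (hc : ‖T‖ ≤ c) :
    ∃ S : Adjointable F F, ∀ x y, (c ^ 2) • F.inner x y - G.inner (T x) (T y)
      = F.inner (S x) (S y) := by
  have hsa : IsSelfAdjoint (T.adjoint.comp T) := rfl
  have hnorm : ‖T.adjoint.comp T‖ ≤ c ^ 2 := by
    refine (norm_comp_le _ _).trans ?_
    rw [norm_adjoint, sq]
    exact mul_le_mul hc hc (norm_nonneg _) ((norm_nonneg _).trans hc)
  have hle : T.adjoint.comp T ≤ algebraMap ℝ (Adjointable F F) (c ^ 2) :=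
    hsa.le_algebraMap_norm_self.trans (algebraMap_mono (Adjointable F F) hnorm)
  obtain ⟨S, hS⟩ := CStarAlgebra.nonneg_iff_eq_star_mul_self.1 (sub_nonneg.2 hle)
  refine ⟨S, fun x y => ?_⟩
  have h1 : F.inner (S x) (S y) = F.inner x ((star S * S) y) := S.inner_adj x (S y)
  have h2 : (algebraMap ℝ (Adjointable F F) (c ^ 2)) y = ((c ^ 2 : ℝ) : ℂ) • y := by
    rw [Algebra.algebraMap_eq_smul_one, ← Complex.coe_smul]; rfl
  rw [h1, ← hS, sub_apply, inner_sub_right, h2, F.inner_smul_right, comp_apply, ← inner_left,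
    Complex.coe_smul]

/-- The rank one operator `z ↦ x ⟪y, z⟫`. -/
def rankOne (x : G) (y : F) : Adjointable F G where
  toCLM := LinearMap.mkContinuous
    { toFun := fun z => op (F.inner y z) • x
      map_add' := fun z w => by rw [F.inner_add_right, op_add, add_smul]
      map_smul' := fun c z => G.ext_inner fun w => by
        rw [F.inner_smul_right, G.inner_op_smul_right, RingHom.id_apply, G.inner_smul_right,
          G.inner_op_smul_right, mul_smul_comm] }
    (‖y‖ * ‖x‖) (fun z => by
      refine (G.norm_op_smul_le _ _).trans ?_
      have := F.norm_inner_le y z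
      nlinarith [norm_nonneg x])
  adj := LinearMap.mkContinuous
    { toFun := fun z => op (G.inner x z) • y
      map_add' := fun z w => by rw [G.inner_add_right, op_add, add_smul]
      map_smul' := fun c z => F.ext_inner fun w => by
        rw [G.inner_smul_right, F.inner_op_smul_right, RingHom.id_apply, F.inner_smul_right,
          F.inner_op_smul_right, mul_smul_comm] }
    (‖y‖ * ‖x‖) (fun z => by
      refine (F.norm_op_smul_le _ _).trans ?_
      have := G.norm_inner_le x z
      nlinarith [norm_nonneg y])
  inner_adj z w := by
    simp [inner_op_smul_left, F.inner_op_smul_right, F.star_inner]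

theorem rankOne_apply (x : G) (y z : F) : rankOne x y z = op (F.inner y z) • x := rfl

variable (F) in
/-- The compact operators on a Hilbert module: the closed linear span of the rank one operators. -/
def compacts : Submodule ℂ (Adjointable F F) :=
  (Submodule.span ℂ {T | ∃ x y, T = rankOne x y}).topologicalClosure

theorem mul_mem_compacts (S : Adjointable F F) {T : Adjointable F F} (hT : T ∈ compacts F) :
    S * T ∈ compacts F := by
  have h : Set.MapsTo (fun T => S * T) (Submodule.span ℂ {T | ∃ x y : F, T = rankOne x y})
      (Submodule.span ℂ {T | ∃ x y : F, T = rankOne x y}) := by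
    intro T hT
    change S * T ∈ Submodule.span ℂ {T | ∃ x y : F, T = rankOne x y}
    induction hT using Submodule.span_induction with
    | mem T hT =>
      obtain ⟨x, y, rfl⟩ := hT
      refine Submodule.subset_span ⟨S x, y, ?_⟩
      ext z
      rw [mul_apply, rankOne_apply, rankOne_apply, map_op_smul]
    | zero => simp
    | add x y _ _ hx hy => rw [mul_add]; exact add_mem hx hy
    | smul c x _ hx => rw [mul_smul_comm]; exact Submodule.smul_mem _ _ hx
  exact h.closure (continuous_const_mul S) hT

theorem star_mem_compacts {T : Adjointable F F} (hT : T ∈ compacts F) : star T ∈ compacts F := by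
  have h : Set.MapsTo (fun T : Adjointable F F => star T)
      (Submodule.span ℂ {T | ∃ x y : F, T = rankOne x y})
      (Submodule.span ℂ {T | ∃ x y : F, T = rankOne x y}) := by
    intro T hT
    change star T ∈ Submodule.span ℂ {T | ∃ x y : F, T = rankOne x y}
    induction hT using Submodule.span_induction with
    | mem T hT =>
      obtain ⟨x, y, rfl⟩ := hT
      exact Submodule.subset_span ⟨y, x, rfl⟩
    | zero => simp
    | add x y _ _ hx hy => rw [star_add]; exact add_mem hx hy
    | smul c x _ hx => rw [star_smul]; exact Submodule.smul_mem _ _ hx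
  exact h.closure continuous_star hT

theorem mem_mul_compacts (S : Adjointable F F) {T : Adjointable F F} (hT : T ∈ compacts F) :
    T * S ∈ compacts F := by
  have := star_mem_compacts (mul_mem_compacts (star S) (star_mem_compacts hT))
  simpa using this

/-- Extension of an adjoint pair of operators between pre-Hilbert modules, one of which is bounded,
to the completions. -/
def ofPre {V W : PreHilbertModule A} (T : V →ₗ[ℂ] W) (S : W →ₗ[ℂ] V)
    (h : ∀ v w, W.inner (T v) w = V.inner v (S w)) (c : ℝ) (hT : ∀ v, ‖T v‖ ≤ c * ‖v‖) :
    Adjointable V.completion W.completion :=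
  have hS : ∀ w, ‖S w‖ ≤ max c 0 * ‖w‖ := fun w => by
    rcases (norm_nonneg (S w)).eq_or_lt with h0 | h0
    · rw [← h0]; positivity
    · have h1 : ‖S w‖ ^ 2 ≤ ‖T (S w)‖ * ‖w‖ := by
        rw [V.norm_sq_eq, ← h]; exact W.norm_inner_le _ _
      have h2 : ‖T (S w)‖ ≤ max c 0 * ‖S w‖ := (hT _).trans (by gcongr; exact le_max_left _ _)
      refine le_of_mul_le_mul_right ?_ h0
      nlinarith [norm_nonneg w]
  let T' : V →L[ℂ] W := T.mkContinuous c hT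
  let S' : W →L[ℂ] V := S.mkContinuous _ hS
  { toCLM := T'.completion
    adj := S'.completion
    inner_adj := PreHilbertModule.complInner_completion T' S' h }

theorem ofPre_coe {V W : PreHilbertModule A} (T : V →ₗ[ℂ] W) (S : W →ₗ[ℂ] V)
    (h : ∀ v w, W.inner (T v) w = V.inner v (S w)) (c : ℝ) (hT : ∀ v, ‖T v‖ ≤ c * ‖v‖) (v : V) :
    ofPre T S h c hT (v : UniformSpace.Completion V) = (T v : UniformSpace.Completion W) :=
  ContinuousLinearMap.completion_apply_coe (T.mkContinuous c hT) v

end Adjointable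
end HilbertModule

theorem CStarAlgebra.exists_neg_part {B : Type*} [CStarAlgebra B] [PartialOrder B]
    [StarOrderedRing B] (M : B) (hM : IsSelfAdjoint M) :
    ∃ N S : B, star N = N ∧ N = star S * S ∧ M * N = -(N * N) ∧ (N = 0 → 0 ≤ M) := by
  have hN0 : 0 ≤ M⁻ := CFC.negPart_nonneg M
  obtain ⟨S, hS⟩ := CStarAlgebra.nonneg_iff_eq_star_mul_self.1 hN0
  refine ⟨M⁻, S, (IsSelfAdjoint.of_nonneg hN0).star_eq, hS, ?_,
    (CFC.negPart_eq_zero_iff M hM).1⟩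
  conv_lhs => enter [1]; rw [← CFC.posPart_sub_negPart M hM]
  rw [sub_mul, CFC.posPart_mul_negPart, zero_sub]

theorem CStarAlgebra.exists_star_mul_self {B : Type*} [CStarAlgebra B] [PartialOrder B]
    [StarOrderedRing B] {M : B} (hM : 0 ≤ M) : ∃ S : B, M = star S * S :=
  CStarAlgebra.nonneg_iff_eq_star_mul_self.1 hM

theorem CStarMatrix.nonneg_of_conj_diag {ι : Type*} [Fintype ι] [DecidableEq ι]
    (M : CStarMatrix ι ι A) (hsa : IsSelfAdjoint M)
    (h : ∀ a : ι → A, 0 ≤ ∑ i, ∑ j, star (a i) * M i j * a j) : 0 ≤ M := by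
  obtain ⟨N, S, hNsa, hS, h2, hN⟩ := CStarAlgebra.exists_neg_part M hsa
  have hMN : N * M * N = -(star (S * N) * (S * N)) := by
    rw [mul_assoc, h2, star_mul, hNsa, mul_neg, mul_assoc, ← mul_assoc (star S), ← hS]
  have hSN : S * N = 0 := by
    have hdiag : ∀ k, (N * M * N) k k = ∑ i, ∑ j, star (N i k) * M i j * N j k := by
      intro k
      rw [CStarMatrix.mul_apply, Finset.sum_comm]
      refine Finset.sum_congr rfl fun j _ => ?_
      rw [CStarMatrix.mul_apply, Finset.sum_mul]
      refine Finset.sum_congr rfl fun i _ => ?_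
      rw [← CStarMatrix.star_apply, hNsa]
    have hdiag2 : ∀ k, (star (S * N) * (S * N)) k k = ∑ j, star ((S * N) j k) * (S * N) j k := by
      intro k
      rw [CStarMatrix.mul_apply]
      rfl
    have hz : ∀ k, ∑ j, star ((S * N) j k) * (S * N) j k = 0 := by
      intro k
      refine le_antisymm ?_ (Finset.sum_nonneg fun j _ => star_mul_self_nonneg _)
      have := h fun i => N i k
      rw [← hdiag, hMN, CStarMatrix.neg_apply, hdiag2] at this
      exact neg_nonneg.1 this
    ext j k
    have := (Finset.sum_eq_zero_iff_of_nonneg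
      (fun j _ => star_mul_self_nonneg ((S * N) j k))).1 (hz k) j (Finset.mem_univ _)
    exact CStarRing.star_mul_self_eq_zero_iff _ |>.1 this
  have hNN : N = 0 := by
    have : star N * N = 0 := by
      rw [hNsa]
      conv_lhs => rw [hS]
      rw [mul_assoc, ← hS, hSN, mul_zero]
    exact CStarRing.star_mul_self_eq_zero_iff _ |>.1 this
  exact hN hNN

namespace HilbertModule

/-- The Gram matrix of finitely many vectors of a Hilbert module is of the form `B⋆ B`. -/
theorem exists_gram (F : HilbertModule A) {ι : Type*} [Fintype ι] [DecidableEq ι] (x : ι → F) :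
    ∃ B : ι → ι → A, ∀ i j, F.inner (x i) (x j) = ∑ k, star (B k i) * B k j := by
  let M : CStarMatrix ι ι A := CStarMatrix.ofMatrix fun i j => F.inner (x i) (x j)
  have hM : 0 ≤ M := by
    refine CStarMatrix.nonneg_of_conj_diag M ?_ fun a => ?_
    · ext i j
      exact F.star_inner _ _
    · have : ∑ i, ∑ j, star (a i) * M i j * a j
          = F.inner (∑ i, op (a i) • x i) (∑ i, op (a i) • x i) := by
        rw [F.inner_sum_left]
        refine Finset.sum_congr rfl fun i _ => ?_
        rw [F.inner_sum_right]
        refine Finset.sum_congr rfl fun j _ => ?_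
        rw [F.inner_op_smul_right, F.inner_op_smul_left]
        rfl
      rw [this]
      exact F.inner_self_nonneg _
  obtain ⟨B, hB⟩ := CStarAlgebra.exists_star_mul_self hM
  refine ⟨fun i j => B i j, fun i j => ?_⟩
  have : M i j = (star B * B) i j := by rw [hB]
  rw [CStarMatrix.mul_apply] at this
  exact this

end HilbertModule

/-- A C⋆-correspondence over `A`: a right Hilbert `A`-module with a faithful nondegenerate (for
unital `A`: unital) left action `φ` of `A` by adjointable operators. -/
structure CStarCorrespondence (A : Type u) [CStarAlgebra A] [PartialOrder A]
    [StarOrderedRing A] extends HilbertModule A where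
  φ : A →⋆ₐ[ℂ] HilbertModule.Adjointable toHilbertModule toHilbertModule
  φ_injective : Function.Injective φ

namespace HilbertModule

open Adjointable

variable (F G H : HilbertModule A) (E : CStarCorrespondence A)

/-- The formula `∑ ⟪y, φ(⟪x, x'⟫) y'⟫` for the inner product of two formal sums `∑ x ⊗ y` and
`∑ x' ⊗ y'`. -/
def tensorInner (v w : F →₀ E.toHilbertModule) : A :=
  v.sum fun x y => w.sum fun x' y' => E.inner y (E.φ (F.inner x x') y')

theorem tensorInner_add_right (v w w' : F →₀ E.toHilbertModule) :
    tensorInner F E v (w + w') = tensorInner F E v w + tensorInner F E v w' := by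
  classical
  rw [tensorInner, tensorInner, tensorInner, ← Finsupp.sum_add]
  refine Finsupp.sum_congr fun x _ => ?_
  refine Finsupp.sum_add_index' (fun _ => ?_) fun _ _ _ => ?_
  · rw [Adjointable.map_zero, E.inner_zero_right]
  · rw [Adjointable.map_add, E.inner_add_right]

theorem star_tensorInner (v w : F →₀ E.toHilbertModule) :
    star (tensorInner F E v w) = tensorInner F E w v := by
  rw [tensorInner, tensorInner, Finsupp.sum, star_sum]
  simp only [Finsupp.sum, star_sum]
  rw [Finset.sum_comm]
  refine Finset.sum_congr rfl fun x _ => Finset.sum_congr rfl fun y _ => ?_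
  rw [E.star_inner, Adjointable.inner_left]
  change E.inner _ (star (E.φ _) _) = _
  rw [← map_star, F.star_inner]

theorem tensorInner_self_nonneg (v : F →₀ E.toHilbertModule) : 0 ≤ tensorInner F E v v := by
  classical
  obtain ⟨B, hB⟩ := F.exists_gram fun i : v.support => (i : F)
  have : tensorInner F E v v
      = ∑ k, E.inner (∑ i, E.φ (B k i) (v i)) (∑ i, E.φ (B k i) (v i)) := by
    rw [tensorInner, Finsupp.sum, ← Finset.sum_coe_sort]
    simp only [Finsupp.sum]
    simp_rw [← Finset.sum_coe_sort v.support fun x' => E.inner _ (E.φ (F.inner _ x') (v x'))]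
    simp_rw [hB]
    trans ∑ i : v.support, ∑ j : v.support, ∑ k,
        E.inner (E.φ (B k i) (v i)) (E.φ (B k j) (v j))
    · refine Finset.sum_congr rfl fun i _ => Finset.sum_congr rfl fun j _ => ?_
      rw [map_sum]
      rw [Adjointable.sum_apply, E.inner_sum_right]
      refine Finset.sum_congr rfl fun k _ => ?_
      rw [map_mul, map_star, Adjointable.inner_left]
      rfl
    · symm
      trans ∑ k, ∑ i : v.support, ∑ j : v.support,
        E.inner (E.φ (B k i) (v i)) (E.φ (B k j) (v j))
      · refine Finset.sum_congr rfl fun k _ => ?_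
        rw [E.inner_sum_left]
        refine Finset.sum_congr rfl fun i _ => ?_
        rw [E.inner_sum_right]
      · rw [Finset.sum_comm]
        refine Finset.sum_congr rfl fun i _ => ?_
        rw [Finset.sum_comm]
  rw [this]
  exact Finset.sum_nonneg fun k _ => E.inner_self_nonneg _

/-- Formal finite sums `∑ x ⊗ y` with `x ∈ F`, `y ∈ E`, with the semi-definite inner product
`⟪x ⊗ y, x' ⊗ y'⟫ = ⟪y, φ(⟪x, x'⟫) y'⟫` and right action `(x ⊗ y) a = x ⊗ y a`. A finitely
supported `v : F →₀ E` stands for `∑ x ⊗ v x`; the additivity and `A`-balancedness in the first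
variable hold up to vectors of length zero. -/
def preTensor : PreHilbertModule A where
  carrier := F →₀ E.toHilbertModule
  inner := tensorInner F E
  inner_add_right := tensorInner_add_right F E
  inner_smul_right v w c := by
    rw [tensorInner, tensorInner, Finsupp.smul_sum]
    refine Finsupp.sum_congr fun x _ => ?_
    rw [Finsupp.smul_sum, Finsupp.sum_smul_index']
    · refine Finsupp.sum_congr fun x' _ => ?_
      rw [Adjointable.map_smul, E.inner_smul_right]
    · intro
      rw [Adjointable.map_zero, E.inner_zero_right]
  inner_op_smul_right v w a := by
    rw [tensorInner, tensorInner, Finsupp.sum, Finsupp.sum, Finset.sum_mul]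
    refine Finset.sum_congr rfl fun x _ => ?_
    refine (Finsupp.sum_smul_index' fun _ => ?_).trans ?_
    · rw [Adjointable.map_zero, E.inner_zero_right]
    · rw [Finsupp.sum, Finsupp.sum, Finset.sum_mul]
      refine Finset.sum_congr rfl fun x' _ => ?_
      rw [Adjointable.map_op_smul, E.inner_op_smul_right]
  star_inner := star_tensorInner F E
  inner_self_nonneg := tensorInner_self_nonneg F E

/-- The internal tensor product `F ⊗_A E`. -/
def tensor : HilbertModule A := (preTensor F E).completion

variable {F E} in
/-- The elementary tensor `x ⊗ y` in `F ⊗_A E`. -/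
def tmul (x : F) (y : E.toHilbertModule) : tensor F E :=
  UniformSpace.Completion.coe' (α := preTensor F E) (Finsupp.single x y)

theorem inner_tmul (x x' : F) (y y' : E.toHilbertModule) :
    (tensor F E).inner (tmul x y) (tmul x' y') = E.inner y (E.φ (F.inner x x') y') := by
  refine ((preTensor F E).complInner_coe (Finsupp.single x y) (Finsupp.single x' y')).trans ?_
  change tensorInner F E _ _ = _
  rw [tensorInner, Finsupp.sum_single_index, Finsupp.sum_single_index]
  · rw [Adjointable.map_zero, E.inner_zero_right]
  · exact Finset.sum_eq_zero fun _ _ => E.inner_zero_left _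

namespace Adjointable

variable {F G H}

theorem tensorInner_mapDomain (T : Adjointable F G) (v : F →₀ E.toHilbertModule)
    (w : G →₀ E.toHilbertModule) :
    tensorInner G E (v.mapDomain T) w = tensorInner F E v (w.mapDomain T.adjoint) := by
  rw [tensorInner, tensorInner, Finsupp.sum_mapDomain_index]
  · refine Finsupp.sum_congr fun x _ => ?_
    rw [Finsupp.sum_mapDomain_index]
    · refine Finsupp.sum_congr fun y _ => ?_
      rw [inner_left]
    · intro
      rw [Adjointable.map_zero, E.inner_zero_right]
    · intros
      rw [Adjointable.map_add, E.inner_add_right]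
  · intro
    exact Finset.sum_eq_zero fun _ _ => E.inner_zero_left _
  · intros
    rw [← Finsupp.sum_add]
    exact Finsupp.sum_congr fun _ _ => E.inner_add_left _ _ _

theorem tensorInner_mapDomain_le (T : Adjointable F G) (v : F →₀ E.toHilbertModule) :
    tensorInner G E (v.mapDomain T) (v.mapDomain T) ≤ ‖T‖ ^ 2 • tensorInner F E v v := by
  obtain ⟨S, hS⟩ := T.exists_sq_sub le_rfl
  have key : ∀ {G : HilbertModule A} (T : Adjointable F G),
      tensorInner G E (v.mapDomain T) (v.mapDomain T)
        = v.sum fun x y => v.sum fun x' y' => E.inner y (E.φ (G.inner (T x) (T x')) y') := by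
    intro G T
    rw [tensorInner_mapDomain, tensorInner]
    refine Finsupp.sum_congr fun x _ => ?_
    rw [← Finsupp.mapDomain_comp, Finsupp.sum_mapDomain_index]
    · refine Finsupp.sum_congr fun y _ => ?_
      rw [Function.comp_apply, ← inner_left]
    · intro
      rw [Adjointable.map_zero, E.inner_zero_right]
    · intros
      rw [Adjointable.map_add, E.inner_add_right]
  have h0 := tensorInner_self_nonneg F E (v.mapDomain S)
  rw [← sub_nonneg]
  convert h0 using 1
  rw [key, key, tensorInner, Finsupp.smul_sum, Finsupp.sum, Finsupp.sum, Finsupp.sum,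
    ← Finset.sum_sub_distrib]
  refine Finset.sum_congr rfl fun x _ => ?_
  rw [Finsupp.smul_sum, Finsupp.sum, Finsupp.sum, Finsupp.sum, ← Finset.sum_sub_distrib]
  refine Finset.sum_congr rfl fun y _ => ?_
  rw [← hS, map_sub, sub_apply, E.inner_sub_right]
  congr 1
  rw [← Complex.coe_smul, ← Complex.coe_smul, _root_.map_smul, smul_apply, E.inner_smul_right]

theorem norm_mapDomain_le (T : Adjointable F G) (v : preTensor F E) :
    ‖show preTensor G E from Finsupp.lmapDomain E.toHilbertModule ℂ T v‖ ≤ ‖T‖ * ‖v‖ := by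
  rw [PreHilbertModule.norm_def, PreHilbertModule.norm_def, ← Real.sqrt_sq (norm_nonneg T),
    ← Real.sqrt_mul (sq_nonneg _)]
  refine Real.sqrt_le_sqrt ?_
  have := CStarAlgebra.norm_le_norm_of_nonneg_of_le (tensorInner_self_nonneg G E _)
    (tensorInner_mapDomain_le E T v)
  rwa [norm_smul, Real.norm_of_nonneg (sq_nonneg _)] at this

/-- The operator `T ⊗ I_E : F ⊗_A E → G ⊗_A E`, `x ⊗ y ↦ T x ⊗ y`. -/
def tensorId (T : Adjointable F G) : Adjointable (F.tensor E) (G.tensor E) :=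
  ofPre (V := preTensor F E) (W := preTensor G E)
    (Finsupp.lmapDomain E.toHilbertModule ℂ T) (Finsupp.lmapDomain E.toHilbertModule ℂ T.adjoint)
    (tensorInner_mapDomain E T) ‖T‖ (norm_mapDomain_le E T)

theorem tensorId_tmul (T : Adjointable F G) (x : F) (y : E.toHilbertModule) :
    tensorId E T (tmul x y) = tmul (T x) y := by
  refine (ofPre_coe (V := preTensor F E) (W := preTensor G E) _ _ _ _ _
    (Finsupp.single x y)).trans ?_
  refine congrArg _ ?_
  exact Finsupp.mapDomain_single

end Adjointable
end HilbertModule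

namespace HilbertModule

open Adjointable UniformSpace

variable {F G : HilbertModule A}

theorem Adjointable.norm_ofPre_le {V W : PreHilbertModule A} (T : V →ₗ[ℂ] W) (S : W →ₗ[ℂ] V)
    (h : ∀ v w, W.inner (T v) w = V.inner v (S w)) (c : ℝ) (hc : 0 ≤ c)
    (hT : ∀ v, ‖T v‖ ≤ c * ‖v‖) : ‖ofPre T S h c hT‖ ≤ c := by
  refine ContinuousLinearMap.opNorm_le_bound _ hc fun x => ?_
  change ‖(T.mkContinuous c hT).completion x‖ ≤ c * ‖x‖
  refine Completion.induction_on x (isClosed_le ?_ ?_) fun a => ?_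
  · exact (T.mkContinuous c hT).completion.continuous.norm
  · exact continuous_const.mul continuous_norm
  · have := hT a
    rw [ContinuousLinearMap.completion_apply_coe]
    exact (Completion.norm_coe _).le.trans (this.trans_eq
      (congrArg _ (Completion.norm_coe a).symm))

theorem Adjointable.norm_tensorId_le (E : CStarCorrespondence A) (T : Adjointable F G) :
    ‖tensorId E T‖ ≤ ‖T‖ :=
  norm_ofPre_le (V := preTensor F E) (W := preTensor G E) _ _ _ _ (norm_nonneg T) _

theorem op_smul_smul (F : HilbertModule A) (c : ℂ) (a : A) (x : F) :
    op (c • a) • x = c • op a • x :=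
  F.ext_inner fun w => by
    rw [F.inner_op_smul_right, F.inner_smul_right, F.inner_op_smul_right, mul_smul_comm]

/-- The operator `A → F`, `a ↦ x a`, given by a vector `x ∈ F`. -/
def Adjointable.ofVector (x : F) : Adjointable (self A) F where
  toCLM := LinearMap.mkContinuous
    { toFun := fun a : A => op a • x
      map_add' := fun a b => add_smul (op (show A from a)) (op (show A from b)) x
      map_smul' := fun c a => F.op_smul_smul c a x }
    ‖x‖ (fun a => by rw [mul_comm]; exact F.norm_op_smul_le a x)
  adj := LinearMap.mkContinuous
    { toFun := fun y => F.inner x y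
      map_add' := F.inner_add_right x
      map_smul' := fun c y => F.inner_smul_right x y c }
    ‖x‖ (F.norm_inner_le x)
  inner_adj a y := F.inner_op_smul_left x y a

theorem Adjointable.norm_ofVector_le (x : F) : ‖ofVector x‖ ≤ ‖x‖ :=
  ContinuousLinearMap.opNorm_le_bound _ (norm_nonneg x) fun a => by
    rw [mul_comm]; exact F.norm_op_smul_le a x

end HilbertModule

namespace CStarCorrespondence

open HilbertModule HilbertModule.Adjointable UniformSpace

variable (E : CStarCorrespondence A)

/-- The internal tensor powers `E⁰ = A`, `Eⁿ⁺¹ = Eⁿ ⊗_A E` (so `E¹ = A ⊗_A E ≅ E`). -/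
def tpow : ℕ → HilbertModule A
  | 0 => HilbertModule.self A
  | n + 1 => (tpow n).tensor E

theorem finite_ne_zero (x : Π₀ n, tpow E n) (f : ∀ n, tpow E n → A) (hf : ∀ n, f n 0 = 0) :
    (Function.support fun n => f n (x n)).Finite := by
  refine (DFinsupp.finite_support x).subset fun n hn => ?_
  intro h
  exact hn ((congrArg (f n) h).trans (hf n))

/-- The algebraic direct sum of the `Eⁿ` with `⟪x, y⟫ = ∑ ⟪x n, y n⟫`. -/
def preFock : PreHilbertModule A where
  carrier := Π₀ n, tpow E n
  inner x y := ∑ᶠ n, (tpow E n).inner (x n) (y n)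
  inner_add_right x y z := by
    rw [← finsum_add_distrib]
    · exact finsum_congr fun n => (tpow E n).inner_add_right _ _ _
    · exact finite_ne_zero E y _ fun n => (tpow E n).inner_zero_right _
    · exact finite_ne_zero E z _ fun n => (tpow E n).inner_zero_right _
  inner_smul_right x y c := by
    rw [smul_finsum]
    exact finsum_congr fun n => (tpow E n).inner_smul_right _ _ _
  inner_op_smul_right x y a := by
    rw [finsum_mul' _ _ (finite_ne_zero E y _ fun n => (tpow E n).inner_zero_right _)]
    exact finsum_congr fun n => (tpow E n).inner_op_smul_right _ _ _
  star_inner x y := by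
    refine (AddMonoidHom.map_finsum (starAddEquiv : A ≃+ A).toAddMonoidHom
      (finite_ne_zero E y _ fun n => (tpow E n).inner_zero_right (x n))).trans ?_
    exact finsum_congr fun n => (tpow E n).star_inner _ _
  inner_self_nonneg x := finsum_nonneg fun n => (tpow E n).inner_self_nonneg _

/-- The inclusion of the `n`-th summand into the algebraic direct sum. -/
def preSingle (n : ℕ) : tpow E n →ₗ[ℂ] preFock E :=
  DFinsupp.lsingle (R := ℂ) (M := fun n => tpow E n) n

/-- The projection of the algebraic direct sum onto the `n`-th summand. -/
def preCoord (n : ℕ) : preFock E →ₗ[ℂ] tpow E n :=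
  DFinsupp.lapply (R := ℂ) (M := fun n => tpow E n) n

variable {E} in
theorem preFock_ext {x y : preFock E} (h : ∀ n, preCoord E n x = preCoord E n y) : x = y :=
  DFinsupp.ext h

theorem preCoord_single_same (n : ℕ) (a : tpow E n) : preCoord E n (preSingle E n a) = a :=
  DFinsupp.single_eq_same

theorem preCoord_single_ne {m n : ℕ} (h : m ≠ n) (a : tpow E n) :
    preCoord E m (preSingle E n a) = 0 :=
  DFinsupp.single_eq_of_ne h

theorem preFock_induction {p : preFock E → Prop} (x : preFock E) (h0 : p 0)
    (hs : ∀ n a, p (preSingle E n a)) (ha : ∀ x y, p x → p y → p (x + y)) : p x :=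
  DFinsupp.induction (p := p) x h0 fun n a _ _ _ h => ha _ _ (hs n a) h

theorem preFock_finite (x : preFock E) (f : ∀ n, tpow E n → A) (hf : ∀ n, f n 0 = 0) :
    (Function.support fun n => f n (preCoord E n x)).Finite :=
  finite_ne_zero E x f hf

theorem preFock_inner (x y : preFock E) :
    (preFock E).inner x y = ∑ᶠ n, (tpow E n).inner (preCoord E n x) (preCoord E n y) := rfl

theorem preFock_inner_single (n : ℕ) (a : tpow E n) (y : preFock E) :
    (preFock E).inner (preSingle E n a) y = (tpow E n).inner a (preCoord E n y) := by
  rw [preFock_inner, finsum_eq_single _ n, preCoord_single_same]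
  intro m hm
  rw [preCoord_single_ne E hm, (tpow E m).inner_zero_left]

/-- The Fock module `Γ_E = ⨁ Eⁿ` (Hilbert module direct sum). -/
def fock : HilbertModule A := (preFock E).completion

theorem norm_preSingle_le (n : ℕ) (x : tpow E n) : ‖preSingle E n x‖ ≤ 1 * ‖x‖ := by
  rw [one_mul, PreHilbertModule.norm_def, HilbertModule.norm_eq, preFock_inner_single,
    preCoord_single_same]

theorem norm_preCoord_le (n : ℕ) (x : preFock E) : ‖preCoord E n x‖ ≤ 1 * ‖x‖ := by
  rw [one_mul, PreHilbertModule.norm_def, HilbertModule.norm_eq]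
  refine Real.sqrt_le_sqrt ?_
  refine CStarAlgebra.norm_le_norm_of_nonneg_of_le ((tpow E n).inner_self_nonneg _) ?_
  exact single_le_finsum n (preFock_finite E x (fun m => (tpow E m).inner (preCoord E m x))
    fun m => (tpow E m).inner_zero_right _) fun m => (tpow E m).inner_self_nonneg _

theorem inner_incl (n : ℕ) (x : tpow E n) (y : Completion (preFock E)) :
    (preFock E).complInner (preSingle E n x : Completion (preFock E)) y
      = (tpow E n).inner x (((preCoord E n).mkContinuous 1 (norm_preCoord_le E n)).fromCompletion
        y) := by
  refine Completion.induction_on y (isClosed_eq ?_ ?_) fun a => ?_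
  · exact (preFock E).continuous_complInner' continuous_const continuous_id
  · exact (tpow E n).continuous_inner.comp
      (Continuous.prodMk continuous_const (ContinuousLinearMap.continuous _))
  · rw [(preFock E).complInner_coe, preFock_inner_single,
      ContinuousLinearMap.fromCompletion_apply_coe]
    rfl

/-- The isometric inclusion `Eⁿ → Γ_E`; its adjoint is the projection onto the `n`-th summand. -/
def incl (n : ℕ) : Adjointable (tpow E n) (fock E) where
  toCLM := (Completion.toComplL (𝕜 := ℂ) (E := preFock E)).comp
    ((preSingle E n).mkContinuous 1 (norm_preSingle_le E n))
  adj := ((preCoord E n).mkContinuous 1 (norm_preCoord_le E n)).fromCompletion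
  inner_adj := inner_incl E n

/-- The creation operator with `μ ∈ Eʳ` on the `n`-th summand, `Eⁿ → Eʳ⁺ⁿ`, `x ↦ μ ⊗ x`: it is
`a ↦ μ a` on `E⁰ = A`, and `x ⊗ ξ ↦ (μ ⊗ x) ⊗ ξ` on `Eⁿ⁺¹ = Eⁿ ⊗_A E`. -/
def createLevel {r : ℕ} (μ : tpow E r) : ∀ n : ℕ, Adjointable (tpow E n) (tpow E (r + n))
  | 0 => ofVector μ
  | n + 1 => tensorId E (createLevel μ n)

theorem norm_createLevel_le {r : ℕ} (μ : tpow E r) (n : ℕ) : ‖createLevel E μ n‖ ≤ ‖μ‖ := by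
  induction n with
  | zero => exact norm_ofVector_le μ
  | succ n ih => exact (norm_tensorId_le E _).trans ih

section create

variable {r : ℕ} (μ : tpow E r)

/-- The creation operator on the algebraic Fock module. -/
def preCreate : preFock E →ₗ[ℂ] preFock E :=
  DFinsupp.lsum (R := ℂ) (M := fun n => tpow E n) ℂ fun n =>
    (preSingle E (r + n)).comp (createLevel E μ n).toCLM.toLinearMap

/-- The annihilation operator on the algebraic Fock module. -/
def preAnnihilate : preFock E →ₗ[ℂ] preFock E where
  toFun := fun y : Π₀ n, tpow E n => (DFinsupp.mapRange (fun n => (createLevel E μ n).adjoint)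
    (fun n => Adjointable.map_zero _)
    (DFinsupp.comapDomain (fun n => r + n) (add_right_injective r) y) : Π₀ n, tpow E n)
  map_add' x y := by
    refine DFinsupp.ext fun n => ?_
    exact Adjointable.map_add _ _ _
  map_smul' c x := by
    refine DFinsupp.ext fun n => ?_
    exact Adjointable.map_smul _ _ _

theorem preAnnihilate_coord (y : preFock E) (n : ℕ) :
    preCoord E n (preAnnihilate E μ y) = (createLevel E μ n).adjoint (preCoord E (r + n) y) :=
  rfl

theorem preCreate_single (n : ℕ) (a : tpow E n) :
    preCreate E μ (preSingle E n a) = preSingle E (r + n) (createLevel E μ n a) :=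
  DFinsupp.lsum_single (R := ℂ) (M := fun n => tpow E n) ℂ _ n a

theorem preCreate_adjoint (x y : preFock E) :
    (preFock E).inner (preCreate E μ x) y = (preFock E).inner x (preAnnihilate E μ y) := by
  induction x using preFock_induction with
  | h0 => rw [_root_.map_zero, PreHilbertModule.inner_zero_left, PreHilbertModule.inner_zero_left]
  | hs n a =>
    rw [preCreate_single, preFock_inner_single, preFock_inner_single, preAnnihilate_coord,
      Adjointable.inner_left]
  | ha x x' hx hx' =>
    rw [_root_.map_add, PreHilbertModule.inner_add_left, PreHilbertModule.inner_add_left, hx, hx']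

theorem preCreate_coord (x : preFock E) (n : ℕ) :
    preCoord E (r + n) (preCreate E μ x) = createLevel E μ n (preCoord E n x) := by
  induction x using preFock_induction with
  | h0 => simp only [_root_.map_zero, Adjointable.map_zero]
  | hs m a =>
    rw [preCreate_single]
    by_cases hm : n = m
    · subst hm; rw [preCoord_single_same, preCoord_single_same]
    · rw [preCoord_single_ne E hm, preCoord_single_ne E (by omega), Adjointable.map_zero]
  | ha x x' hx hx' => simp only [_root_.map_add, Adjointable.map_add, hx, hx']

theorem norm_preCreate_le (x : preFock E) : ‖preCreate E μ x‖ ≤ ‖μ‖ * ‖x‖ := by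
  rw [PreHilbertModule.norm_def, PreHilbertModule.norm_def, ← Real.sqrt_sq (norm_nonneg μ),
    ← Real.sqrt_mul (sq_nonneg _), ← Real.norm_of_nonneg (sq_nonneg ‖μ‖), ← norm_smul]
  refine Real.sqrt_le_sqrt ?_
  refine CStarAlgebra.norm_le_norm_of_nonneg_of_le ((preFock E).inner_self_nonneg _) ?_
  rw [preCreate_adjoint, preFock_inner, preFock_inner, smul_finsum]
  rw [← sub_nonneg, ← finsum_sub_distrib]
  · refine finsum_nonneg fun n => ?_
    rw [preAnnihilate_coord, preCreate_coord, ← Adjointable.inner_left]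
    obtain ⟨S, hS⟩ := (createLevel E μ n).exists_sq_sub (norm_createLevel_le E μ n)
    rw [hS]
    exact (tpow E n).inner_self_nonneg _
  · exact preFock_finite E x (fun n z => ‖μ‖ ^ 2 • (tpow E n).inner z (preCoord E n x)) fun n => by
      rw [(tpow E n).inner_zero_left, smul_zero]
  · exact preFock_finite E x (fun n z => (tpow E n).inner z _) fun n =>
      (tpow E n).inner_zero_left _

/-- The creation (Toeplitz) operator `t_μ` on the Fock module, `t_μ x = μ ⊗ x`, for `μ ∈ Eʳ`. -/
def create : Adjointable (fock E) (fock E) :=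
  ofPre (preCreate E μ) (preAnnihilate E μ) (preCreate_adjoint E μ) ‖μ‖ (norm_preCreate_le E μ)

theorem norm_create_le : ‖create E μ‖ ≤ ‖μ‖ := norm_ofPre_le _ _ _ _ (norm_nonneg μ) _

theorem create_incl (n : ℕ) (a : tpow E n) :
    create E μ (incl E n a) = incl E (r + n) (createLevel E μ n a) := by
  refine (ofPre_coe (preCreate E μ) _ _ _ _ (preSingle E n a)).trans ?_
  rw [preCreate_single]
  rfl

end create

end CStarCorrespondence

namespace HilbertModule

open Adjointable UniformSpace

theorem tensor_induction {F : HilbertModule A} {E : CStarCorrespondence A}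
    {p : F.tensor E → Prop} (z : F.tensor E) (hc : IsClosed {z | p z}) (h0 : p 0)
    (ht : ∀ x y, p (tmul x y)) (ha : ∀ z w, p z → p w → p (z + w)) : p z := by
  refine Completion.induction_on (α := preTensor F E) z hc fun v => ?_
  refine Finsupp.induction (motive := fun v : F →₀ E.toHilbertModule =>
    p (Completion.coe' (α := preTensor F E) v)) v h0 fun x y v _ _ h => ?_
  have := ha _ _ (ht x y) h
  exact (congrArg p (Completion.coe_add (α := preTensor F E) (Finsupp.single x y) v)).mpr this

theorem op_smul_smul_comm (F : HilbertModule A) (c : ℂ) (a : A) (x : F) :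
    op a • c • x = c • op a • x :=
  F.ext_inner fun w => by
    rw [F.inner_op_smul_right, F.inner_smul_right, F.inner_smul_right, F.inner_op_smul_right,
      smul_mul_assoc]

theorem Adjointable.isClosed_eq {F G : HilbertModule A} (S T : Adjointable F G) :
    IsClosed {z | S z = T z} :=
  _root_.isClosed_eq S.toCLM.continuous T.toCLM.continuous

theorem Adjointable.tensor_ext {F G : HilbertModule A} {E : CStarCorrespondence A}
    {S T : Adjointable (F.tensor E) G} (h : ∀ x y, S (tmul x y) = T (tmul x y)) : S = T := by
  ext z
  induction z using tensor_induction with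
  | hc => exact Adjointable.isClosed_eq S T
  | h0 => rw [Adjointable.map_zero, Adjointable.map_zero]
  | ht x y => exact h x y
  | ha z w hz hw => rw [Adjointable.map_add, Adjointable.map_add, hz, hw]

theorem tmul_add_left {F : HilbertModule A} {E : CStarCorrespondence A} (x x' : F)
    (y : E.toHilbertModule) : (tmul (x + x') y : F.tensor E) = tmul x y + tmul x' y := by
  refine (F.tensor E).ext_inner fun z => ?_
  rw [(F.tensor E).inner_add_right, ← (F.tensor E).star_inner (tmul (x + x') y),
    ← (F.tensor E).star_inner (tmul x y), ← (F.tensor E).star_inner (tmul x' y), ← star_add]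
  congr 1
  induction z using tensor_induction with
  | hc =>
    refine _root_.isClosed_eq ?_ (Continuous.add ?_ ?_) <;>
    exact (F.tensor E).continuous_inner.comp (Continuous.prodMk continuous_const continuous_id)
  | h0 => simp only [inner_zero_right, add_zero]
  | ht a b =>
    rw [inner_tmul, inner_tmul, inner_tmul, F.inner_add_left, _root_.map_add, Adjointable.add_apply,
      E.inner_add_right]
  | ha z w hz hw =>
    simp only [HilbertModule.inner_add_right, hz, hw]
    abel

theorem tmul_smul_left {F : HilbertModule A} {E : CStarCorrespondence A} (c : ℂ) (x : F)
    (y : E.toHilbertModule) : (tmul (c • x) y : F.tensor E) = c • tmul x y := by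
  refine (F.tensor E).ext_inner fun z => ?_
  rw [(F.tensor E).inner_smul_right]
  induction z using tensor_induction with
  | hc =>
    refine _root_.isClosed_eq ?_ (Continuous.const_smul ?_ c) <;>
    exact (F.tensor E).continuous_inner.comp (Continuous.prodMk continuous_id continuous_const)
  | h0 => simp only [HilbertModule.inner_zero_left, smul_zero]
  | ht a b =>
    rw [inner_tmul, inner_tmul, F.inner_smul_right, _root_.map_smul, Adjointable.smul_apply,
      E.inner_smul_right]
  | ha z w hz hw =>
    simp only [HilbertModule.inner_add_left, hz, hw, smul_add]

theorem Adjointable.tensorId_add {F G : HilbertModule A} (E : CStarCorrespondence A)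
    (S T : Adjointable F G) : tensorId E (S + T) = tensorId E S + tensorId E T :=
  tensor_ext fun x y => by
    rw [tensorId_tmul, Adjointable.add_apply, Adjointable.add_apply, tmul_add_left, tensorId_tmul,
      tensorId_tmul]

theorem Adjointable.tensorId_smul {F G : HilbertModule A} (E : CStarCorrespondence A)
    (c : ℂ) (T : Adjointable F G) : tensorId E (c • T) = c • tensorId E T :=
  tensor_ext fun x y => by
    rw [tensorId_tmul, Adjointable.smul_apply, Adjointable.smul_apply, tmul_smul_left,
      tensorId_tmul]

theorem Adjointable.tensorId_comp {F G H : HilbertModule A} (E : CStarCorrespondence A)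
    (S : Adjointable G H) (T : Adjointable F G) :
    tensorId E (S.comp T) = (tensorId E S).comp (tensorId E T) :=
  tensor_ext fun x y => by
    rw [tensorId_tmul, Adjointable.comp_apply, Adjointable.comp_apply, tensorId_tmul,
      tensorId_tmul]

end HilbertModule

namespace CStarCorrespondence

open HilbertModule HilbertModule.Adjointable UniformSpace

variable (E : CStarCorrespondence A)

variable {E} in
theorem fock_ext {G : HilbertModule A} {S T : Adjointable (fock E) G}
    (h : ∀ n a, S (incl E n a) = T (incl E n a)) : S = T := by
  ext z
  refine Completion.induction_on (α := preFock E) z (Adjointable.isClosed_eq S T) fun v => ?_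
  induction v using preFock_induction with
  | h0 => exact (Adjointable.map_zero S).trans (Adjointable.map_zero T).symm
  | hs n a => exact h n a
  | ha x y hx hy =>
    have h2 : ((x + y : preFock E) : Completion (preFock E)) = x + y := Completion.coe_add _ _
    rw [h2]
    exact (Adjointable.map_add S _ _).trans ((congrArg₂ _ hx hy).trans
      (Adjointable.map_add T _ _).symm)

theorem createLevel_add {r : ℕ} (μ ν : tpow E r) (n : ℕ) :
    createLevel E (μ + ν) n = createLevel E μ n + createLevel E ν n := by
  induction n with
  | zero => exact Adjointable.ext fun a => smul_add (op (show A from a)) μ ν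
  | succ n ih => exact (congrArg (tensorId E) ih).trans (tensorId_add E _ _)

theorem createLevel_smul {r : ℕ} (c : ℂ) (μ : tpow E r) (n : ℕ) :
    createLevel E (c • μ) n = c • createLevel E μ n := by
  induction n with
  | zero =>
    exact Adjointable.ext fun a => op_smul_smul_comm (A := A) (tpow E r) c (show A from a) μ
  | succ n ih => exact (congrArg (tensorId E) ih).trans (tensorId_smul E _ _)

/-- `μ ↦ t_μ` as a linear map. -/
def createHom (r : ℕ) : tpow E r →ₗ[ℂ] Adjointable (fock E) (fock E) where
  toFun := create E
  map_add' μ ν := fock_ext fun n a => by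
    rw [Adjointable.add_apply, create_incl, create_incl, create_incl, createLevel_add,
      Adjointable.add_apply, Adjointable.map_add]
  map_smul' c μ := fock_ext fun n a => by
    rw [RingHom.id_apply, Adjointable.smul_apply, create_incl, create_incl, createLevel_smul,
      Adjointable.smul_apply, Adjointable.map_smul]

theorem continuous_create (r : ℕ) : Continuous (create E (r := r)) :=
  ((createHom E r).mkContinuous 1 fun μ => by
    rw [one_mul]; exact norm_create_le E μ).continuous

/-- An element of `A` as an element of `E⁰ = A`. -/
def ofA (a : A) : tpow E 0 := a

/-- The elementary tensor `x ⊗ ξ ∈ Eⁿ⁺¹` of `x ∈ Eⁿ` and `ξ ∈ E`. -/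
def tmulVec {n : ℕ} (x : tpow E n) (ξ : E.toHilbertModule) : tpow E (n + 1) := tmul x ξ

/-- A vector `ξ ∈ E` as a vector of `E¹ = A ⊗_A E`. -/
def toTpow (ξ : E.toHilbertModule) : tpow E 1 := tmulVec E (ofA E 1) ξ

/-- The Toeplitz–Pimsner algebra `T_E`: the C⋆-subalgebra of the adjointable operators on the
Fock module generated by `A` (acting by left multiplication, i.e. by the `t_a` with
`a ∈ E⁰ = A`) and by the `t_ξ` with `ξ ∈ E`. -/
def toeplitz : StarSubalgebra ℂ (Adjointable (fock E) (fock E)) :=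
  (StarAlgebra.adjoin ℂ
    ({T | ∃ a : A, T = create E (ofA E a)} ∪
      {T | ∃ ξ : E.toHilbertModule, T = create E (toTpow E ξ)})).topologicalClosure

theorem tensorId_heq {F : HilbertModule A} {p q : ℕ} (h : p = q) (S : Adjointable F (tpow E p))
    (T : Adjointable F (tpow E q)) (hST : S ≍ T) : tensorId E S ≍ tensorId E T := by
  subst h; rw [eq_of_heq hST]

theorem createLevel_tmul {r : ℕ} (μ : tpow E r) (ξ : E.toHilbertModule) (n : ℕ) :
    createLevel E (tmulVec E μ ξ) n ≍
      (createLevel E μ (1 + n)).comp (createLevel E (toTpow E ξ) n) := by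
  induction n with
  | zero =>
    refine heq_of_eq (Adjointable.ext fun a => ?_)
    refine Eq.trans ?_ (Adjointable.map_op_smul (tensorId E (ofVector μ)) a _).symm
    refine congrArg _ (Eq.trans ?_ (tensorId_tmul E (ofVector μ) _ _).symm)
    exact congrArg (fun z => tmulVec E z ξ) (one_smul Aᵐᵒᵖ μ).symm
  | succ n ih =>
    have h : r + 1 + n = r + (1 + n) := by omega
    refine (tensorId_heq E h _ _ ih).trans (heq_of_eq ?_)
    exact tensorId_comp E _ _

theorem incl_heq {F : HilbertModule A} {p q : ℕ} (h : p = q) (S : Adjointable F (tpow E p))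
    (T : Adjointable F (tpow E q)) (hST : S ≍ T) (x : F) : incl E p (S x) = incl E q (T x) := by
  subst h; rw [eq_of_heq hST]

theorem create_tmul {r : ℕ} (μ : tpow E r) (ξ : E.toHilbertModule) :
    create E (tmulVec E μ ξ) = create E μ * create E (toTpow E ξ) :=
  fock_ext fun n a => by
    rw [Adjointable.mul_apply, create_incl, create_incl, create_incl]
    exact incl_heq E (by omega) _ _ (createLevel_tmul E μ ξ n) a

theorem isClosed_toeplitz : IsClosed (toeplitz E : Set (Adjointable (fock E) (fock E))) :=
  StarSubalgebra.isClosed_topologicalClosure _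

theorem create_mem_toeplitz {r : ℕ} (μ : tpow E r) : create E μ ∈ toeplitz E := by
  induction r with
  | zero =>
    exact StarSubalgebra.le_topologicalClosure _ (StarAlgebra.subset_adjoin _ _ (.inl ⟨μ, rfl⟩))
  | succ r ih =>
    have h0 : createHom E (r + 1) 0 ∈ toeplitz E := by
      rw [_root_.map_zero]; exact zero_mem (toeplitz E)
    have ha : ∀ z w, createHom E (r + 1) z ∈ toeplitz E → createHom E (r + 1) w ∈ toeplitz E →
        createHom E (r + 1) (z + w) ∈ toeplitz E := fun z w hz hw => by
      rw [_root_.map_add]; exact add_mem hz hw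
    refine tensor_induction (F := tpow E r) (E := E)
      (p := fun z => createHom E (r + 1) z ∈ toeplitz E) μ ?_ h0 ?_ ha
    · exact (isClosed_toeplitz E).preimage (continuous_create E (r + 1))
    · intro x y
      change create E (tmulVec E x y) ∈ toeplitz E
      rw [create_tmul]
      exact mul_mem (ih x) (StarSubalgebra.le_topologicalClosure _
        (StarAlgebra.subset_adjoin _ _ (.inr ⟨y, rfl⟩)))

/-- The generator `t_μ` of the Toeplitz–Pimsner algebra, for `μ ∈ Eʳ`. -/
def t {r : ℕ} (μ : tpow E r) : toeplitz E := ⟨create E μ, create_mem_toeplitz E μ⟩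

/-- The ideal `K(Γ_E) ∩ T_E` of `T_E`. -/
def compactIdeal : Ideal (toeplitz E) where
  carrier := {x | (x : Adjointable (fock E) (fock E)) ∈ compacts (fock E)}
  add_mem' := fun hx hy => (compacts (fock E)).add_mem hx hy
  zero_mem' := (compacts (fock E)).zero_mem
  smul_mem' := fun c _ hx => mul_mem_compacts (c : Adjointable (fock E) (fock E)) hx

instance : (compactIdeal E).IsTwoSided where
  mul_mem_of_left b h := mem_mul_compacts (b : Adjointable (fock E) (fock E)) h

theorem star_mem_compactIdeal {x : toeplitz E} (hx : x ∈ compactIdeal E) :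
    star x ∈ compactIdeal E := star_mem_compacts hx

instance : IsClosed (compactIdeal E : Set (toeplitz E)) :=
  (Submodule.isClosed_topologicalClosure _).preimage continuous_subtype_val

/-- The Cuntz–Pimsner algebra `O_E = T_E / K(Γ_E)`. -/
def CuntzPimsner : Type u := toeplitz E ⧸ compactIdeal E

namespace CuntzPimsner

instance : Ring (CuntzPimsner E) := inferInstanceAs (Ring (toeplitz E ⧸ compactIdeal E))

instance : Algebra ℂ (CuntzPimsner E) :=
  inferInstanceAs (Algebra ℂ (toeplitz E ⧸ compactIdeal E))

/-- The quotient norm. -/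
instance : NormedAddCommGroup (CuntzPimsner E) :=
  inferInstanceAs (NormedAddCommGroup (toeplitz E ⧸ compactIdeal E))

/-- The quotient map `p : T_E → O_E`. -/
def p : toeplitz E →ₐ[ℂ] CuntzPimsner E := Ideal.Quotient.mkₐ ℂ (compactIdeal E)

instance : Star (CuntzPimsner E) where
  star := Quotient.map' star (by
    intro x y h
    rw [Submodule.quotientRel_def] at h ⊢
    rw [← star_sub]
    exact star_mem_compactIdeal E h)

theorem star_p (x : toeplitz E) : star (p E x) = p E (star x) := rfl

theorem p_surjective : Function.Surjective (p E) := Ideal.Quotient.mk_surjective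

instance : StarRing (CuntzPimsner E) where
  star_involutive a := by
    obtain ⟨x, rfl⟩ := p_surjective E a
    rw [star_p, star_p, star_star]
  star_mul a b := by
    obtain ⟨x, rfl⟩ := p_surjective E a
    obtain ⟨y, rfl⟩ := p_surjective E b
    rw [← map_mul, star_p, star_p, star_p, star_mul, map_mul]
  star_add a b := by
    obtain ⟨x, rfl⟩ := p_surjective E a
    obtain ⟨y, rfl⟩ := p_surjective E b
    rw [← _root_.map_add, star_p, star_p, star_p, star_add, _root_.map_add]

end CuntzPimsner

/-- The image `s_μ` of `t_μ` in the Cuntz–Pimsner algebra. -/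
def s {r : ℕ} (μ : tpow E r) : CuntzPimsner E := CuntzPimsner.p E (t E μ)

/-- The projection `P_N` of the Fock module onto `Γ_E^{(N)} = A ⊕ E ⊕ ⋯ ⊕ E^N`. -/
def P (N : ℕ) : Adjointable (fock E) (fock E) :=
  ∑ n ∈ Finset.range (N + 1), (incl E n).comp (incl E n).adjoint

/-- The compression `φ_N(x) = P_N x P_N`; the algebra of adjointable operators on `Γ_E^{(N)}` is
identified with the corner cut out by `P_N`. -/
def compress (N : ℕ) (x : Adjointable (fock E) (fock E)) : Adjointable (fock E) (fock E) :=
  P E N * x * P E N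

/-- `T ⊗ I_{E^k} : E^{j+k} → E^{i+k}` for `T : E^j → E^i`. -/
def tensorPowId {i j : ℕ} (T : Adjointable (tpow E j) (tpow E i)) :
    ∀ k : ℕ, Adjointable (tpow E (j + k)) (tpow E (i + k))
  | 0 => T
  | k + 1 => tensorId E (tensorPowId T k)

/-- `x ⊗ I_{E^k} = ∑_{i,j ≤ N} x_{ij} ⊗ I_{E^k}` as an operator on the Fock module, where
`x_{ij} : E^j → E^i` are the blocks of the operator `x` on `Γ_E^{(N)}`. -/
def amplify (N : ℕ) (x : Adjointable (fock E) (fock E)) (k : ℕ) :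
    Adjointable (fock E) (fock E) :=
  ∑ i ∈ Finset.range (N + 1), ∑ j ∈ Finset.range (N + 1),
    (incl E (i + k)).comp ((tensorPowId E ((incl E i).adjoint.comp (x.comp (incl E j))) k).comp
      (incl E (j + k)).adjoint)

end CStarCorrespondence

namespace HilbertModule.Adjointable

variable {F : HilbertModule A}

/-- The series `∑ f k` of adjointable operators converges to `y` in the strict topology (the
topology of pointwise norm convergence of operators and of their adjoints). -/
def HasStrictSum (f : ℕ → Adjointable F F) (y : Adjointable F F) : Prop :=
  ∀ z, HasSum (fun k => f k z) (y z) ∧ HasSum (fun k => star (f k) z) (star y z)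

open Classical in
/-- The strict sum of a series of adjointable operators (zero if it does not converge). -/
def strictSum (f : ℕ → Adjointable F F) : Adjointable F F :=
  if h : ∃ y, HasStrictSum f y then h.choose else 0

end HilbertModule.Adjointable

namespace CStarCorrespondence

open HilbertModule HilbertModule.Adjointable

variable (E : CStarCorrespondence A)

/-- `Ψ_N(x) = (N + 1)⁻¹ ∑_{k ≥ 0} x ⊗ I_{E^k}`, with strict convergence of the series. -/
def Psi (N : ℕ) (x : Adjointable (fock E) (fock E)) : Adjointable (fock E) (fock E) :=
  ((N : ℂ) + 1)⁻¹ • strictSum (amplify E N x)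

/-- The map `Ψ_N ∘ φ_N` on the adjointable operators of the Fock module. -/
def PsiPhi (N : ℕ) (x : Adjointable (fock E) (fock E)) : Adjointable (fock E) (fock E) :=
  Psi E N (compress E N x)

/-- The map `V_N = p ∘ Ψ_N ∘ φ_N : T_E → O_E`, defined once `Ψ_N ∘ φ_N` maps `T_E` into `T_E`. -/
def V (N : ℕ) (hN : ∀ x ∈ toeplitz E, PsiPhi E N x ∈ toeplitz E) (x : toeplitz E) :
    CuntzPimsner E :=
  CuntzPimsner.p E ⟨PsiPhi E N x, hN x x.2⟩

end CStarCorrespondence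

end

/-! Write Q_p for the projection `levelProj p` of Γ_E onto E^p. An isometry σ : Γ_E ⊗ E → Γ_E
carries E^n ⊗ E onto E^{n+1}, so T ↦ σ (T ⊗ I_E) σ⋆ is a ⋆-endomorphism `amp` of L(Γ_E). Its k-th
power `ampPow k` sends P_N to the projection onto the window of levels k, …, k + N, and x ⊗ I_{E^k}
is `ampPow k (P_N x P_N)`, that is, `ampPow k x` cut down to this window. Every level lies in at
most N + 1 windows, so a Cauchy–Schwarz argument bounds all finite partial sums by (N + 1)‖x‖
(`norm_sum_compress_le`, `sum_inner_ampPow_P_le`). On a vector of a single level only finitely many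
terms are nonzero; together with the bound this gives strict convergence (`exists_hasSum`), and the
factor 1/(N + 1) makes Ψ_N ∘ φ_N contractive. Each term is a compression followed by a
⋆-homomorphism, and positivity survives strict limits, which gives complete positivity
(`psiPhi_sum_nonneg`).

If E is finitely generated, the open mapping theorem makes a frame operator invertible and yields
vectors with ∑ e_i ⟪f_i, ·⟫ = 1 (`exists_frame`). In the Fock representation this reads ∑ t_{e_i}
t_{f_i}⋆ = 1 - Q_0, so Q_0 lies in T_E. As A is unital, Q_0 has rank one, and the operators t_μ Q_0
t_ν⋆ are the rank one operators between levels; hence K(Γ_E) ⊆ T_E. Since ∑ t_{e_i} Q_p t_{f_i}⋆ =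
Q_{p+1}, every Q_p is compact.

The value on words comes from `ampPow_create_levelProj`: amplification sends t_μ Q_p t_ν⋆ to t_μ
Q_{p+k} t_ν⋆. Compressing t_μ t_ν⋆ by P_N keeps the levels p < L with L = min(N+1-|μ|, N+1-|ν|),
truncated at 0. Summing over k leaves ∑_{l<L} t_μ (1 - Q_0 - ⋯ - Q_{l-1}) t_ν⋆, which is L t_μ t_ν⋆
modulo compact operators (`PsiPhi_create`). The coefficient L/(N+1) tends to 1, the words t_μ t_ν⋆
span a dense subspace of T_E (`toeplitz_le_closure`), and the V_N are contractions, so convergence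
extends to all of T_E. -/

noncomputable section

variable {A : Type u} [CStarAlgebra A] [PartialOrder A] [StarOrderedRing A]

/-! ### Algebra of adjointable operators and of T ↦ T ⊗ I_E -/

namespace HilbertModule

open Adjointable

namespace Adjointable

variable {F G H : HilbertModule A}

theorem star_eq_adjoint (T : Adjointable F F) : star T = T.adjoint := rfl

theorem mul_eq_comp (S T : Adjointable F F) : S * T = S.comp T := rfl

theorem adjoint_comp (S : Adjointable G H) (T : Adjointable F G) :
    (S.comp T).adjoint = T.adjoint.comp S.adjoint := rfl

theorem comp_assoc {K : HilbertModule A} (R : Adjointable H K) (S : Adjointable G H)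
    (T : Adjointable F G) : (R.comp S).comp T = R.comp (S.comp T) := rfl

theorem one_comp (T : Adjointable F G) : (1 : Adjointable G G).comp T = T := rfl

theorem comp_add (S : Adjointable G H) (T T' : Adjointable F G) :
    S.comp (T + T') = S.comp T + S.comp T' := ext fun x => S.map_add (T x) (T' x)

theorem add_comp (S S' : Adjointable G H) (T : Adjointable F G) :
    (S + S').comp T = S.comp T + S'.comp T := ext fun _ => rfl

theorem comp_smul (c : ℂ) (S : Adjointable G H) (T : Adjointable F G) :
    S.comp (c • T) = c • S.comp T := ext fun x => S.map_smul c (T x)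

theorem smul_comp (c : ℂ) (S : Adjointable G H) (T : Adjointable F G) :
    (c • S).comp T = c • S.comp T := ext fun _ => rfl

theorem zero_apply (x : F) : (0 : Adjointable F G) x = 0 := rfl

theorem zero_comp (T : Adjointable F G) : (0 : Adjointable G H).comp T = 0 := ext fun _ => rfl

theorem comp_zero (S : Adjointable G H) : S.comp (0 : Adjointable F G) = 0 :=
  ext fun _ => S.map_zero

theorem comp_sum {ι : Type*} (s : Finset ι) (S : Adjointable G H) (T : ι → Adjointable F G) :
    S.comp (∑ i ∈ s, T i) = ∑ i ∈ s, S.comp (T i) :=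
  map_sum (AddMonoidHom.mk' (fun T : Adjointable F G => S.comp T) (comp_add S)) T s

theorem sum_comp {ι : Type*} (s : Finset ι) (S : ι → Adjointable G H) (T : Adjointable F G) :
    (∑ i ∈ s, S i).comp T = ∑ i ∈ s, (S i).comp T :=
  map_sum (AddMonoidHom.mk' (fun S : Adjointable G H => S.comp T) fun S S' => add_comp S S' T) S s

theorem adjoint_sum {ι : Type*} (s : Finset ι) (T : ι → Adjointable F G) :
    (∑ i ∈ s, T i).adjoint = ∑ i ∈ s, (T i).adjoint :=
  map_sum (AddMonoidHom.mk' (fun T : Adjointable F G => T.adjoint) fun _ _ => rfl) T s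

theorem map_sub (T : Adjointable F G) (x y : F) : T (x - y) = T x - T y := T.toCLM.map_sub x y

theorem continuous (T : Adjointable F G) : Continuous T := T.toCLM.continuous

theorem tensorId_adjoint (E : CStarCorrespondence A) (T : Adjointable F G) :
    tensorId E T.adjoint = (tensorId E T).adjoint := toCLM_injective rfl

theorem tensorId_one (E : CStarCorrespondence A) :
    tensorId E (1 : Adjointable F F) = 1 :=
  tensor_ext fun x y => by rw [tensorId_tmul, one_apply, one_apply]

theorem tensorId_zero (E : CStarCorrespondence A) :
    tensorId E (0 : Adjointable F G) = 0 := by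
  simpa using tensorId_smul E 0 (0 : Adjointable F G)

theorem tensorId_sum {ι : Type*} (E : CStarCorrespondence A) (s : Finset ι)
    (T : ι → Adjointable F G) : tensorId E (∑ i ∈ s, T i) = ∑ i ∈ s, tensorId E (T i) :=
  map_sum (AddMonoidHom.mk' (tensorId E (F := F) (G := G)) (tensorId_add E)) T s

theorem norm_le_one_of_adjoint_comp_self {T : Adjointable F G} (h : ‖T.adjoint.comp T‖ ≤ 1) :
    ‖T‖ ≤ 1 := by
  have := T.norm_sq_le
  nlinarith [norm_nonneg T]

theorem norm_le_one_of_projection {T : Adjointable F F} (h : T.adjoint.comp T = T) : ‖T‖ ≤ 1 := by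
  have := T.norm_sq_le
  rw [h] at this
  nlinarith [norm_nonneg T]

/-- The difference of the two sides is ⟪S x, S x⟫, where S⋆S = c² - T⋆T. Unlike the norm estimate,
this inequality in the order of `A` can be summed over orthogonal pieces without loss. -/
theorem inner_apply_le (T : Adjointable F G) {c : ℝ} (hc : ‖T‖ ≤ c) (x : F) :
    G.inner (T x) (T x) ≤ c ^ 2 • F.inner x x := by
  obtain ⟨S, hS⟩ := T.exists_sq_sub hc
  rw [← sub_nonneg, hS]
  exact F.inner_self_nonneg _

end Adjointable

/-! ### Series of operators with bounded partial sums -/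

section Sums

variable {F G : HilbertModule A}

theorem hasSum_inner_right {ι : Type*} {f : ι → F} {y : F} (x : F) (h : HasSum f y) :
    HasSum (fun i => F.inner x (f i)) (F.inner x y) :=
  h.map (AddMonoidHom.mk' (F.inner x) (F.inner_add_right x))
    (F.continuous_inner.comp (Continuous.prodMk continuous_const continuous_id))

theorem hasSum_inner_left {ι : Type*} {f : ι → F} {y : F} (x : F) (h : HasSum f y) :
    HasSum (fun i => F.inner (f i) x) (F.inner y x) :=
  h.map (AddMonoidHom.mk' (fun y => F.inner y x) fun a b => F.inner_add_left a b x)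
    (F.continuous_inner.comp (Continuous.prodMk continuous_id continuous_const))

theorem Adjointable.hasSum_apply {ι : Type*} {f : ι → F} {y : F} (T : Adjointable F G)
    (h : HasSum f y) : HasSum (fun i => T (f i)) (T y) :=
  T.toCLM.hasSum h

/-- A family of operators with bounded finite partial sums that is summable at the points of a
dense set is summable at every point. -/
theorem Adjointable.summable_of_dense {ι : Type*} {f : ι → Adjointable F G} {C : ℝ}
    (hC : ∀ s : Finset ι, ‖∑ i ∈ s, f i‖ ≤ C) (hd : Dense {z | Summable fun i => f i z}) (z : F) :
    Summable fun i => f i z := by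
  have hC0 : 0 ≤ C := (norm_nonneg _).trans (hC ∅)
  rw [summable_iff_vanishing_norm]
  intro ε hε
  -- The radius makes C‖z - w‖ at most ε/2; `C + 1` replaces `C` so that the denominator is never
  -- zero.
  obtain ⟨w, hw, hzw⟩ := Metric.dense_iff.1 hd z (ε / (2 * (C + 1))) (by positivity)
  rw [Metric.mem_ball, dist_comm, dist_eq_norm] at hw
  obtain ⟨s, hs⟩ := summable_iff_vanishing_norm.1 hzw (ε / 2) (by positivity)
  refine ⟨s, fun t ht => ?_⟩
  have h1 : ∑ i ∈ t, f i z = ∑ i ∈ t, f i w + (∑ i ∈ t, f i) (z - w) := by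
    rw [map_sub, sum_apply, sum_apply]; abel
  have h2 : C * ‖z - w‖ ≤ ε / 2 := by
    calc C * ‖z - w‖ ≤ (C + 1) * (ε / (2 * (C + 1))) := by gcongr; linarith
      _ = ε / 2 := by field_simp
  calc ‖∑ i ∈ t, f i z‖ ≤ ‖∑ i ∈ t, f i w‖ + ‖(∑ i ∈ t, f i) (z - w)‖ := by
        rw [h1]; exact norm_add_le _ _
    _ ≤ ‖∑ i ∈ t, f i w‖ + C * ‖z - w‖ := by
        gcongr
        exact (norm_apply_le _ _).trans (by gcongr; exact hC t)
    _ < ε := by linarith [hs t ht]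

theorem Adjointable.norm_tsum_apply_le {ι : Type*} {f : ι → Adjointable F G} {C : ℝ}
    (hC : ∀ s : Finset ι, ‖∑ i ∈ s, f i‖ ≤ C) {z : F} (hz : Summable fun i => f i z) :
    ‖∑' i, f i z‖ ≤ C * ‖z‖ :=
  le_of_tendsto hz.hasSum.norm (Eventually.of_forall fun s => by
    rw [← sum_apply]
    exact (norm_apply_le _ _).trans (by gcongr; exact hC s))

/-- The pointwise sum of a pointwise summable family of operators with bounded partial sums. -/
def Adjointable.sumCLM {ι : Type*} (f : ι → Adjointable F G) (C : ℝ)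
    (hC : ∀ s : Finset ι, ‖∑ i ∈ s, f i‖ ≤ C) (h : ∀ z, Summable fun i => f i z) : F →L[ℂ] G :=
  LinearMap.mkContinuous
    { toFun := fun z => ∑' i, f i z
      map_add' := fun x y => by simp only [Adjointable.map_add]; exact (h x).tsum_add (h y)
      map_smul' := fun c x => by
        simp only [Adjointable.map_smul, RingHom.id_apply]; exact (h x).tsum_const_smul c }
    C fun z => norm_tsum_apply_le hC (h z)

/-- Strict convergence of a family of adjointable operators with bounded partial sums, tested on
dense sets. -/
theorem Adjointable.exists_hasSum {ι : Type*} {f : ι → Adjointable F G} {C : ℝ}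
    (hC : ∀ s : Finset ι, ‖∑ i ∈ s, f i‖ ≤ C) (hd : Dense {z | Summable fun i => f i z})
    (hd' : Dense {w | Summable fun i => (f i).adjoint w}) :
    ∃ y : Adjointable F G, ‖y‖ ≤ C ∧ (∀ z, HasSum (fun i => f i z) (y z)) ∧
      ∀ w, HasSum (fun i => (f i).adjoint w) (y.adjoint w) := by
  have hC' : ∀ s : Finset ι, ‖∑ i ∈ s, (f i).adjoint‖ ≤ C := fun s => by
    rw [← adjoint_sum, norm_adjoint]; exact hC s
  have h := summable_of_dense hC hd
  have h' := summable_of_dense hC' hd'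
  refine ⟨⟨sumCLM f C hC h, sumCLM _ C hC' h', fun x y => ?_⟩, ?_, fun z => (h z).hasSum,
    fun w => (h' w).hasSum⟩
  -- Both inner products are sums of the one series ∑ ⟪f i x, y⟫ = ∑ ⟪x, (f i)⋆ y⟫, so the pointwise
  -- sums of the `f i` and of their adjoints are adjoint to each other.
  · refine HasSum.unique (f := fun i => G.inner (f i x) y) (hasSum_inner_left y (h x).hasSum) ?_
    simp only [inner_left]
    exact hasSum_inner_right x (h' y).hasSum
  · exact ContinuousLinearMap.opNorm_le_bound _ ((norm_nonneg _).trans (hC ∅))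
      fun z => norm_tsum_apply_le hC (h z)

variable (F) in
/-- The families `ι → F` with the inner product `∑ i ∈ s, ⟪u i, v i⟫`. -/
def piPre {ι : Type} (s : Finset ι) : PreHilbertModule A where
  carrier := ι → F
  inner u v := ∑ i ∈ s, F.inner (u i) (v i)
  inner_add_right u v w := by
    rw [← Finset.sum_add_distrib]; exact Finset.sum_congr rfl fun i _ => F.inner_add_right _ _ _
  inner_smul_right u v c := by
    rw [Finset.smul_sum]; exact Finset.sum_congr rfl fun i _ => F.inner_smul_right _ _ _
  inner_op_smul_right u v a := by
    rw [Finset.sum_mul]; exact Finset.sum_congr rfl fun i _ => F.inner_op_smul_right _ _ _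
  star_inner u v := by
    rw [star_sum]; exact Finset.sum_congr rfl fun i _ => F.star_inner _ _
  inner_self_nonneg u := Finset.sum_nonneg fun i _ => F.inner_self_nonneg _

/-- This is Cauchy–Schwarz for the direct sum of copies of `F` indexed by `s`. Coordinates outside
`s` have length zero in `piPre`, which is harmless because a semi-definite inner product suffices.
-/
theorem norm_sum_inner_sq_le {ι : Type} (s : Finset ι) (u v : ι → F) :
    ‖∑ i ∈ s, F.inner (u i) (v i)‖ ^ 2
      ≤ ‖∑ i ∈ s, F.inner (u i) (u i)‖ * ‖∑ i ∈ s, F.inner (v i) (v i)‖ :=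
  (piPre F s).norm_inner_sq_le u v

/-- A sum of compressions `Q⋆ T Q` is bounded by the overlap of the `Q` times the norms of the
`T`. -/
theorem Adjointable.norm_sum_compress_le {ι : Type} (s : Finset ι) (Q T : ι → Adjointable F F)
    {C M : ℝ} (hC : 0 ≤ C) (hM : 0 ≤ M)
    (hQ : ∀ z, ∑ i ∈ s, F.inner (Q i z) (Q i z) ≤ C • F.inner z z) (hT : ∀ i ∈ s, ‖T i‖ ≤ M) :
    ‖∑ i ∈ s, star (Q i) * T i * Q i‖ ≤ C * M := by
  have hQn : ∀ z, ‖∑ i ∈ s, F.inner (Q i z) (Q i z)‖ ≤ C * ‖z‖ ^ 2 := fun z => by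
    have := CStarAlgebra.norm_le_norm_of_nonneg_of_le
      (Finset.sum_nonneg fun i _ => F.inner_self_nonneg _) (hQ z)
    rwa [norm_smul, Real.norm_of_nonneg hC, ← F.norm_sq_eq] at this
  refine norm_le_of _ (by positivity) fun z => ?_
  set S := ∑ i ∈ s, star (Q i) * T i * Q i with hS
  -- Only the second `S z` is expanded. The first stays whole, so that the overlap bound `hQn` can
  -- be applied to it as well as to `z`.
  have h1 : F.inner (S z) (S z) = ∑ i ∈ s, F.inner (Q i (S z)) (T i (Q i z)) := by
    conv_lhs => enter [3]; rw [hS, sum_apply]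
    rw [F.inner_sum_right]
    refine Finset.sum_congr rfl fun i _ => ?_
    rw [mul_apply, mul_apply, star_eq_adjoint, ← inner_left]
  have h2 : ‖∑ i ∈ s, F.inner (T i (Q i z)) (T i (Q i z))‖ ≤ M ^ 2 * (C * ‖z‖ ^ 2) := by
    refine (CStarAlgebra.norm_le_norm_of_nonneg_of_le
      (Finset.sum_nonneg fun i _ => F.inner_self_nonneg _)
      (Finset.sum_le_sum fun i hi => (T i).inner_apply_le (hT i hi) (Q i z))).trans ?_
    rw [← Finset.smul_sum, norm_smul, Real.norm_of_nonneg (sq_nonneg M)]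
    exact mul_le_mul_of_nonneg_left (hQn z) (sq_nonneg M)
  -- Cauchy–Schwarz gives ‖S z‖⁴ ≤ C ‖S z‖² · M² C ‖z‖²; dividing by ‖S z‖² leaves the square of the
  -- claim. The overlap `C` enters once from each side, under a square root.
  have h3 : (‖S z‖ ^ 2) ^ 2 ≤ (C * ‖S z‖ ^ 2) * (M ^ 2 * (C * ‖z‖ ^ 2)) := by
    conv_lhs => rw [F.norm_sq_eq, h1]
    exact (norm_sum_inner_sq_le s _ _).trans
      (mul_le_mul (hQn (S z)) h2 (norm_nonneg _) (by positivity))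
  rcases (norm_nonneg (S z)).eq_or_lt with h0 | h0
  · rw [← h0]; positivity
  · refine abs_le_of_sq_le_sq' ?_ (by positivity) |>.2
    have h4 : 0 < ‖S z‖ ^ 2 := by positivity
    refine le_of_mul_le_mul_right ?_ h4
    nlinarith

end Sums

/-! ### Positivity tested on vectors, and calculus of strict sums -/

section Positivity

variable {F : HilbertModule A}

theorem Adjointable.inner_nonneg {T : Adjointable F F} (hT : 0 ≤ T) (z : F) :
    0 ≤ F.inner z (T z) := by
  obtain ⟨S, rfl⟩ := CStarAlgebra.exists_star_mul_self hT
  rw [mul_apply, star_eq_adjoint, ← inner_left]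
  exact F.inner_self_nonneg _

/-- Let N = S⋆S be the negative part of `T`, so that T N = -N². On the vectors N w the form of `T`
equals -⟪S N w, S N w⟫, and nonnegativity forces S N = 0. Then N² = S⋆(S N) = 0, hence N = 0. -/
theorem Adjointable.nonneg_of_inner {T : Adjointable F F} (hsa : IsSelfAdjoint T)
    (h : ∀ z, 0 ≤ F.inner z (T z)) : 0 ≤ T := by
  obtain ⟨N, S, hN, hS, hTN, hpos⟩ := CStarAlgebra.exists_neg_part T hsa
  refine hpos ?_
  have hSN : S * N = 0 := by
    ext w
    refine F.inner_self_eq_zero (le_antisymm ?_ (F.inner_self_nonneg _))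
    have h1 := h (N w)
    rw [← mul_apply, hTN] at h1
    have h2 : F.inner (N w) ((-(N * N)) w) = -F.inner (S (N w)) (S (N w)) := by
      have : (-(N * N)) w = -(N (N w)) := rfl
      rw [this, inner_neg_right, inner_left S, ← star_eq_adjoint, ← mul_apply (Star.star S), ← hS]
    rw [h2] at h1
    exact neg_nonneg.1 h1
  have hNN : star N * N = 0 := by
    rw [hN]
    conv_lhs => enter [1]; rw [hS]
    rw [mul_assoc, hSN, mul_zero]
  exact CStarRing.star_mul_self_eq_zero_iff _ |>.1 hNN

theorem Adjointable.HasStrictSum.unique {f : ℕ → Adjointable F F} {y y' : Adjointable F F}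
    (h : HasStrictSum f y) (h' : HasStrictSum f y') : y = y' :=
  ext fun z => (h z).1.unique (h' z).1

theorem Adjointable.HasStrictSum.strictSum_eq {f : ℕ → Adjointable F F} {y : Adjointable F F}
    (h : HasStrictSum f y) : strictSum f = y := by
  have hex : ∃ y, HasStrictSum f y := ⟨y, h⟩
  rw [strictSum, dif_pos hex]
  exact hex.choose_spec.unique h

theorem Adjointable.HasStrictSum.add {f g : ℕ → Adjointable F F} {y w : Adjointable F F}
    (hf : HasStrictSum f y) (hg : HasStrictSum g w) : HasStrictSum (fun k => f k + g k) (y + w) :=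
  fun z => ⟨(hf z).1.add (hg z).1, (hf z).2.add (hg z).2⟩

theorem Adjointable.HasStrictSum.zero : HasStrictSum (fun _ => (0 : Adjointable F F)) 0 :=
  fun _ => ⟨hasSum_zero, hasSum_zero⟩

theorem Adjointable.HasStrictSum.sum {ι : Type*} (s : Finset ι) {f : ι → ℕ → Adjointable F F}
    {y : ι → Adjointable F F} (h : ∀ i ∈ s, HasStrictSum (f i) (y i)) :
    HasStrictSum (fun k => ∑ i ∈ s, f i k) (∑ i ∈ s, y i) := by
  classical
  induction s using Finset.induction_on with
  | empty => simpa using HasStrictSum.zero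
  | insert a s ha ih =>
    simp only [Finset.sum_insert ha]
    exact (h a (by simp)).add (ih fun i hi => h i (by simp [hi]))

theorem Adjointable.HasStrictSum.star {f : ℕ → Adjointable F F} {y : Adjointable F F}
    (h : HasStrictSum f y) : HasStrictSum (fun k => star (f k)) (star y) :=
  fun z => ⟨(h z).2, by simpa only [star_star] using (h z).1⟩

/-- For the adjoints, (S f_k)⋆ z = f_k⋆ (S⋆ z), so the given convergence is used at the vector S⋆ z.
-/
theorem Adjointable.HasStrictSum.mul_left {f : ℕ → Adjointable F F} {y : Adjointable F F}
    (h : HasStrictSum f y) (S : Adjointable F F) : HasStrictSum (fun k => S * f k) (S * y) :=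
  fun z => ⟨S.hasSum_apply (h z).1, by simpa only [star_mul, mul_apply] using (h (Star.star S z)).2⟩

theorem Adjointable.HasStrictSum.mul_right {f : ℕ → Adjointable F F} {y : Adjointable F F}
    (h : HasStrictSum f y) (S : Adjointable F F) : HasStrictSum (fun k => f k * S) (y * S) := by
  simpa only [star_mul, star_star] using (h.star.mul_left (Star.star S)).star

theorem Adjointable.HasStrictSum.smul {f : ℕ → Adjointable F F} {y : Adjointable F F}
    (h : HasStrictSum f y) (c : ℂ) : HasStrictSum (fun k => c • f k) (c • y) := by
  simpa only [smul_mul_assoc, one_mul] using h.mul_left (c • 1)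

/-- Positivity is decided by the elements ⟪z, y z⟫ of `A`, each of which is a norm convergent sum of
positive elements; self-adjointness passes to the limit by uniqueness of strict sums. -/
theorem Adjointable.HasStrictSum.nonneg {f : ℕ → Adjointable F F} {y : Adjointable F F}
    (h : HasStrictSum f y) (hf : ∀ k, 0 ≤ f k) : 0 ≤ y := by
  have hsa : ∀ k, Star.star (f k) = f k := fun k => (IsSelfAdjoint.of_nonneg (hf k)).star_eq
  refine nonneg_of_inner ?_ fun z => ?_
  · exact HasStrictSum.unique (by simpa only [hsa] using h.star) h
  · exact (hasSum_inner_right z (h z).1).nonneg fun k => inner_nonneg (hf k) z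

end Positivity

/-! ### Finite frames of finitely generated Hilbert modules -/

section Frame

variable {F : HilbertModule A}

/-- A self-adjoint adjointable operator that is bounded below is invertible. -/
theorem Adjointable.isUnit_of_bounded_below {h : Adjointable F F} (hsa : IsSelfAdjoint h) {δ : ℝ}
    (hδ : 0 < δ) (hb : ∀ z, δ * ‖z‖ ≤ ‖h z‖) : IsUnit h := by
  -- The number -c is not real, so it is outside the spectrum of the self-adjoint `h` and h + c is
  -- invertible. The size δ/2 keeps `h` within reach of a Neumann series around h + c.
  set c : ℂ := ((δ / 2 : ℝ) : ℂ) * Complex.I with hc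
  have hcstar : star c = -c := by
    rw [hc, Complex.star_def, map_mul, Complex.conj_ofReal, Complex.conj_I, mul_neg]
  have hunit : IsUnit (h + c • 1) := by
    have h1 : -c ∉ spectrum ℂ h := by
      intro hmem
      have := hsa.im_eq_zero_of_mem_spectrum hmem
      simp [hc] at this
      exact hδ.ne' this
    rw [spectrum.notMem_iff] at h1
    have h2 := h1.neg
    rwa [Algebra.algebraMap_eq_smul_one, neg_sub, neg_smul, sub_neg_eq_add] at h2
  -- The cross terms of ⟪(h + c) z, (h + c) z⟫ cancel, since `h` is self-adjoint and `c` is purely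
  -- imaginary. The lower bound δ of `h` is therefore inherited, and the inverse of h + c has norm
  -- at most 1/δ.
  have hlow : ∀ z, δ * ‖z‖ ≤ ‖(h + c • 1) z‖ := fun z => by
    refine (hb z).trans (abs_le_of_sq_le_sq' ?_ (norm_nonneg _) |>.2)
    rw [F.norm_sq_eq, F.norm_sq_eq]
    refine CStarAlgebra.norm_le_norm_of_nonneg_of_le (F.inner_self_nonneg _) ?_
    have h3 : F.inner (h z) z = F.inner z (h z) := by
      rw [inner_left, ← star_eq_adjoint, hsa.star_eq]
    have h4 : F.inner ((h + c • 1) z) ((h + c • 1) z)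
        = F.inner (h z) (h z) + F.inner (c • z) (c • z) := by
      rw [add_apply, smul_apply, one_apply, F.inner_add_right, inner_add_left, inner_add_left,
        inner_smul_left F z (h z), F.inner_smul_right (h z), h3, hcstar, neg_smul]
      abel
    rw [h4]
    exact le_add_of_nonneg_right (F.inner_self_nonneg _)
  obtain ⟨v, hv⟩ := hunit
  have hinv : ‖(↑v⁻¹ : Adjointable F F)‖ ≤ δ⁻¹ := by
    refine norm_le_of _ (by positivity) fun z => ?_
    have h5 := hlow ((↑v⁻¹ : Adjointable F F) z)
    rw [← hv, ← mul_apply, Units.mul_inv, one_apply] at h5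
    rw [inv_mul_eq_div, le_div_iff₀ hδ, mul_comm]
    exact h5
  have hsmall : ‖c • (↑v⁻¹ : Adjointable F F)‖ < 1 := by
    have hcn : ‖c‖ = δ / 2 := by
      rw [hc, norm_mul, Complex.norm_I, mul_one, Complex.norm_real,
        Real.norm_of_nonneg (by positivity)]
    rw [norm_smul, hcn]
    calc δ / 2 * ‖(↑v⁻¹ : Adjointable F F)‖ ≤ δ / 2 * δ⁻¹ := by gcongr
      _ = 1 / 2 := by field_simp
      _ < 1 := by norm_num
  -- With v = h + c this is h = (1 - c v⁻¹) v, and ‖c v⁻¹‖ ≤ 1/2.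
  have h6 : h = (1 - c • (↑v⁻¹ : Adjointable F F)) * v := by
    rw [sub_mul, one_mul, smul_mul_assoc, Units.inv_mul, hv]; abel
  rw [h6]
  exact (isUnit_one_sub_of_norm_lt_one hsmall).mul v.isUnit

/-- A finitely generated Hilbert module has a finite frame. -/
theorem exists_frame (F : HilbertModule A) (hF : Module.Finite Aᵐᵒᵖ F.carrier) :
    ∃ (n : ℕ) (e f : Fin n → F), ∑ i, rankOne (e i) (f i) = 1 := by
  obtain ⟨n, e, he⟩ := Module.Finite.exists_fin (R := Aᵐᵒᵖ) (M := F.carrier)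
  -- The synthesis map a ↦ ∑ e_i a_i is bounded and, by finite generation, onto. The open mapping
  -- theorem then gives coefficients with ‖a‖ ≤ C ‖y‖ for every vector y.
  let T : (Fin n → A) →L[ℂ] F :=
    ∑ i, (ofVector (e i)).toCLM.comp (ContinuousLinearMap.proj (R := ℂ) (φ := fun _ : Fin n => A) i)
  have hTapp : ∀ a : Fin n → A, T a = ∑ i, op (a i) • e i := fun a => by
    simp only [T, _root_.sum_apply]; rfl
  have hTs : Function.Surjective T := fun y => by
    have hy : y ∈ Submodule.span Aᵐᵒᵖ (Set.range e) := by rw [he]; trivial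
    obtain ⟨c, hc⟩ := (Submodule.mem_span_range_iff_exists_fun _).1 hy
    exact ⟨fun i => (c i).unop, by rw [hTapp]; exact hc⟩
  obtain ⟨C, hC0, hC⟩ := T.exists_preimage_norm_le hTs
  -- The frame operator h. The control of coefficients will make it bounded below, hence invertible.
  set h : Adjointable F F := ∑ i, rankOne (e i) (e i) with hh
  have hinner : ∀ y, F.inner y (h y) = ∑ i, star (F.inner (e i) y) * F.inner (e i) y := fun y => by
    rw [hh, Adjointable.sum_apply, inner_sum_right]
    refine Finset.sum_congr rfl fun i _ => ?_
    rw [rankOne_apply, F.inner_op_smul_right, F.star_inner]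
  -- Each ⟪e_i, y⟫⋆ ⟪e_i, y⟫ is dominated by the whole sum ⟪y, h y⟫.
  have hcoef : ∀ i y, ‖F.inner (e i) y‖ ^ 2 ≤ ‖y‖ * ‖h y‖ := fun i y => by
    rw [sq, ← CStarRing.norm_star_mul_self]
    refine (CStarAlgebra.norm_le_norm_of_nonneg_of_le (star_mul_self_nonneg _) ?_).trans
      (F.norm_inner_le y (h y))
    rw [hinner]
    exact Finset.single_le_sum (f := fun i => star (F.inner (e i) y) * F.inner (e i) y)
      (fun i _ => star_mul_self_nonneg _) (Finset.mem_univ i)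
  -- Writing y = ∑ e_i a_i with ‖a_i‖ ≤ C‖y‖, the n terms of ⟪y, y⟫ = ∑ ⟪y, e_i⟫ a_i give ‖y‖² ≤ n ·
  -- √(‖y‖‖h y‖) · C‖y‖. Cancelling ‖y‖ and squaring produces the constant (nC)².
  have hlow : ∀ y, ‖y‖ ≤ (n * C) ^ 2 * ‖h y‖ := fun y => by
    obtain ⟨a, ha, han⟩ := hC y
    have h1 : F.inner y y = ∑ i, F.inner y (e i) * a i := by
      conv_lhs => enter [3]; rw [← ha, hTapp]
      rw [inner_sum_right]
      exact Finset.sum_congr rfl fun i _ => F.inner_op_smul_right _ _ _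
    have h2 : ‖y‖ ^ 2 ≤ ∑ _i : Fin n, √(‖y‖ * ‖h y‖) * (C * ‖y‖) := by
      rw [F.norm_sq_eq y, h1]
      refine (norm_sum_le _ _).trans (Finset.sum_le_sum fun i _ => ?_)
      refine (norm_mul_le _ _).trans (mul_le_mul ?_ ((norm_le_pi_norm a i).trans han)
        (norm_nonneg _) (Real.sqrt_nonneg _))
      rw [← F.star_inner, norm_star]
      exact Real.le_sqrt_of_sq_le (hcoef i y)
    rw [Finset.sum_const, Finset.card_univ, Fintype.card_fin, nsmul_eq_mul] at h2
    rcases (norm_nonneg y).eq_or_lt with h0 | h0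
    · rw [← h0]; positivity
    · have h3 : ‖y‖ ≤ (n * C) * √(‖y‖ * ‖h y‖) := by
        refine le_of_mul_le_mul_right ?_ h0
        nlinarith
      have h4 : ‖y‖ ^ 2 ≤ (n * C) ^ 2 * (‖y‖ * ‖h y‖) := by
        calc ‖y‖ ^ 2 ≤ ((n * C) * √(‖y‖ * ‖h y‖)) ^ 2 := by gcongr
          _ = _ := by rw [mul_pow, Real.sq_sqrt (by positivity)]
      refine le_of_mul_le_mul_right ?_ h0
      nlinarith
  have hsa : IsSelfAdjoint h := by
    rw [IsSelfAdjoint, hh, star_sum]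
    rfl
  have hunit : IsUnit h := by
    -- The added 1 keeps δ well defined and positive when `n = 0`.
    refine isUnit_of_bounded_below (δ := ((n * C) ^ 2 + 1)⁻¹) hsa (by positivity) fun z => ?_
    rw [inv_mul_le_iff₀ (by positivity)]
    nlinarith [hlow z, norm_nonneg (h z)]
  obtain ⟨v, hv⟩ := hunit
  -- The dual vectors are f_i = (h⁻¹)⋆ e_i, for which ∑ e_i ⟪f_i, z⟫ = ∑ e_i ⟪e_i, h⁻¹ z⟫ = h h⁻¹ z.
  refine ⟨n, e, fun i => star (↑v⁻¹ : Adjointable F F) (e i), ?_⟩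
  have h5 : (1 : Adjointable F F) = h * ↑v⁻¹ := by rw [← hv, Units.mul_inv]
  rw [h5, hh, Finset.sum_mul]
  refine Finset.sum_congr rfl fun i _ => ext fun z => ?_
  rw [mul_apply, rankOne_apply, rankOne_apply, inner_right]
  rfl

end Frame

end HilbertModule

/-! ### Elementary tensors as bounded linear maps -/

namespace HilbertModule

open Adjointable

theorem norm_tmul_le {F : HilbertModule A} {E : CStarCorrespondence A} (x : F)
    (y : E.toHilbertModule) : ‖(tmul x y : F.tensor E)‖ ≤ ‖y‖ * ‖x‖ := by
  refine abs_le_of_sq_le_sq' ?_ (by positivity) |>.2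
  rw [(F.tensor E).norm_sq_eq, inner_tmul, mul_pow, F.norm_sq_eq x]
  refine (E.norm_inner_le _ _).trans ?_
  have h1 := (E.φ (F.inner x x)).norm_apply_le y
  have h2 : ‖E.φ (F.inner x x)‖ ≤ ‖F.inner x x‖ := NonUnitalStarAlgHom.norm_apply_le E.φ _
  calc ‖y‖ * ‖E.φ (F.inner x x) y‖ ≤ ‖y‖ * (‖F.inner x x‖ * ‖y‖) := by
        gcongr; exact h1.trans (by gcongr)
    _ = _ := by ring

/-- The map `x ↦ x ⊗ y`. -/
def tmulLeft (F : HilbertModule A) {E : CStarCorrespondence A} (y : E.toHilbertModule) :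
    F →L[ℂ] F.tensor E :=
  LinearMap.mkContinuous
    { toFun := fun x => tmul x y
      map_add' := fun x x' => tmul_add_left x x' y
      map_smul' := fun c x => tmul_smul_left c x y }
    ‖y‖ fun x => norm_tmul_le x y

end HilbertModule

/-! ### Level projections and density arguments on the Fock module -/

namespace CStarCorrespondence

open HilbertModule HilbertModule.Adjointable UniformSpace

variable (E : CStarCorrespondence A)

variable {E} in
theorem fock_induction {p : fock E → Prop} (z : fock E) (hc : IsClosed {z | p z}) (h0 : p 0)
    (hs : ∀ n a, p (incl E n a)) (ha : ∀ z w, p z → p w → p (z + w)) : p z := by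
  refine Completion.induction_on (α := preFock E) z hc fun v => ?_
  induction v using preFock_induction with
  | h0 => exact h0
  | hs n a => exact hs n a
  | ha x y hx hy =>
    have h2 : ((x + y : preFock E) : Completion (preFock E)) = x + y := Completion.coe_add _ _
    rw [h2]
    exact ha _ _ hx hy

variable {E} in
-- The map x ↦ x ⊗ y is continuous and additive, so the left factor of an elementary tensor can be
-- approximated by sums of vectors of single levels.
theorem fock_tensor_induction {p : (fock E).tensor E → Prop} (z : (fock E).tensor E)
    (hc : IsClosed {z | p z}) (h0 : p 0) (hs : ∀ n a y, p (tmul (incl E n a) y))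
    (ha : ∀ z w, p z → p w → p (z + w)) : p z := by
  refine tensor_induction z hc h0 (fun x y => ?_) ha
  refine fock_induction (p := fun x => p (tmul x y)) x
    (hc.preimage ((fock E).tmulLeft y).continuous) ?_ (fun n a => hs n a y) fun z w hz hw => ?_
  · have : (tmul (0 : fock E) y : (fock E).tensor E) = 0 := ((fock E).tmulLeft y).map_zero
    rw [this]; exact h0
  · rw [tmul_add_left]; exact ha _ _ hz hw

theorem incl_adjoint_incl_same (n : ℕ) : (incl E n).adjoint.comp (incl E n) = 1 :=
  ext fun a => (tpow E n).ext_inner fun b => by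
    refine (inner_left (incl E n) b (incl E n a)).symm.trans ?_
    refine ((preFock E).complInner_coe (preSingle E n b) (preSingle E n a)).trans ?_
    rw [preFock_inner_single, preCoord_single_same, one_apply]

theorem incl_adjoint_incl_ne {m n : ℕ} (h : m ≠ n) : (incl E m).adjoint.comp (incl E n) = 0 :=
  ext fun a => (tpow E m).ext_inner fun b => by
    refine (inner_left (incl E m) b (incl E n a)).symm.trans ?_
    refine ((preFock E).complInner_coe (preSingle E m b) (preSingle E n a)).trans ?_
    rw [preFock_inner_single, preCoord_single_ne E h, Adjointable.zero_apply]

theorem incl_adjoint_incl_apply_same (n : ℕ) (a : tpow E n) :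
    (incl E n).adjoint (incl E n a) = a :=
  DFunLike.congr_fun (incl_adjoint_incl_same E n) a

theorem incl_adjoint_incl_apply_ne {m n : ℕ} (h : m ≠ n) (a : tpow E n) :
    (incl E m).adjoint (incl E n a) = 0 :=
  DFunLike.congr_fun (incl_adjoint_incl_ne E h) a

/-- The projection of the Fock module onto the summand `Eⁿ`. -/
def levelProj (n : ℕ) : Adjointable (fock E) (fock E) := (incl E n).comp (incl E n).adjoint

theorem star_levelProj (n : ℕ) : star (levelProj E n) = levelProj E n := rfl

theorem levelProj_incl_same (n : ℕ) (a : tpow E n) : levelProj E n (incl E n a) = incl E n a :=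
  congrArg (incl E n) (incl_adjoint_incl_apply_same E n a)

theorem levelProj_incl_ne {m n : ℕ} (h : m ≠ n) (a : tpow E n) : levelProj E m (incl E n a) = 0 :=
  (congrArg (incl E m) (incl_adjoint_incl_apply_ne E h a)).trans (Adjointable.map_zero _)

theorem levelProj_mul_self (n : ℕ) : levelProj E n * levelProj E n = levelProj E n :=
  ext fun z => levelProj_incl_same E n ((incl E n).adjoint z)

theorem levelProj_mul_ne {m n : ℕ} (h : m ≠ n) : levelProj E m * levelProj E n = 0 :=
  ext fun z => levelProj_incl_ne E h ((incl E n).adjoint z)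

/-- The projection of the Fock module onto `⨁ n ∈ s, Eⁿ`. -/
def setProj (s : Finset ℕ) : Adjointable (fock E) (fock E) := ∑ n ∈ s, levelProj E n

theorem P_eq (N : ℕ) : P E N = setProj E (Finset.range (N + 1)) := rfl

theorem star_setProj (s : Finset ℕ) : star (setProj E s) = setProj E s := by
  rw [setProj, star_sum]; rfl

theorem setProj_mul (s t : Finset ℕ) : setProj E s * setProj E t = setProj E (s ∩ t) := by
  rw [setProj, setProj, Finset.sum_mul, setProj, ← Finset.filter_mem_eq_inter, Finset.sum_filter]
  refine Finset.sum_congr rfl fun i _ => ?_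
  rw [Finset.mul_sum]
  split_ifs with h
  · rw [Finset.sum_eq_single_of_mem i h fun j _ hj => levelProj_mul_ne E hj.symm,
      levelProj_mul_self]
  · exact Finset.sum_eq_zero fun j hj => levelProj_mul_ne E fun hij => h (hij ▸ hj)

theorem norm_setProj_le (s : Finset ℕ) : ‖setProj E s‖ ≤ 1 := by
  refine norm_le_one_of_projection ?_
  rw [← star_eq_adjoint, ← mul_eq_comp, star_setProj, setProj_mul, Finset.inter_self]

/-- Bessel's inequality in the order of `A`. The left side is ⟪z, Q z⟫ for the projection Q onto the
levels in `s`, and Q has norm at most 1. -/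
theorem sum_inner_levelProj_le (s : Finset ℕ) (z : fock E) :
    ∑ n ∈ s, (fock E).inner (levelProj E n z) (levelProj E n z) ≤ (fock E).inner z z := by
  have h1 := (setProj E s).inner_apply_le (norm_setProj_le E s) z
  rw [one_pow, one_smul, inner_left, ← star_eq_adjoint, star_setProj, ← mul_apply, setProj_mul,
    Finset.inter_self, setProj, Adjointable.sum_apply, inner_sum_right] at h1
  refine le_of_eq_of_le (Finset.sum_congr rfl fun n _ => ?_) h1
  rw [inner_left, ← star_eq_adjoint, star_levelProj, ← mul_apply, levelProj_mul_self]

theorem dense_fock {q : fock E → Prop} (h0 : q 0) (hs : ∀ n a, q (incl E n a))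
    (ha : ∀ z w, q z → q w → q (z + w)) : Dense {z | q z} := by
  intro z
  refine fock_induction (p := fun z => z ∈ closure {z | q z}) z isClosed_closure
    (subset_closure h0) (fun n a => subset_closure (hs n a)) fun z w hz hw => ?_
  exact map_mem_closure₂ continuous_add hz hw fun z hz w hw => ha z w hz hw

theorem dense_fock_tensor {q : (fock E).tensor E → Prop} (h0 : q 0)
    (hs : ∀ n a y, q (tmul (incl E n a) y))
    (ha : ∀ z w, q z → q w → q (z + w)) : Dense {z | q z} := by
  intro z
  refine fock_tensor_induction (p := fun z => z ∈ closure {z | q z}) z isClosed_closure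
    (subset_closure h0) (fun n a y => subset_closure (hs n a y)) fun z w hz hw => ?_
  exact map_mem_closure₂ continuous_add hz hw fun z hz w hw => ha z w hz hw

theorem dense_summable_fock {G : HilbertModule A} {f : ℕ → Adjointable (fock E) G}
    (h : ∀ n a, Summable fun k => f k (incl E n a)) : Dense {z | Summable fun k => f k z} := by
  refine dense_fock E (q := fun z => Summable fun k => f k z) ?_ h fun z w hz hw => ?_
  · simp only [Adjointable.map_zero]; exact summable_zero
  · simp only [Adjointable.map_add]; exact hz.add hw

/-- The partial sums are projections, hence bounded by 1, and on a vector of a single level the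
series has only one nonzero term. -/
theorem hasStrictSum_levelProj : HasStrictSum (levelProj E) 1 := by
  have hs : ∀ n a, HasSum (fun k => levelProj E k (incl E n a)) (incl E n a) := fun n a => by
    have := hasSum_single (f := fun k => levelProj E k (incl E n a)) n
      fun k hk => levelProj_incl_ne E hk a
    rwa [levelProj_incl_same] at this
  have hd := dense_summable_fock E fun n a => (hs n a).summable
  obtain ⟨y, -, hy, hy'⟩ := exists_hasSum (norm_setProj_le E) hd hd
  have h1 : y = 1 := fock_ext fun n a => (hy _).unique (hs n a)
  subst h1
  exact fun z => ⟨hy z, hy' z⟩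

/-! ### The isometry Γ_E ⊗ E → Γ_E -/

/-- The inclusion `Eⁿ⁺¹ = Eⁿ ⊗_A E → Γ_E`. -/
def inclSucc (n : ℕ) : Adjointable ((tpow E n).tensor E) (fock E) := incl E (n + 1)

theorem inclSucc_adjoint_comp_same (n : ℕ) : (inclSucc E n).adjoint.comp (inclSucc E n) = 1 :=
  incl_adjoint_incl_same E (n + 1)

theorem inclSucc_adjoint_comp_ne {m n : ℕ} (h : m ≠ n) :
    (inclSucc E m).adjoint.comp (inclSucc E n) = 0 :=
  incl_adjoint_incl_ne E (by omega)

theorem inclSucc_adjoint_incl {k n : ℕ} (h : k + 1 ≠ n) (a : tpow E n) :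
    (inclSucc E k).adjoint (incl E n a) = 0 :=
  incl_adjoint_incl_apply_ne E h a

/-- The embedding `Eⁿ ⊗_A E → Γ_E` precomposed with the projection of `Γ_E ⊗_A E`. -/
def shiftLevel (n : ℕ) : Adjointable ((fock E).tensor E) (fock E) :=
  (inclSucc E n).comp (tensorId E (incl E n).adjoint)

theorem shiftLevel_adjoint_comp_same (n : ℕ) :
    (shiftLevel E n).adjoint.comp (shiftLevel E n) = tensorId E (levelProj E n) := by
  rw [shiftLevel, adjoint_comp, comp_assoc, ← comp_assoc (inclSucc E n).adjoint,
    inclSucc_adjoint_comp_same, levelProj, tensorId_comp, one_comp, tensorId_adjoint]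
  rfl

theorem shiftLevel_adjoint_comp_ne {m n : ℕ} (h : m ≠ n) :
    (shiftLevel E m).adjoint.comp (shiftLevel E n) = 0 := by
  rw [shiftLevel, shiftLevel, adjoint_comp, comp_assoc, ← comp_assoc (inclSucc E m).adjoint,
    inclSucc_adjoint_comp_ne E h, zero_comp, comp_zero]

/-- The pieces have orthogonal ranges, so S⋆S = Q ⊗ I_E for the partial sum S, where Q is the
projection onto the levels in `s`. -/
theorem norm_sum_shiftLevel_le (s : Finset ℕ) : ‖∑ n ∈ s, shiftLevel E n‖ ≤ 1 := by
  refine norm_le_one_of_adjoint_comp_self ?_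
  have : (∑ n ∈ s, shiftLevel E n).adjoint.comp (∑ n ∈ s, shiftLevel E n)
      = tensorId E (setProj E s) := by
    rw [adjoint_sum, sum_comp, setProj, tensorId_sum]
    refine Finset.sum_congr rfl fun i hi => ?_
    rw [comp_sum, Finset.sum_eq_single_of_mem i hi fun j _ hj =>
      shiftLevel_adjoint_comp_ne E hj.symm, shiftLevel_adjoint_comp_same]
  rw [this]
  exact (norm_tensorId_le E _).trans (norm_setProj_le E s)

/-- τ is the strict sum of the pieces `shiftLevel`. On a ⊗ y with a ∈ E^n only the n-th piece acts;
the adjoint of the k-th piece sees only the level k + 1, and in particular level 0 is killed by all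
of them. -/
theorem exists_shift : ∃ τ : Adjointable ((fock E).tensor E) (fock E),
    ∀ n, τ.comp (tensorId E (incl E n)) = inclSucc E n := by
  have h1 : ∀ n (a : tpow E n) (y : E.toHilbertModule),
      HasSum (fun k => shiftLevel E k (tmul (incl E n a) y)) (inclSucc E n (tmul a y)) := by
    intro n a y
    have := hasSum_single (f := fun k => shiftLevel E k (tmul (incl E n a) y)) n fun k hk => by
      rw [shiftLevel, comp_apply, tensorId_tmul, incl_adjoint_incl_apply_ne E hk]
      exact (congrArg _ (((tpow E k).tmulLeft y).map_zero)).trans (Adjointable.map_zero _)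
    rwa [shiftLevel, comp_apply, tensorId_tmul, incl_adjoint_incl_apply_same] at this
  have h2 : ∀ n a, Summable fun k => (shiftLevel E k).adjoint (incl E n a) := fun n a => by
    refine summable_of_ne_finset_zero (s := Finset.range n) fun k hk => ?_
    have hk' : k + 1 ≠ n := by rw [Finset.mem_range] at hk; omega
    rw [shiftLevel, adjoint_comp, comp_apply, inclSucc_adjoint_incl E hk', Adjointable.map_zero]
  have hd : Dense {z | Summable fun k => shiftLevel E k z} := by
    refine dense_fock_tensor E (q := fun z => Summable fun k => shiftLevel E k z) ?_
      (fun n a y => (h1 n a y).summable) fun z w hz hw => ?_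
    · simp only [Adjointable.map_zero]; exact summable_zero
    · simp only [Adjointable.map_add]; exact hz.add hw
  obtain ⟨τ, -, hτ, -⟩ := exists_hasSum (norm_sum_shiftLevel_le E) hd (dense_summable_fock E h2)
  refine ⟨τ, fun n => tensor_ext fun a y => ?_⟩
  rw [comp_apply, tensorId_tmul]
  exact (hτ _).unique (h1 n a y)

/-- The isometry `Γ_E ⊗_A E → Γ_E` with range `⨁ n ≥ 1, Eⁿ`. -/
def shift : Adjointable ((fock E).tensor E) (fock E) := (exists_shift E).choose

theorem shift_comp_tensorId_incl (n : ℕ) :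
    (shift E).comp (tensorId E (incl E n)) = inclSucc E n := (exists_shift E).choose_spec n

theorem shift_tmul_incl (n : ℕ) (a : tpow E n) (y : E.toHilbertModule) :
    shift E (tmul (incl E n a) y) = inclSucc E n (tmul a y) := by
  rw [← shift_comp_tensorId_incl, comp_apply, tensorId_tmul]

/-- The adjoint of the shift is known only abstractly. It is computed on levels ≥ 1 by pairing with
vectors b ⊗ w, where b lies in a single level and the two sides agree by orthogonality of levels. -/
theorem shift_adjoint_comp_incl (n : ℕ) :
    (shift E).adjoint.comp (inclSucc E n) = tensorId E (incl E n) := by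
  refine tensor_ext fun a y => ((fock E).tensor E).ext_inner fun z => ?_
  rw [comp_apply, ← inner_left, tensorId_tmul]
  refine fock_tensor_induction (p := fun z => (fock E).inner (shift E z) (inclSucc E n (tmul a y))
    = ((fock E).tensor E).inner z (tmul (incl E n a) y)) z ?_ ?_ ?_ ?_
  · exact _root_.isClosed_eq
      ((fock E).continuous_inner.comp (Continuous.prodMk (shift E).continuous continuous_const))
      (((fock E).tensor E).continuous_inner.comp (Continuous.prodMk continuous_id continuous_const))
  · rw [Adjointable.map_zero, HilbertModule.inner_zero_left, HilbertModule.inner_zero_left]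
  · intro m b w
    rw [shift_tmul_incl, inner_left, inner_tmul, inner_left (incl E m), ← comp_apply]
    by_cases h : m = n
    · subst h
      rw [incl_adjoint_incl_apply_same, inclSucc_adjoint_comp_same, one_apply, inner_tmul]
    · rw [incl_adjoint_incl_apply_ne E h, inclSucc_adjoint_comp_ne E h, Adjointable.zero_apply,
        HilbertModule.inner_zero_right, HilbertModule.inner_zero_right, _root_.map_zero,
        Adjointable.zero_apply,
        HilbertModule.inner_zero_right]
  · intro z w hz hw
    rw [Adjointable.map_add, HilbertModule.inner_add_left, HilbertModule.inner_add_left, hz, hw]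

/-- On a ⊗ y the shift goes to level n + 1, from which `shift_adjoint_comp_incl` leads back. This
identity is what makes `amp` multiplicative. -/
theorem shift_adjoint_comp_self : (shift E).adjoint.comp (shift E) = 1 := by
  ext z
  refine fock_tensor_induction (p := fun z => (shift E).adjoint.comp (shift E) z = z) z ?_ ?_ ?_ ?_
  · exact Adjointable.isClosed_eq _ 1
  · exact Adjointable.map_zero _
  · intro n a y
    have : tmul (incl E n a) y = tensorId E (incl E n) (tmul a y) := (tensorId_tmul _ _ _ _).symm
    rw [comp_apply, shift_tmul_incl, this, ← shift_adjoint_comp_incl]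
    rfl
  · intro z w hz hw
    rw [Adjointable.map_add, hz, hw]

/-! ### The amplification endomorphism and its powers -/

/-- The endomorphism `T ↦ T ⊗ I_E` of the adjointable operators on the Fock module, where
`Γ_E ⊗_A E` is identified with `⨁ n ≥ 1, Eⁿ`. -/
def amp : Adjointable (fock E) (fock E) →⋆ₙₐ[ℂ] Adjointable (fock E) (fock E) where
  toFun T := (shift E).comp ((tensorId E T).comp (shift E).adjoint)
  map_smul' c T := by
    rw [tensorId_smul, smul_comp, comp_smul]; rfl
  map_zero' := by rw [tensorId_zero, zero_comp, comp_zero]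
  map_add' S T := by rw [tensorId_add, add_comp, comp_add]
  map_mul' S T := by
    rw [mul_eq_comp, mul_eq_comp, tensorId_comp, comp_assoc, comp_assoc, comp_assoc,
      ← comp_assoc (shift E).adjoint (shift E), shift_adjoint_comp_self, one_comp]
  map_star' T := by
    rw [star_eq_adjoint, star_eq_adjoint, tensorId_adjoint]; rfl

theorem amp_apply (T : Adjointable (fock E) (fock E)) :
    amp E T = (shift E).comp ((tensorId E T).comp (shift E).adjoint) := rfl

/-- Both inclusions absorb the shift, since σ (ι_n ⊗ I_E) = ι_{n+1}. Amplification therefore moves a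
block one level up on both sides and tensors it with I_E. -/
theorem amp_block {i j : ℕ} (T : Adjointable (tpow E j) (tpow E i)) :
    amp E ((incl E i).comp (T.comp (incl E j).adjoint))
      = (incl E (i + 1)).comp ((tensorId E T).comp (incl E (j + 1)).adjoint) := by
  rw [amp_apply, tensorId_comp, tensorId_comp, tensorId_adjoint]
  change _ = (inclSucc E i).comp ((tensorId E T).comp (inclSucc E j).adjoint)
  rw [← shift_comp_tensorId_incl E i, ← shift_comp_tensorId_incl E j]
  rfl

/-- The endomorphism `T ↦ T ⊗ I_{E^k}`. -/
def ampPow : ℕ → Adjointable (fock E) (fock E) →⋆ₙₐ[ℂ] Adjointable (fock E) (fock E)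
  | 0 => NonUnitalStarAlgHom.id ℂ _
  | k + 1 => (amp E).comp (ampPow k)

theorem ampPow_succ_apply (k : ℕ) (T : Adjointable (fock E) (fock E)) :
    ampPow E (k + 1) T = amp E (ampPow E k T) := rfl

theorem ampPow_block {i j : ℕ} (T : Adjointable (tpow E j) (tpow E i)) (k : ℕ) :
    ampPow E k ((incl E i).comp (T.comp (incl E j).adjoint))
      = (incl E (i + k)).comp ((tensorPowId E T k).comp (incl E (j + k)).adjoint) := by
  induction k with
  | zero => rfl
  | succ k ih => rw [ampPow_succ_apply, ih, amp_block]; rfl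

theorem norm_ampPow_le (k : ℕ) (T : Adjointable (fock E) (fock E)) : ‖ampPow E k T‖ ≤ ‖T‖ :=
  NonUnitalStarAlgHom.norm_apply_le (ampPow E k) T

/-- Expanding P_N x P_N into its blocks reduces this to `ampPow_block`. The blockwise definition of
x ⊗ I_{E^k} is thereby replaced by a ⋆-homomorphism applied to one operator, so norms and positivity
can be handled without blocks. -/
theorem amplify_eq (N : ℕ) (x : Adjointable (fock E) (fock E)) (k : ℕ) :
    amplify E N x k = ampPow E k (compress E N x) := by
  rw [compress, P, Finset.sum_mul, Finset.sum_mul, _root_.map_sum, amplify]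
  refine Finset.sum_congr rfl fun i _ => ?_
  rw [Finset.mul_sum, _root_.map_sum]
  refine Finset.sum_congr rfl fun j _ => ?_
  rw [← ampPow_block]
  rfl

theorem amp_levelProj (n : ℕ) : amp E (levelProj E n) = levelProj E (n + 1) := by
  have := amp_block E (1 : Adjointable (tpow E n) (tpow E n))
  rwa [tensorId_one] at this

theorem ampPow_levelProj (k n : ℕ) : ampPow E k (levelProj E n) = levelProj E (n + k) := by
  induction k with
  | zero => rfl
  | succ k ih => rw [ampPow_succ_apply, ih, amp_levelProj]; rfl

/-- The support of the k-th term is thus the window of levels k, …, k + N. -/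
theorem ampPow_P_apply (N k : ℕ) :
    ampPow E k (P E N) = ∑ n ∈ Finset.range (N + 1), levelProj E (n + k) := by
  rw [P_eq, setProj, _root_.map_sum]
  exact Finset.sum_congr rfl fun n _ => ampPow_levelProj E k n

theorem star_P (N : ℕ) : star (P E N) = P E N := star_setProj E _

theorem P_mul_self (N : ℕ) : P E N * P E N = P E N := by
  rw [P_eq, setProj_mul, Finset.inter_self]

/-- The windows k, …, k + N cover each level at most N + 1 times. After exchanging the sums over k
and over the offset n, each of the N + 1 offsets contributes at most ⟪z, z⟫ by Bessel's inequality.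
-/
theorem sum_inner_ampPow_P_le (N : ℕ) (s : Finset ℕ) (z : fock E) :
    ∑ k ∈ s, (fock E).inner (ampPow E k (P E N) z) (ampPow E k (P E N) z)
      ≤ ((N : ℝ) + 1) • (fock E).inner z z := by
  have h1 : ∀ k, (fock E).inner (ampPow E k (P E N) z) (ampPow E k (P E N) z)
      = ∑ n ∈ Finset.range (N + 1),
        (fock E).inner (levelProj E (n + k) z) (levelProj E (n + k) z) := fun k => by
    rw [inner_left, ← star_eq_adjoint, ← mul_apply, ← map_star, ← _root_.map_mul, star_P,
      P_mul_self, ampPow_P_apply, Adjointable.sum_apply, inner_sum_right]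
    refine Finset.sum_congr rfl fun n _ => ?_
    rw [inner_left, ← star_eq_adjoint, star_levelProj, ← mul_apply, levelProj_mul_self]
  simp only [h1]
  rw [Finset.sum_comm]
  have h2 : ∀ n ∈ Finset.range (N + 1), ∑ k ∈ s,
      (fock E).inner (levelProj E (n + k) z) (levelProj E (n + k) z) ≤ (fock E).inner z z := by
    intro n _
    -- For a fixed offset n the levels n + k are distinct as k varies, so Bessel's inequality
    -- applies to the translate of `s`.
    have := sum_inner_levelProj_le E (s.map (addLeftEmbedding n)) z
    rwa [Finset.sum_map] at this
  refine (Finset.sum_le_sum h2).trans_eq ?_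
  rw [Finset.sum_const, Finset.card_range, ← Nat.cast_smul_eq_nsmul ℝ]
  push_cast
  rfl

/-! ### Strict convergence and contractivity of Ψ_N ∘ φ_N -/

theorem ampPow_compress (N k : ℕ) (x : Adjointable (fock E) (fock E)) :
    ampPow E k (compress E N x)
      = star (ampPow E k (P E N)) * ampPow E k x * ampPow E k (P E N) := by
  rw [compress, _root_.map_mul, _root_.map_mul, ← map_star, star_P]

theorem norm_sum_ampPow_compress_le (N : ℕ) (x : Adjointable (fock E) (fock E)) (s : Finset ℕ) :
    ‖∑ k ∈ s, ampPow E k (compress E N x)‖ ≤ ((N : ℝ) + 1) * ‖x‖ := by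
  simp only [ampPow_compress]
  exact norm_sum_compress_le s _ _ (by positivity) (norm_nonneg x)
    (sum_inner_ampPow_P_le E N s) fun k _ => norm_ampPow_le E k x

theorem star_compress (N : ℕ) (x : Adjointable (fock E) (fock E)) :
    star (compress E N x) = compress E N (star x) := by
  rw [compress, compress, star_mul, star_mul, star_P, mul_assoc]

/-- The windows have overlap N + 1, which bounds the partial sums; on a vector of level n the terms
with k > n vanish. The adjoint series is the series of `star x`, so the same finiteness serves both
halves of strict convergence. -/
theorem exists_hasStrictSum_ampPow (N : ℕ) (x : Adjointable (fock E) (fock E)) :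
    ∃ y, ‖y‖ ≤ ((N : ℝ) + 1) * ‖x‖ ∧ HasStrictSum (fun k => ampPow E k (compress E N x)) y := by
  have hs : ∀ (x : Adjointable (fock E) (fock E)) n a,
      Summable fun k => ampPow E k (compress E N x) (incl E n a) := fun x n a => by
    -- The k-th window starts at level k, so it misses E^n as soon as k > n.
    refine summable_of_ne_finset_zero (s := Finset.range (n + 1)) fun k hk => ?_
    rw [Finset.mem_range] at hk
    have h0 : ampPow E k (P E N) (incl E n a) = 0 := by
      rw [ampPow_P_apply, Adjointable.sum_apply]
      exact Finset.sum_eq_zero fun i _ => levelProj_incl_ne E (by omega) a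
    rw [ampPow_compress, mul_apply, h0, Adjointable.map_zero]
  have hs' : ∀ n a, Summable fun k => (ampPow E k (compress E N x)).adjoint (incl E n a) :=
    fun n a => by
      simp only [← star_eq_adjoint, ← map_star, star_compress]
      exact hs (star x) n a
  obtain ⟨y, hy, h1, h2⟩ := exists_hasSum (norm_sum_ampPow_compress_le E N x)
    (dense_summable_fock E (hs x)) (dense_summable_fock E hs')
  exact ⟨y, hy, fun z => ⟨h1 z, h2 z⟩⟩

/-- The series defining `Ψ_N` converges strictly. -/
theorem exists_hasStrictSum_amplify (N : ℕ) (x : Adjointable (fock E) (fock E)) :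
    ∃ y, ‖y‖ ≤ ((N : ℝ) + 1) * ‖x‖ ∧ HasStrictSum (amplify E N x) y := by
  have : amplify E N x = fun k => ampPow E k (compress E N x) := funext (amplify_eq E N x)
  rw [this]
  exact exists_hasStrictSum_ampPow E N x

theorem natCast_add_one_ne_zero (N : ℕ) : ((N : ℂ) + 1) ≠ 0 := Nat.cast_add_one_ne_zero N

theorem hasStrictSum_amplify (N : ℕ) (x : Adjointable (fock E) (fock E)) :
    HasStrictSum (amplify E N x) (((N : ℂ) + 1) • Psi E N x) := by
  obtain ⟨y, -, hy⟩ := exists_hasStrictSum_amplify E N x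
  rw [Psi, hy.strictSum_eq, smul_inv_smul₀ (natCast_add_one_ne_zero N)]
  exact hy

theorem compress_compress (N : ℕ) (x : Adjointable (fock E) (fock E)) :
    compress E N (compress E N x) = compress E N x := by
  simp only [compress]
  rw [mul_assoc, mul_assoc, mul_assoc, P_mul_self, ← mul_assoc, P_mul_self, ← mul_assoc]

/-- The operator `x` is compressed twice here, once by φ_N and once because `amplify` only reads the
blocks up to N; the compression is idempotent. -/
theorem hasStrictSum_PsiPhi (N : ℕ) (x : Adjointable (fock E) (fock E)) :
    HasStrictSum (fun k => ampPow E k (compress E N x)) (((N : ℂ) + 1) • PsiPhi E N x) := by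
  have h := hasStrictSum_amplify E N (compress E N x)
  have : amplify E N (compress E N x) = fun k => ampPow E k (compress E N x) :=
    funext fun k => by rw [amplify_eq, compress_compress]
  rwa [this] at h

theorem PsiPhi_eq_of_hasStrictSum {N : ℕ} {x y : Adjointable (fock E) (fock E)}
    (h : HasStrictSum (fun k => ampPow E k (compress E N x)) y) :
    PsiPhi E N x = ((N : ℂ) + 1)⁻¹ • y := by
  rw [(hasStrictSum_PsiPhi E N x).unique h |>.symm, inv_smul_smul₀ (natCast_add_one_ne_zero N)]

theorem norm_PsiPhi_le (N : ℕ) (x : Adjointable (fock E) (fock E)) : ‖PsiPhi E N x‖ ≤ ‖x‖ := by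
  obtain ⟨y, hy, h⟩ := exists_hasStrictSum_ampPow E N x
  have hn : ‖((N : ℂ) + 1)‖ = (N : ℝ) + 1 := by
    rw [← Nat.cast_add_one, Complex.norm_natCast, Nat.cast_add_one]
  rw [PsiPhi_eq_of_hasStrictSum E h, norm_smul, norm_inv, hn, inv_mul_le_iff₀ (by positivity)]
  exact hy

/-! ### Linearity and complete positivity of Ψ_N ∘ φ_N -/

/-- `Ψ_N ∘ φ_N` as a linear map. -/
def psiPhiHom (N : ℕ) : Adjointable (fock E) (fock E) →ₗ[ℂ] Adjointable (fock E) (fock E) where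
  toFun := PsiPhi E N
  map_add' x y := by
    have h := (hasStrictSum_PsiPhi E N x).add (hasStrictSum_PsiPhi E N y)
    have h2 : ∀ k, ampPow E k (compress E N x) + ampPow E k (compress E N y)
        = ampPow E k (compress E N (x + y)) := fun k => by
      rw [← _root_.map_add, compress, compress, compress, mul_add, add_mul]
    simp only [h2] at h
    rw [PsiPhi_eq_of_hasStrictSum E h, ← smul_add, inv_smul_smul₀ (natCast_add_one_ne_zero N)]
  map_smul' c x := by
    have h := (hasStrictSum_PsiPhi E N x).smul c
    have h2 : ∀ k, c • ampPow E k (compress E N x) = ampPow E k (compress E N (c • x)) :=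
      fun k => by
        rw [← _root_.map_smul, compress, compress, mul_smul_comm, smul_mul_assoc]
    simp only [h2] at h
    rw [PsiPhi_eq_of_hasStrictSum E h, smul_comm c, inv_smul_smul₀ (natCast_add_one_ne_zero N)]
    rfl

theorem psiPhiHom_apply (N : ℕ) (x : Adjointable (fock E) (fock E)) :
    psiPhiHom E N x = PsiPhi E N x := rfl

theorem smul_nonneg_of_natCast_smul {N : ℕ} {x : Adjointable (fock E) (fock E)}
    (h : 0 ≤ ((N : ℂ) + 1) • x) : 0 ≤ x := by
  have h1 : ((N : ℂ) + 1) • x = ((N : ℝ) + 1) • x := by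
    rw [← Complex.coe_smul]; push_cast; rfl
  rw [h1] at h
  have := smul_nonneg (inv_nonneg.2 (by positivity : (0 : ℝ) ≤ (N : ℝ) + 1)) h
  rwa [inv_smul_smul₀ (by positivity)] at this

/-- For M = B⋆B the k-th term of the series is ∑_l w_l⋆ w_l with w_l = ∑_i `ampPow k (B l i * P_N)`
a_i, because `ampPow k` is a ⋆-homomorphism. Strict limits of positive operators are positive. -/
theorem psiPhi_sum_nonneg (N : ℕ) {ι : Type*} [Fintype ι]
    (M : ι → ι → Adjointable (fock E) (fock E)) (B : ι → ι → Adjointable (fock E) (fock E))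
    (hM : ∀ i j, M i j = ∑ l, star (B l i) * B l j) (a : ι → Adjointable (fock E) (fock E)) :
    0 ≤ ∑ i, ∑ j, star (a i) * PsiPhi E N (M i j) * a j := by
  have hs : HasStrictSum (fun k => ∑ i, ∑ j, star (a i) * ampPow E k (compress E N (M i j)) * a j)
      (∑ i, ∑ j, star (a i) * (((N : ℂ) + 1) • PsiPhi E N (M i j)) * a j) :=
    HasStrictSum.sum _ fun i _ => HasStrictSum.sum _ fun j _ =>
      ((hasStrictSum_PsiPhi E N (M i j)).mul_left _).mul_right _
  have hpos := hs.nonneg fun k => by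
    have : ∑ i, ∑ j, star (a i) * ampPow E k (compress E N (M i j)) * a j
        = ∑ l, star (∑ i, ampPow E k (B l i * P E N) * a i)
          * ∑ i, ampPow E k (B l i * P E N) * a i := by
      have h1 : ∀ i j, star (a i) * ampPow E k (compress E N (M i j)) * a j
          = ∑ l, star (ampPow E k (B l i * P E N) * a i) * (ampPow E k (B l j * P E N) * a j) := by
        intro i j
        rw [compress, hM, Finset.mul_sum, Finset.sum_mul, _root_.map_sum, Finset.mul_sum,
          Finset.sum_mul]
        refine Finset.sum_congr rfl fun l _ => ?_
        simp only [star_mul, ← map_star, _root_.map_mul, star_P, mul_assoc]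
      simp only [h1, star_sum, Finset.sum_mul, Finset.mul_sum]
      rw [Finset.sum_comm]
      simp only [fun j => Finset.sum_comm (s := Finset.univ) (t := Finset.univ)
        (f := fun i l => star (ampPow E k (B l i * P E N) * a i) *
          (ampPow E k (B l j * P E N) * a j))]
      rw [Finset.sum_comm]
    rw [this]
    exact Finset.sum_nonneg fun l _ => star_mul_self_nonneg _
  refine smul_nonneg_of_natCast_smul E (N := N) ?_
  simpa only [mul_smul_comm, smul_mul_assoc, ← Finset.smul_sum] using hpos

theorem star_PsiPhi (N : ℕ) (x : Adjointable (fock E) (fock E)) :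
    star (PsiPhi E N x) = PsiPhi E N (star x) := by
  have h := (hasStrictSum_PsiPhi E N x).star
  simp only [← map_star, star_compress, star_smul, star_add, star_one, star_natCast] at h
  rw [PsiPhi_eq_of_hasStrictSum E h, inv_smul_smul₀ (natCast_add_one_ne_zero N)]

/-- `Ψ_N ∘ φ_N` as a completely positive map. -/
def psiPhiCP (N : ℕ) :
    CompletelyPositiveMap (Adjointable (fock E) (fock E)) (Adjointable (fock E) (fock E)) where
  toLinearMap := psiPhiHom E N
  map_cstarMatrix_nonneg' k M hM := by
    obtain ⟨B, hB⟩ := CStarAlgebra.exists_star_mul_self hM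
    have hMB : ∀ i j, M i j = ∑ l, star (B l i) * B l j := fun i j => by
      have : M i j = (star B * B) i j := by rw [hB]
      rw [CStarMatrix.mul_apply] at this
      exact this
    -- A self-adjoint operator matrix is positive once all the sums ∑ a_i⋆ M_ij a_j are; this
    -- reduces complete positivity to `psiPhi_sum_nonneg`.
    refine CStarMatrix.nonneg_of_conj_diag _ ?_ fun a => psiPhi_sum_nonneg E N _ _ hMB a
    refine CStarMatrix.ext fun i j => ?_
    change star (PsiPhi E N (M j i)) = PsiPhi E N (M i j)
    rw [star_PsiPhi]
    congr 1
    have hsa : star M = M := (IsSelfAdjoint.of_nonneg hM).star_eq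
    exact congrFun (congrFun hsa i) j

end CStarCorrespondence

/-! ### Relations among creation operators -/

namespace CStarCorrespondence

open HilbertModule HilbertModule.Adjointable UniformSpace

variable (E : CStarCorrespondence A)

/-- The left action of `A` on `Eⁿ`. -/
def leftAct (a : A) : ∀ n : ℕ, Adjointable (tpow E n) (tpow E n)
  | 0 => ofVector (F := HilbertModule.self A) a
  | n + 1 => tensorId E (leftAct a n)

theorem leftAct_one (n : ℕ) : leftAct E 1 n = 1 := by
  induction n with
  | zero => exact Adjointable.ext fun b => one_mul (show A from b)
  | succ n ih => exact (congrArg (tensorId E) ih).trans (tensorId_one E)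

/-- The codomains E^{0+n} and E^n agree only propositionally, hence the heterogeneous equality. It
becomes an ordinary one after inclusion into the Fock module, in `create_ofA_incl`. -/
theorem createLevel_ofA (a : A) (n : ℕ) : createLevel E (ofA E a) n ≍ leftAct E a n := by
  induction n with
  | zero => rfl
  | succ n ih => exact tensorId_heq E (by omega) _ _ ih

theorem create_ofA_incl (a : A) (n : ℕ) (x : tpow E n) :
    create E (ofA E a) (incl E n x) = incl E n (leftAct E a n x) := by
  rw [create_incl]
  exact incl_heq E (by omega) _ _ (createLevel_ofA E a n) x

theorem create_ofA_one : create E (ofA E 1) = 1 :=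
  fock_ext fun n x => by rw [create_ofA_incl, leftAct_one]; rfl

/-- On E^0 = A this is (μ a) b = μ (a b); tensoring with I_E carries it to the higher levels. -/
theorem createLevel_op_smul {r : ℕ} (μ : tpow E r) (a : A) (n : ℕ) :
    createLevel E (op a • μ) n ≍
      (createLevel E μ n).comp (leftAct E a n) := by
  induction n with
  | zero =>
    refine heq_of_eq (Adjointable.ext fun b => ?_)
    exact (mul_smul (op (show A from b)) (op a) μ).symm
  | succ n ih =>
    exact heq_of_eq ((congrArg (tensorId E) (eq_of_heq ih)).trans (tensorId_comp E _ _))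

theorem create_op_smul {r : ℕ} (μ : tpow E r) (a : A) :
    create E (op a • μ) = create E μ * create E (ofA E a) :=
  fock_ext fun n x => by
    rw [mul_apply, create_ofA_incl, create_incl, create_incl,
      eq_of_heq (createLevel_op_smul E μ a n), comp_apply]

/-- On E^0 = A this is ⟪μ, ν b⟫ = ⟪μ, ν⟫ b. The passage T ↦ T ⊗ I_E respects products and adjoints
and carries the identity to the higher levels. -/
theorem createLevel_adjoint_comp {r : ℕ} (μ ν : tpow E r) (n : ℕ) :
    (createLevel E μ n).adjoint.comp (createLevel E ν n)
      = leftAct E ((tpow E r).inner μ ν) n := by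
  induction n with
  | zero =>
    exact Adjointable.ext fun b => (tpow E r).inner_op_smul_right μ ν b
  | succ n ih =>
    refine Eq.trans ?_ (congrArg (tensorId E) ih)
    exact (tensorId_comp E (createLevel E μ n).adjoint (createLevel E ν n)).symm

theorem create_comp_incl {r : ℕ} (μ : tpow E r) (n : ℕ) :
    (create E μ).comp (incl E n) = (incl E (r + n)).comp (createLevel E μ n) :=
  Adjointable.ext fun x => create_incl E μ n x

theorem star_create_incl {r : ℕ} (μ : tpow E r) (n : ℕ) (y : tpow E (r + n)) :
    star (create E μ) (incl E (r + n) y) = incl E n ((createLevel E μ n).adjoint y) := by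
  refine (fock E).ext_inner fun z => ?_
  rw [star_eq_adjoint, ← inner_left]
  refine fock_induction (p := fun z => (fock E).inner (create E μ z) (incl E (r + n) y)
    = (fock E).inner z (incl E n ((createLevel E μ n).adjoint y))) z ?_ ?_ ?_ ?_
  · exact _root_.isClosed_eq
      ((fock E).continuous_inner.comp (Continuous.prodMk (create E μ).continuous continuous_const))
      ((fock E).continuous_inner.comp (Continuous.prodMk continuous_id continuous_const))
  · rw [Adjointable.map_zero, HilbertModule.inner_zero_left, HilbertModule.inner_zero_left]
  · intro m b
    rw [create_incl, inner_left (incl E (r + m)), inner_left (incl E m)]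
    by_cases h : m = n
    · subst h
      rw [incl_adjoint_incl_apply_same, incl_adjoint_incl_apply_same, inner_left]
    · rw [incl_adjoint_incl_apply_ne E h, incl_adjoint_incl_apply_ne E (by omega),
        HilbertModule.inner_zero_right, HilbertModule.inner_zero_right]
  · intro z w hz hw
    rw [Adjointable.map_add, HilbertModule.inner_add_left, HilbertModule.inner_add_left, hz, hw]

/-- The Toeplitz relation: on each level, annihilation by μ after creation by ν is the left action
of ⟪μ, ν⟫. -/
theorem star_create_mul_create {r : ℕ} (μ ν : tpow E r) :
    star (create E μ) * create E ν = create E (ofA E ((tpow E r).inner μ ν)) :=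
  fock_ext fun n x => by
    rw [mul_apply, create_incl, star_create_incl, create_ofA_incl, ← createLevel_adjoint_comp,
      comp_apply]

/-- This is the Toeplitz relation for μ = a and ν = 1, since t_1 = 1. -/
theorem star_create_ofA (a : A) : star (create E (ofA E a)) = create E (ofA E (star a)) := by
  have := star_create_mul_create E (ofA E a) (ofA E 1)
  rw [create_ofA_one, mul_one] at this
  rw [this]
  congr 2
  exact mul_one (star a)

/-! ### Density of the words t_μ t_ν⋆ -/

/-- The closed linear subspace spanned by the `t_μ` with `μ ∈ Eʳ`. -/
def createRange (r : ℕ) : Submodule ℂ (Adjointable (fock E) (fock E)) :=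
  (LinearMap.range (createHom E r)).topologicalClosure

theorem create_mem_createRange {r : ℕ} (μ : tpow E r) : create E μ ∈ createRange E r :=
  Submodule.le_topologicalClosure _ ⟨μ, rfl⟩

theorem isClosed_createRange (r : ℕ) :
    IsClosed (createRange E r : Set (Adjointable (fock E) (fock E))) :=
  Submodule.isClosed_topologicalClosure _

/-- A condition that is closed and linear in T need only be checked on the operators t_μ. -/
theorem createRange_induction {B : Submodule ℂ (Adjointable (fock E) (fock E))}
    (hB : IsClosed (B : Set (Adjointable (fock E) (fock E)))) {r : ℕ}
    (L : Adjointable (fock E) (fock E) →ₗ[ℂ] Adjointable (fock E) (fock E)) (hL : Continuous L)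
    (h : ∀ μ : tpow E r, L (create E μ) ∈ B) {T : Adjointable (fock E) (fock E)}
    (hT : T ∈ createRange E r) : L T ∈ B := by
  have h1 : createRange E r ≤ B.comap L := by
    refine Submodule.topologicalClosure_minimal _ ?_ (hB.preimage hL)
    rintro _ ⟨μ, rfl⟩
    exact h μ
  exact h1 hT

theorem createRange_mul_toTpow {r : ℕ} (ξ : E.toHilbertModule)
    {T : Adjointable (fock E) (fock E)} (hT : T ∈ createRange E r) :
    T * create E (toTpow E ξ) ∈ createRange E (r + 1) :=
  createRange_induction E (isClosed_createRange E (r + 1))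
    (LinearMap.mulRight ℂ (create E (toTpow E ξ))) (continuous_mul_const _)
    (fun μ => by
      rw [LinearMap.mulRight_apply, ← create_tmul]; exact create_mem_createRange E _) hT

/-- To prove that `S t_μ` lies in a closed subspace for all `μ ∈ Eʳ⁺¹`, elementary tensors
suffice. -/
theorem mul_create_mem_of_tmul {B : Submodule ℂ (Adjointable (fock E) (fock E))}
    (hB : IsClosed (B : Set (Adjointable (fock E) (fock E)))) {r : ℕ}
    (S : Adjointable (fock E) (fock E))
    (h : ∀ (x : tpow E r) (ξ : E.toHilbertModule),
      S * (create E x * create E (toTpow E ξ)) ∈ B) (μ : tpow E (r + 1)) :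
    S * create E μ ∈ B := by
  refine tensor_induction (F := tpow E r) (E := E) (p := fun z : tpow E (r + 1) =>
    S * createHom E (r + 1) z ∈ B) μ ?_ ?_ ?_ ?_
  · exact hB.preimage ((continuous_const_mul S).comp (continuous_create E (r + 1)))
  · change S * createHom E (r + 1) 0 ∈ B
    rw [_root_.map_zero, mul_zero]; exact zero_mem B
  · intro x ξ
    change S * create E (tmulVec E x ξ) ∈ B
    rw [create_tmul]; exact h x ξ
  · intro z w hz hw
    have : createHom E (r + 1) (z + w) = createHom E (r + 1) z + createHom E (r + 1) w :=
      _root_.map_add _ _ _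
    change S * createHom E (r + 1) (z + w) ∈ B
    rw [this, mul_add]
    exact add_mem hz hw

/-- Since t_{x⊗ξ} = t_x t_ξ, the last tensor factor can be peeled off on the right, which leads down
to t_a t_b = t_{ab} on degree 0. General vectors are limits of sums of elementary tensors, and
membership in a closed subspace is all that the density of words requires. -/
theorem create_ofA_mul_create (a : A) {r : ℕ} (μ : tpow E r) :
    create E (ofA E a) * create E μ ∈ createRange E r := by
  induction r with
  | zero =>
    have := create_op_smul E (ofA E a) (show A from μ)
    change create E (ofA E a) * create E (ofA E (show A from μ)) ∈ _
    rw [← this]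
    exact create_mem_createRange E _
  | succ r ih =>
    refine mul_create_mem_of_tmul E (isClosed_createRange E (r + 1)) _ (fun x ξ => ?_) μ
    rw [← mul_assoc]
    exact createRange_mul_toTpow E ξ (ih x)

/-- Same peeling of the last factor; the induction starts from t_η t_a = t_{ηa}. -/
theorem create_toTpow_mul_create (η : E.toHilbertModule) {r : ℕ} (μ : tpow E r) :
    create E (toTpow E η) * create E μ ∈ createRange E (r + 1) := by
  induction r with
  | zero =>
    have := create_op_smul E (toTpow E η) (show A from μ)
    change create E (toTpow E η) * create E (ofA E (show A from μ)) ∈ _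
    rw [← this]
    exact create_mem_createRange E _
  | succ r ih =>
    refine mul_create_mem_of_tmul E (isClosed_createRange E (r + 1 + 1)) _ (fun x ξ => ?_) μ
    rw [← mul_assoc]
    exact createRange_mul_toTpow E ξ (ih x)

/-- Same peeling of the last factor; the induction starts in degree 1 with the Toeplitz relation
t_η⋆ t_μ = t_{⟪η,μ⟫}. -/
theorem star_create_toTpow_mul_create (η : E.toHilbertModule) {r : ℕ} (μ : tpow E (r + 1)) :
    star (create E (toTpow E η)) * create E μ ∈ createRange E r := by
  induction r with
  | zero => rw [star_create_mul_create]; exact create_mem_createRange E _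
  | succ r ih =>
    refine mul_create_mem_of_tmul E (isClosed_createRange E (r + 1)) _ (fun x ξ => ?_) μ
    rw [← mul_assoc]
    exact createRange_mul_toTpow E ξ (ih x)

/-- The linear span of the operators `t_μ t_ν⋆`. -/
def wordSpan : Submodule ℂ (Adjointable (fock E) (fock E)) :=
  Submodule.span ℂ {T | ∃ (m n : ℕ) (μ : tpow E m) (ν : tpow E n),
    T = create E μ * star (create E ν)}

theorem word_mem_closure {m n : ℕ} (μ : tpow E m) (ν : tpow E n) :
    create E μ * star (create E ν) ∈ (wordSpan E).topologicalClosure :=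
  Submodule.le_topologicalClosure _ (Submodule.subset_span ⟨m, n, μ, ν, rfl⟩)

theorem isClosed_word_closure :
    IsClosed ((wordSpan E).topologicalClosure : Set (Adjointable (fock E) (fock E))) :=
  Submodule.isClosed_topologicalClosure _

theorem createRange_mul_star_mem {m n : ℕ} (ν : tpow E n) {T : Adjointable (fock E) (fock E)}
    (hT : T ∈ createRange E m) : T * star (create E ν) ∈ (wordSpan E).topologicalClosure :=
  createRange_induction E (isClosed_word_closure E)
    (LinearMap.mulRight ℂ (star (create E ν))) (continuous_mul_const _)
    (fun μ => word_mem_closure E μ ν) hT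

theorem mul_mem_word_closure {S : Adjointable (fock E) (fock E)}
    (hS : ∀ (m n : ℕ) (μ : tpow E m) (ν : tpow E n),
      S * (create E μ * star (create E ν)) ∈ (wordSpan E).topologicalClosure)
    {T : Adjointable (fock E) (fock E)} (hT : T ∈ (wordSpan E).topologicalClosure) :
    S * T ∈ (wordSpan E).topologicalClosure := by
  have h : Set.MapsTo (fun T => S * T) (wordSpan E : Set (Adjointable (fock E) (fock E)))
      ((wordSpan E).topologicalClosure : Set (Adjointable (fock E) (fock E))) := by
    intro T hT
    change S * T ∈ (wordSpan E).topologicalClosure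
    rw [SetLike.mem_coe] at hT
    induction hT using Submodule.span_induction with
    | mem T hT =>
      obtain ⟨m, n, μ, ν, rfl⟩ := hT
      exact hS m n μ ν
    | zero => rw [mul_zero]; exact zero_mem _
    | add x y _ _ hx hy => rw [mul_add]; exact add_mem hx hy
    | smul c x _ hx => rw [mul_smul_comm]; exact Submodule.smul_mem _ c hx
  exact closure_minimal h ((isClosed_word_closure E).preimage (continuous_const_mul S)) hT

theorem create_ofA_mul_mem (a : A) {T : Adjointable (fock E) (fock E)}
    (hT : T ∈ (wordSpan E).topologicalClosure) :
    create E (ofA E a) * T ∈ (wordSpan E).topologicalClosure :=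
  mul_mem_word_closure E (fun m n μ ν => by
    rw [← mul_assoc]
    exact createRange_mul_star_mem E ν (create_ofA_mul_create E a μ)) hT

theorem create_toTpow_mul_mem (η : E.toHilbertModule) {T : Adjointable (fock E) (fock E)}
    (hT : T ∈ (wordSpan E).topologicalClosure) :
    create E (toTpow E η) * T ∈ (wordSpan E).topologicalClosure :=
  mul_mem_word_closure E (fun m n μ ν => by
    rw [← mul_assoc]
    exact createRange_mul_star_mem E ν (create_toTpow_mul_create E η μ)) hT

/-- If the word starts with at least one creation operator, t_η⋆ is absorbed by it. If it starts
with a ∈ A, then t_η⋆ t_a t_ν⋆ is the adjoint of t_ν t_{a⋆} t_η, which is t of νa⋆ ⊗ η. -/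
theorem star_create_toTpow_mul_mem (η : E.toHilbertModule) {T : Adjointable (fock E) (fock E)}
    (hT : T ∈ (wordSpan E).topologicalClosure) :
    star (create E (toTpow E η)) * T ∈ (wordSpan E).topologicalClosure :=
  mul_mem_word_closure E (fun m n μ ν => by
    cases m with
    | zero =>
      have h1 : star (create E (toTpow E η)) * (create E μ * star (create E ν))
          = create E (ofA E 1) * star (create E
            (tmulVec E (op (star (show A from μ)) • ν) η)) := by
        rw [create_ofA_one, one_mul, create_tmul, create_op_smul, ← star_create_ofA]
        simp only [star_mul, star_star]
        rfl
      rw [h1]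
      exact word_mem_closure E _ _
    | succ m =>
      rw [← mul_assoc]
      exact createRange_mul_star_mem E ν (star_create_toTpow_mul_create E η μ)) hT

/-- The operators `t_μ t_ν⋆` span a dense subspace of the Toeplitz–Pimsner algebra. -/
theorem toeplitz_le_closure {x : Adjointable (fock E) (fock E)} (hx : x ∈ toeplitz E) :
    x ∈ closure (wordSpan E : Set (Adjointable (fock E) (fock E))) := by
  -- The closed span of the words is stable under left multiplication by the generators and their
  -- adjoints, hence by the algebra that they generate. As it contains 1, it contains that algebra,
  -- and being closed it contains the closure.
  have hsub : ∀ x ∈ StarAlgebra.adjoin ℂ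
      ({T | ∃ a : A, T = create E (ofA E a)} ∪
        {T | ∃ ξ : E.toHilbertModule, T = create E (toTpow E ξ)}),
      ∀ T ∈ (wordSpan E).topologicalClosure, x * T ∈ (wordSpan E).topologicalClosure := by
    intro x hx
    rw [← StarSubalgebra.mem_toSubalgebra, StarAlgebra.adjoin_toSubalgebra] at hx
    induction hx using Algebra.adjoin_induction with
    | mem x hx =>
      intro T hT
      -- As a plain algebra, the ⋆-algebra is generated by the generators together with their
      -- adjoints, which accounts for the four cases.
      rcases hx with (⟨a, rfl⟩ | ⟨ξ, rfl⟩) | (⟨a, ha⟩ | ⟨ξ, hξ⟩)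
      · exact create_ofA_mul_mem E a hT
      · exact create_toTpow_mul_mem E ξ hT
      · rw [← star_star x, ha, star_create_ofA]
        exact create_ofA_mul_mem E _ hT
      · rw [← star_star x, hξ]
        exact star_create_toTpow_mul_mem E ξ hT
    | algebraMap c =>
      intro T hT
      rw [Algebra.algebraMap_eq_smul_one, smul_mul_assoc, one_mul]
      exact Submodule.smul_mem _ c hT
    | add x y _ _ hx hy =>
      intro T hT
      rw [add_mul]
      exact add_mem (hx T hT) (hy T hT)
    | mul x y _ _ hx hy =>
      intro T hT
      rw [mul_assoc]
      exact hx _ (hy T hT)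
  have h1 : (1 : Adjointable (fock E) (fock E)) ∈ (wordSpan E).topologicalClosure := by
    have := word_mem_closure E (ofA E 1) (ofA E 1)
    rwa [create_ofA_one, star_one, mul_one] at this
  refine closure_minimal (fun y hy => ?_) (isClosed_word_closure E) hx
  have := hsub y hy 1 h1
  rwa [mul_one] at this

theorem wordSpan_le_toeplitz : wordSpan E ≤ (toeplitz E).toSubalgebra.toSubmodule := by
  refine Submodule.span_le.2 ?_
  rintro _ ⟨m, n, μ, ν, rfl⟩
  exact (toeplitz E).mul_mem (create_mem_toeplitz E μ)
    ((toeplitz E).star_mem' (create_mem_toeplitz E ν))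

end CStarCorrespondence

/-! ### Balanced tensors and rank one operators -/

namespace HilbertModule

open Adjointable UniformSpace

theorem tmul_add_right {F : HilbertModule A} {E : CStarCorrespondence A} (x : F)
    (y y' : E.toHilbertModule) : (tmul x (y + y') : F.tensor E) = tmul x y + tmul x y' :=
  (congrArg (Completion.coe' (α := preTensor F E)) (Finsupp.single_add x y y')).trans
    (Completion.coe_add (α := preTensor F E) (Finsupp.single x y) (Finsupp.single x y'))

theorem tmul_sum_right {F : HilbertModule A} {E : CStarCorrespondence A} (x : F) {ι : Type*}
    (s : Finset ι) (y : ι → E.toHilbertModule) :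
    (tmul x (∑ i ∈ s, y i) : F.tensor E) = ∑ i ∈ s, tmul x (y i) :=
  map_sum (AddMonoidHom.mk' (fun y => (tmul x y : F.tensor E)) (tmul_add_right x)) y s

theorem tmul_op_smul_right {F : HilbertModule A} {E : CStarCorrespondence A} (x : F)
    (a : A) (y : E.toHilbertModule) : (tmul x (op a • y) : F.tensor E) = op a • tmul x y :=
  (congrArg (Completion.coe' (α := preTensor F E))
    (Finsupp.smul_single (op a) x y).symm).trans
    (Completion.coe_smul (X := preTensor F E) (op a) (Finsupp.single x y))

/-- Formal sums are not balanced over `A`; the two sides coincide because they have the same inner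
products with all elementary tensors, φ being multiplicative. -/
theorem tmul_op_smul_left {F : HilbertModule A} {E : CStarCorrespondence A} (x : F)
    (a : A) (y : E.toHilbertModule) : (tmul (op a • x) y : F.tensor E) = tmul x (E.φ a y) := by
  refine (F.tensor E).ext_inner fun z => ?_
  induction z using tensor_induction with
  | hc =>
    refine _root_.isClosed_eq ?_ ?_ <;>
    exact (F.tensor E).continuous_inner.comp (Continuous.prodMk continuous_id continuous_const)
  | h0 => simp only [HilbertModule.inner_zero_left]
  | ht b w =>
    rw [inner_tmul, inner_tmul, F.inner_op_smul_right, map_mul, mul_apply]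
  | ha z w hz hw => simp only [HilbertModule.inner_add_left, hz, hw]

namespace Adjointable

variable {F G : HilbertModule A}

theorem star_rankOne (x y : F) : star (rankOne x y) = rankOne y x := rfl

theorem rankOne_apply_apply (S R : Adjointable F F) (x y : F) :
    rankOne (S x) (R y) = S * rankOne x y * star R :=
  ext fun z => by
    rw [mul_apply, mul_apply, rankOne_apply, rankOne_apply, map_op_smul, star_eq_adjoint,
      ← inner_left]

theorem rankOne_add_left (x x' : G) (y : F) : rankOne (x + x') y = rankOne x y + rankOne x' y :=
  ext fun z => by rw [add_apply, rankOne_apply, rankOne_apply, rankOne_apply, smul_add]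

theorem norm_rankOne_le (x : G) (y : F) : ‖rankOne x y‖ ≤ ‖y‖ * ‖x‖ :=
  norm_le_of _ (by positivity) fun z => by
    rw [rankOne_apply]
    refine (G.norm_op_smul_le _ _).trans ?_
    have := F.norm_inner_le y z
    nlinarith [norm_nonneg x]

theorem continuous_rankOne_left (y : F) : Continuous fun x : G => rankOne x y :=
  AddMonoidHomClass.continuous_of_bound
    (AddMonoidHom.mk' (fun x : G => rankOne x y) fun x x' => rankOne_add_left x x' y) ‖y‖
    fun x => norm_rankOne_le x y

end Adjointable

end HilbertModule

/-! ### The value of Ψ_N ∘ φ_N on the words t_μ t_ν⋆ -/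

namespace CStarCorrespondence

open HilbertModule HilbertModule.Adjointable UniformSpace

variable (E : CStarCorrespondence A)

/-- The tail, from level `l` on, of the resolution of the identity by level projections. -/
theorem hasStrictSum_levelProj_add (l : ℕ) :
    HasStrictSum (fun k => levelProj E (k + l)) (1 - setProj E (Finset.range l)) := fun z => by
  have h := (hasSum_nat_add_iff' (f := fun k => levelProj E k z) l).2 (hasStrictSum_levelProj E z).1
  have h1 : (1 - setProj E (Finset.range l)) z
      = (1 : Adjointable (fock E) (fock E)) z - ∑ i ∈ Finset.range l, levelProj E i z := by
    rw [Adjointable.sub_apply, setProj, Adjointable.sum_apply]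
  refine ⟨by rwa [h1], ?_⟩
  rw [star_sub, star_one, star_setProj, h1]
  exact h

theorem create_levelProj_block {m n : ℕ} (μ : tpow E m) (ν : tpow E n) (p : ℕ) :
    create E μ * levelProj E p * star (create E ν)
      = (incl E (m + p)).comp
        (((createLevel E μ p).comp (createLevel E ν p).adjoint).comp (incl E (n + p)).adjoint) := by
  have h1 : create E μ * levelProj E p * star (create E ν)
      = ((create E μ).comp (incl E p)).comp ((create E ν).comp (incl E p)).adjoint := rfl
  rw [h1, create_comp_incl, create_comp_incl]
  rfl

/-- Creation by μ on E^{p+1} is, by definition, creation by μ on E^p tensored with I_E. Amplifying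
the block t_μ Q_p t_ν⋆ therefore only raises p by one. -/
theorem amp_create_levelProj {m n : ℕ} (μ : tpow E m) (ν : tpow E n) (p : ℕ) :
    amp E (create E μ * levelProj E p * star (create E ν))
      = create E μ * levelProj E (p + 1) * star (create E ν) := by
  rw [create_levelProj_block, create_levelProj_block, amp_block]
  have : tensorId E ((createLevel E μ p).comp (createLevel E ν p).adjoint)
      = (tensorId E (createLevel E μ p)).comp (tensorId E (createLevel E ν p)).adjoint := by
    rw [tensorId_comp, tensorId_adjoint]
  rw [this]
  rfl

theorem ampPow_create_levelProj {m n : ℕ} (μ : tpow E m) (ν : tpow E n) (p k : ℕ) :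
    ampPow E k (create E μ * levelProj E p * star (create E ν))
      = create E μ * levelProj E (p + k) * star (create E ν) := by
  induction k with
  | zero => rfl
  | succ k ih => rw [ampPow_succ_apply, ih, amp_create_levelProj]; rfl

theorem setProj_incl (s : Finset ℕ) (n : ℕ) (a : tpow E n) :
    setProj E s (incl E n a) = if n ∈ s then incl E n a else 0 := by
  rw [setProj, Adjointable.sum_apply]
  split_ifs with h
  · rw [Finset.sum_eq_single_of_mem n h fun m _ hm => levelProj_incl_ne E hm a,
      levelProj_incl_same]
  · exact Finset.sum_eq_zero fun m hm => levelProj_incl_ne E (fun hmn : m = n => h (hmn ▸ hm)) a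

/-- Creation raises levels by m, so the output level is ≤ N exactly when the input level is < N + 1
- m. The truncated subtraction covers m > N, where the range is empty and both sides vanish. -/
theorem P_mul_create {m : ℕ} (μ : tpow E m) (N : ℕ) :
    P E N * create E μ = create E μ * setProj E (Finset.range (N + 1 - m)) :=
  fock_ext fun n a => by
    rw [mul_apply, mul_apply, create_incl, P_eq, setProj_incl, setProj_incl]
    by_cases h : m + n < N + 1
    · rw [if_pos (Finset.mem_range.2 h), if_pos (Finset.mem_range.2 (by omega)), create_incl]
    · rw [if_neg (by simpa using h), if_neg (by rw [Finset.mem_range]; omega),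
        Adjointable.map_zero]

theorem star_create_mul_P {n : ℕ} (ν : tpow E n) (N : ℕ) :
    star (create E ν) * P E N = setProj E (Finset.range (N + 1 - n)) * star (create E ν) := by
  have := congrArg star (P_mul_create E ν N)
  rwa [star_mul, star_mul, star_P, star_setProj] at this

theorem compress_create {m n : ℕ} (μ : tpow E m) (ν : tpow E n) (N : ℕ) :
    compress E N (create E μ * star (create E ν))
      = create E μ * setProj E (Finset.range (min (N + 1 - m) (N + 1 - n)))
        * star (create E ν) := by
  have h : Finset.range (N + 1 - m) ∩ Finset.range (N + 1 - n)
      = Finset.range (min (N + 1 - m) (N + 1 - n)) := by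
    ext i; simp
  rw [compress, ← mul_assoc, P_mul_create, mul_assoc _ _ (P E N), star_create_mul_P, ← h,
    ← setProj_mul]
  simp only [mul_assoc]

/-- `Ψ_N ∘ φ_N` multiplies `t_μ t_ν⋆` by a scalar, up to an operator supported on finitely many
levels. -/
theorem PsiPhi_create {m n : ℕ} (μ : tpow E m) (ν : tpow E n) (N : ℕ) :
    PsiPhi E N (create E μ * star (create E ν))
      = (((min (N + 1 - m) (N + 1 - n) : ℕ) : ℂ) / ((N : ℂ) + 1)) •
          (create E μ * star (create E ν))
        - ((N : ℂ) + 1)⁻¹ • ∑ l ∈ Finset.range (min (N + 1 - m) (N + 1 - n)),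
          create E μ * setProj E (Finset.range l) * star (create E ν) := by
  -- L counts the levels p for which both m + p and n + p are at most N; it is 0 if m or n exceeds
  -- N.
  set L := min (N + 1 - m) (N + 1 - n) with hL
  have h : HasStrictSum
      (fun k => ampPow E k (compress E N (create E μ * star (create E ν))))
      (∑ l ∈ Finset.range L,
        create E μ * (1 - setProj E (Finset.range l)) * star (create E ν)) := by
    -- The k-th term is ∑_{l<L} t_μ Q_{k+l} t_ν⋆. For fixed l, the sum over k is then a tail of the
    -- resolution of the identity.
    have h1 : (fun k => ampPow E k (compress E N (create E μ * star (create E ν))))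
        = fun k => ∑ l ∈ Finset.range L, create E μ * levelProj E (k + l) * star (create E ν) := by
      funext k
      rw [compress_create, ← hL, setProj, Finset.mul_sum, Finset.sum_mul, _root_.map_sum]
      refine Finset.sum_congr rfl fun l _ => ?_
      rw [ampPow_create_levelProj, add_comm]
    rw [h1]
    exact HasStrictSum.sum _ fun l _ =>
      ((hasStrictSum_levelProj_add E l).mul_left _).mul_right _
  rw [PsiPhi_eq_of_hasStrictSum E h]
  simp only [mul_sub, sub_mul, mul_one]
  rw [Finset.sum_sub_distrib, Finset.sum_const, Finset.card_range, smul_sub,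
    ← Nat.cast_smul_eq_nsmul ℂ, smul_smul, div_eq_inv_mul]

/-! ### Frames in the Fock representation -/

section Frame

variable {E}
variable {n : ℕ} {e f : Fin n → E.toHilbertModule}

/-- Since x = u⟪u, x⟫, every x ⊗ y equals u ⊗ φ(⟪u, x⟫) y, so a frame of `E` expands it. With F = A
and u = 1 this transports the frame from E to E¹ = A ⊗ E. -/
theorem sum_rankOne_tmul {F : HilbertModule A} (u : F) (hu : ∀ x, op (F.inner u x) • u = x)
    (hef : ∑ i, rankOne (e i) (f i) = 1) :
    ∑ i, rankOne (tmul u (e i) : F.tensor E) (tmul u (f i)) = 1 := by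
  refine tensor_ext fun x y => ?_
  have h1 : ∀ i, rankOne (tmul u (e i) : F.tensor E) (tmul u (f i)) (tmul x y)
      = tmul u (rankOne (e i) (f i) (E.φ (F.inner u x) y)) := fun i => by
    rw [rankOne_apply, rankOne_apply, inner_tmul, tmul_op_smul_right]
  rw [Adjointable.sum_apply, Finset.sum_congr rfl fun i _ => h1 i, ← tmul_sum_right,
    ← Adjointable.sum_apply, hef, one_apply, one_apply, ← tmul_op_smul_left, hu]

/-- For p = 0 this is the frame identity of E¹; tensoring with I_E preserves it and raises p. -/
theorem sum_createLevel_frame (hef : ∑ i, rankOne (e i) (f i) = 1) (p : ℕ) :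
    ∑ i, (createLevel E (toTpow E (e i)) p).comp (createLevel E (toTpow E (f i)) p).adjoint
      = 1 := by
  induction p with
  | zero =>
    have key := sum_rankOne_tmul (F := HilbertModule.self A) (ofA E 1)
      (fun x => (one_mul _).trans ((congrArg (fun b : A => b * (show A from x)) (star_one A)).trans
        (one_mul (show A from x)))) hef
    exact key
  | succ p ih =>
    refine Eq.trans ?_ ((congrArg (tensorId E) ih).trans (tensorId_one E))
    rw [tensorId_sum]
    refine Finset.sum_congr rfl fun i _ => ?_
    rw [tensorId_comp, tensorId_adjoint]
    rfl

theorem sum_create_levelProj_frame (hef : ∑ i, rankOne (e i) (f i) = 1) (p : ℕ) :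
    ∑ i, create E (toTpow E (e i)) * levelProj E p * star (create E (toTpow E (f i)))
      = levelProj E (p + 1) := by
  simp only [create_levelProj_block]
  rw [← comp_sum, ← sum_comp, sum_createLevel_frame hef, one_comp, add_comm p 1]
  rfl

/-- Summing t_{e_i} Q_p t_{f_i}⋆ over i gives Q_{p+1}. Summing then strictly over p yields all
levels except level 0. -/
theorem sum_create_frame (hef : ∑ i, rankOne (e i) (f i) = 1) :
    ∑ i, create E (toTpow E (e i)) * star (create E (toTpow E (f i))) = 1 - levelProj E 0 := by
  have h1 := HasStrictSum.sum Finset.univ fun (i : Fin n) _ =>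
    ((hasStrictSum_levelProj E).mul_left (create E (toTpow E (e i)))).mul_right
      (star (create E (toTpow E (f i))))
  simp only [sum_create_levelProj_frame hef, mul_one] at h1
  have h2 := hasStrictSum_levelProj_add E 1
  rw [Finset.range_one, setProj, Finset.sum_singleton] at h2
  exact h1.unique h2

end Frame

/-! ### Compact operators and the Toeplitz algebra -/

section Compacts

theorem create_incl_one {m : ℕ} (μ : tpow E m) : create E μ (incl E 0 (ofA E 1)) = incl E m μ :=
  (create_incl E μ 0 (ofA E 1)).trans (congrArg (incl E m) (one_smul Aᵐᵒᵖ μ))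

/-- The module E^0 = A is generated by its unit: a = 1 ⟪1, a⟫. -/
theorem levelProj_zero_eq : levelProj E 0 = rankOne (incl E 0 (ofA E 1)) (incl E 0 (ofA E 1)) := by
  have h : rankOne (ofA E 1) (ofA E 1) = 1 := Adjointable.ext fun a => by
    change (1 : A) * (star (1 : A) * (show A from a)) = a
    rw [star_one, one_mul, one_mul]
  have h2 : rankOne (incl E 0 (ofA E 1)) (incl E 0 (ofA E 1))
      = (incl E 0).comp ((rankOne (ofA E 1) (ofA E 1)).comp (incl E 0).adjoint) :=
    Adjointable.ext fun z => by
      rw [comp_apply, comp_apply, rankOne_apply, rankOne_apply, map_op_smul, ← inner_left]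
  rw [h2, h]
  rfl

theorem rankOne_incl {m n : ℕ} (μ : tpow E m) (ν : tpow E n) :
    rankOne (incl E m μ) (incl E n ν) = create E μ * levelProj E 0 * star (create E ν) := by
  rw [levelProj_zero_eq, ← rankOne_apply_apply, create_incl_one, create_incl_one]

/-- Q_0 has rank one, and the frame writes Q_{p+1} as a finite sum of products t_{e_i} Q_p t_{f_i}⋆.
-/
theorem levelProj_mem_compacts (hE : Module.Finite Aᵐᵒᵖ E.carrier) (p : ℕ) :
    levelProj E p ∈ compacts (fock E) := by
  induction p with
  | zero =>
    rw [levelProj_zero_eq]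
    exact Submodule.le_topologicalClosure _ (Submodule.subset_span ⟨_, _, rfl⟩)
  | succ p ih =>
    obtain ⟨n, e, f, hef⟩ := exists_frame E.toHilbertModule hE
    rw [← sum_create_levelProj_frame hef]
    exact Submodule.sum_mem _ fun i _ => mem_mul_compacts _ (mul_mem_compacts _ ih)

theorem levelProj_zero_mem_toeplitz (hE : Module.Finite Aᵐᵒᵖ E.carrier) :
    levelProj E 0 ∈ toeplitz E := by
  obtain ⟨n, e, f, hef⟩ := exists_frame E.toHilbertModule hE
  have h : levelProj E 0
      = 1 - ∑ i, create E (toTpow E (e i)) * star (create E (toTpow E (f i))) := by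
    rw [sum_create_frame hef, sub_sub_cancel]
  rw [h]
  exact sub_mem (one_mem _) (sum_mem fun i _ =>
    mul_mem (create_mem_toeplitz E _) (star_mem (create_mem_toeplitz E _)))

theorem rankOne_mem_toeplitz (hE : Module.Finite Aᵐᵒᵖ E.carrier) (x y : fock E) :
    rankOne x y ∈ toeplitz E := by
  have key : ∀ y : fock E, (∀ n a, rankOne (incl E n a) y ∈ toeplitz E) →
      ∀ x, rankOne x y ∈ toeplitz E := fun y h x => by
    refine fock_induction (p := fun x => rankOne x y ∈ toeplitz E) x
      ((isClosed_toeplitz E).preimage (continuous_rankOne_left y)) ?_ h fun z w hz hw => ?_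
    · have : rankOne (0 : fock E) y = 0 :=
        Adjointable.ext fun z => by rw [rankOne_apply, smul_zero, Adjointable.zero_apply]
      rw [this]; exact zero_mem _
    · rw [rankOne_add_left]; exact add_mem hz hw
  -- The reduction to vectors of a single level is applied to the left entry and then, after taking
  -- adjoints, to the right one.
  refine key y (fun m a => ?_) x
  rw [← star_rankOne]
  refine star_mem (key _ (fun n b => ?_) y)
  rw [rankOne_incl]
  exact mul_mem (mul_mem (create_mem_toeplitz E _) (levelProj_zero_mem_toeplitz E hE))
    (star_mem (create_mem_toeplitz E _))

theorem compacts_le_toeplitz (hE : Module.Finite Aᵐᵒᵖ E.carrier)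
    {x : Adjointable (fock E) (fock E)} (hx : x ∈ compacts (fock E)) : x ∈ toeplitz E := by
  have h : compacts (fock E) ≤ (toeplitz E).toSubalgebra.toSubmodule := by
    refine Submodule.topologicalClosure_minimal _ (Submodule.span_le.2 ?_) (isClosed_toeplitz E)
    rintro _ ⟨x, y, rfl⟩
    exact rankOne_mem_toeplitz E hE x y
  exact h hx

theorem create_setProj_mem_compacts (hE : Module.Finite Aᵐᵒᵖ E.carrier) {m n : ℕ} (μ : tpow E m)
    (ν : tpow E n) (s : Finset ℕ) :
    create E μ * setProj E s * star (create E ν) ∈ compacts (fock E) :=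
  mem_mul_compacts _ (mul_mem_compacts _
    (Submodule.sum_mem _ fun p _ => levelProj_mem_compacts E hE p))

/-- The error terms of `PsiPhi_create` involve only finitely many levels, and all level projections
are compact when `E` is finitely generated. -/
theorem PsiPhi_create_sub_mem_compacts (hE : Module.Finite Aᵐᵒᵖ E.carrier) {m n : ℕ}
    (μ : tpow E m) (ν : tpow E n) (N : ℕ) :
    PsiPhi E N (create E μ * star (create E ν))
      - (((min (N + 1 - m) (N + 1 - n) : ℕ) : ℂ) / ((N : ℂ) + 1)) •
          (create E μ * star (create E ν)) ∈ compacts (fock E) := by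
  rw [PsiPhi_create, sub_sub_cancel_left]
  exact Submodule.neg_mem _ (Submodule.smul_mem _ _ (Submodule.sum_mem _ fun l _ =>
    create_setProj_mem_compacts E hE μ ν _))

/-- On a word the value is a multiple of the word plus a compact operator, and K(Γ_E) ⊆ T_E.
Contractivity of Ψ_N ∘ φ_N extends this from the dense span of the words. -/
theorem PsiPhi_mem_toeplitz (hE : Module.Finite Aᵐᵒᵖ E.carrier) (N : ℕ)
    {x : Adjointable (fock E) (fock E)} (hx : x ∈ toeplitz E) : PsiPhi E N x ∈ toeplitz E := by
  have hcont : Continuous (psiPhiHom E N) :=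
    ((psiPhiHom E N).mkContinuous 1 fun x => by rw [one_mul]; exact norm_PsiPhi_le E N x).continuous
  have hword : Set.MapsTo (psiPhiHom E N) (wordSpan E : Set (Adjointable (fock E) (fock E)))
      (toeplitz E : Set (Adjointable (fock E) (fock E))) := by
    intro w hw
    rw [SetLike.mem_coe] at hw
    change psiPhiHom E N w ∈ toeplitz E
    induction hw using Submodule.span_induction with
    | mem w hw =>
      obtain ⟨m, n, μ, ν, rfl⟩ := hw
      have h := compacts_le_toeplitz E hE (PsiPhi_create_sub_mem_compacts E hE μ ν N)
      have h2 := (toeplitz E).smul_mem (mul_mem (create_mem_toeplitz E μ)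
        (star_mem (create_mem_toeplitz E ν)))
        (((min (N + 1 - m) (N + 1 - n) : ℕ) : ℂ) / ((N : ℂ) + 1))
      rw [psiPhiHom_apply, ← sub_add_cancel (PsiPhi E N (create E μ * star (create E ν)))]
      exact add_mem h h2
    | zero => rw [_root_.map_zero]; exact zero_mem _
    | add x y _ _ hx hy => rw [_root_.map_add]; exact add_mem hx hy
    | smul c x _ hx => rw [_root_.map_smul]; exact (toeplitz E).smul_mem hx c
  have hmem : psiPhiHom E N x ∈ closure (toeplitz E : Set (Adjointable (fock E) (fock E))) :=
    map_mem_closure hcont (toeplitz_le_closure E hx) hword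
  rwa [(isClosed_toeplitz E).closure_eq] at hmem

end Compacts

/-! ### The maps V_N and their convergence -/

section Quotient

theorem p_eq_p_of_sub_mem {x y : toeplitz E}
    (h : (x : Adjointable (fock E) (fock E)) - y ∈ compacts (fock E)) :
    CuntzPimsner.p E x = CuntzPimsner.p E y :=
  Ideal.Quotient.eq.2 h

theorem norm_p_le (x : toeplitz E) : ‖CuntzPimsner.p E x‖ ≤ ‖x‖ :=
  Submodule.Quotient.norm_mk_le (compactIdeal E) x

theorem continuous_p : Continuous (CuntzPimsner.p E) :=
  AddMonoidHomClass.continuous_of_bound (CuntzPimsner.p E) 1 fun x => by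
    rw [one_mul]; exact norm_p_le E x

instance : ContinuousConstSMul ℂ (CuntzPimsner E) :=
  inferInstanceAs (ContinuousConstSMul ℂ (toeplitz E ⧸ compactIdeal E))

/-- With truncated subtraction a single coefficient serves all m and n, vanishing when m or n
exceeds N; the case distinction is postponed to `V_create_eq_ite`. -/
theorem V_create (hE : Module.Finite Aᵐᵒᵖ E.carrier) (N : ℕ)
    (hN : ∀ x ∈ toeplitz E, PsiPhi E N x ∈ toeplitz E) {m n : ℕ} (μ : tpow E m) (ν : tpow E n) :
    V E N hN (t E μ * star (t E ν))
      = (((min (N + 1 - m) (N + 1 - n) : ℕ) : ℂ) / ((N : ℂ) + 1)) • (s E μ * star (s E ν)) := by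
  have h1 : s E μ * star (s E ν) = CuntzPimsner.p E (t E μ * star (t E ν)) := by
    rw [s, s, CuntzPimsner.star_p, _root_.map_mul]
  rw [h1, ← _root_.map_smul]
  exact p_eq_p_of_sub_mem E (PsiPhi_create_sub_mem_compacts E hE μ ν N)

theorem V_create_eq_ite (hE : Module.Finite Aᵐᵒᵖ E.carrier) (N : ℕ)
    (hN : ∀ x ∈ toeplitz E, PsiPhi E N x ∈ toeplitz E) {m n : ℕ} (μ : tpow E m) (ν : tpow E n) :
    V E N hN (t E μ * star (t E ν)) =
      if m ≤ N ∧ n ≤ N then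
        (((min (N - m) (N - n) : ℕ) + 1 : ℂ) / ((N : ℂ) + 1)) • (s E μ * star (s E ν))
      else 0 := by
  rw [V_create E hE]
  split_ifs with h
  · have : min (N + 1 - m) (N + 1 - n) = min (N - m) (N - n) + 1 := by omega
    rw [this, Nat.cast_add_one]
  · have : min (N + 1 - m) (N + 1 - n) = 0 := by omega
    rw [this, Nat.cast_zero, zero_div, zero_smul]

/-- The linear map `V_N`. -/
def vHom (N : ℕ) (hN : ∀ x ∈ toeplitz E, PsiPhi E N x ∈ toeplitz E) :
    toeplitz E →ₗ[ℂ] CuntzPimsner E where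
  toFun := V E N hN
  map_add' x y := by
    rw [V, V, V, ← _root_.map_add]
    exact congrArg (CuntzPimsner.p E) (Subtype.ext ((psiPhiHom E N).map_add _ _))
  map_smul' c x := by
    rw [V, V, RingHom.id_apply, ← _root_.map_smul]
    exact congrArg (CuntzPimsner.p E) (Subtype.ext ((psiPhiHom E N).map_smul _ _))

theorem norm_V_le (N : ℕ) (hN : ∀ x ∈ toeplitz E, PsiPhi E N x ∈ toeplitz E) (x : toeplitz E) :
    ‖V E N hN x‖ ≤ ‖x‖ :=
  (norm_p_le E _).trans (norm_PsiPhi_le E N x)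

/-- As soon as N ≥ max(m, n), the coefficient equals 1 - max(m, n)/(N + 1). -/
theorem tendsto_coeff (m n : ℕ) :
    Tendsto (fun N : ℕ => ((min (N + 1 - m) (N + 1 - n) : ℕ) : ℂ) / ((N : ℂ) + 1)) atTop (𝓝 1) := by
  have h1 : Tendsto (fun N : ℕ => ((max m n : ℕ) : ℂ) / ((N + 1 : ℕ) : ℂ)) atTop (𝓝 0) :=
    (tendsto_const_div_atTop_nhds_zero_nat ((max m n : ℕ) : ℂ)).comp (tendsto_add_atTop_nat 1)
  have h2 := h1.const_sub 1
  rw [sub_zero] at h2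
  refine h2.congr' ?_
  filter_upwards [eventually_ge_atTop (max m n)] with N hN
  have h3 : min (N + 1 - m) (N + 1 - n) = N + 1 - max m n := by omega
  rw [h3, Nat.cast_sub (by omega), Nat.cast_add_one, sub_div, div_self (natCast_add_one_ne_zero N)]

theorem tendsto_V_of_mem_wordSpan (hE : Module.Finite Aᵐᵒᵖ E.carrier)
    (hT : ∀ N : ℕ, ∀ x ∈ toeplitz E, PsiPhi E N x ∈ toeplitz E)
    {w : Adjointable (fock E) (fock E)} (hw : w ∈ wordSpan E) :
    Tendsto (fun N => V E N (hT N) ⟨w, wordSpan_le_toeplitz E hw⟩) atTop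
      (𝓝 (CuntzPimsner.p E ⟨w, wordSpan_le_toeplitz E hw⟩)) := by
  change Tendsto (fun N => vHom E N (hT N) ⟨w, wordSpan_le_toeplitz E hw⟩) _ _
  induction hw using Submodule.span_induction with
  | mem w hw =>
    obtain ⟨m, n, μ, ν, rfl⟩ := hw
    have h1 : ∀ N, vHom E N (hT N) (t E μ * star (t E ν))
        = (((min (N + 1 - m) (N + 1 - n) : ℕ) : ℂ) / ((N : ℂ) + 1)) • (s E μ * star (s E ν)) :=
      fun N => V_create E hE N (hT N) μ ν
    have h2 : CuntzPimsner.p E (t E μ * star (t E ν)) = s E μ * star (s E ν) := by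
      rw [s, s, CuntzPimsner.star_p, _root_.map_mul]
    change Tendsto (fun N => vHom E N (hT N) (t E μ * star (t E ν))) _
      (𝓝 (CuntzPimsner.p E (t E μ * star (t E ν))))
    simp only [h1, h2]
    -- The limit is taken in T_E, where c_N t_μ t_ν⋆ tends to t_μ t_ν⋆, and then carried to O_E by
    -- the continuous linear map p.
    have h3 := (tendsto_coeff m n).smul_const (t E μ * star (t E ν))
    rw [one_smul] at h3
    have h4 := ((continuous_p E).tendsto _).comp h3
    refine (h4.congr fun N => ?_).trans_eq (by rw [h2])
    rw [Function.comp_apply, _root_.map_smul, h2]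
  | zero =>
    have h1 : ∀ N, vHom E N (hT N) 0 = CuntzPimsner.p E 0 := fun N => by
      rw [_root_.map_zero, _root_.map_zero]
    change Tendsto (fun N => vHom E N (hT N) 0) _ (𝓝 (CuntzPimsner.p E 0))
    simp only [h1]
    exact tendsto_const_nhds
  | add x y hx hy ihx ihy =>
    have h1 : ∀ N, vHom E N (hT N) ⟨x + y, wordSpan_le_toeplitz E (add_mem hx hy)⟩
        = vHom E N (hT N) ⟨x, wordSpan_le_toeplitz E hx⟩
          + vHom E N (hT N) ⟨y, wordSpan_le_toeplitz E hy⟩ := fun N => by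
      rw [← _root_.map_add]; rfl
    have h2 : CuntzPimsner.p E ⟨x + y, wordSpan_le_toeplitz E (add_mem hx hy)⟩
        = CuntzPimsner.p E ⟨x, wordSpan_le_toeplitz E hx⟩
          + CuntzPimsner.p E ⟨y, wordSpan_le_toeplitz E hy⟩ := by
      rw [← _root_.map_add]; rfl
    simp only [h1, h2]
    exact ihx.add ihy
  | smul c x hx ih =>
    have h1 : ∀ N, vHom E N (hT N) ⟨c • x, wordSpan_le_toeplitz E (Submodule.smul_mem _ c hx)⟩
        = c • vHom E N (hT N) ⟨x, wordSpan_le_toeplitz E hx⟩ := fun N => by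
      rw [← _root_.map_smul]; rfl
    have h2 : CuntzPimsner.p E ⟨c • x, wordSpan_le_toeplitz E (Submodule.smul_mem _ c hx)⟩
        = c • CuntzPimsner.p E ⟨x, wordSpan_le_toeplitz E hx⟩ := by
      rw [← _root_.map_smul]; rfl
    simp only [h1, h2]
    exact ih.const_smul c

theorem tendsto_V (hE : Module.Finite Aᵐᵒᵖ E.carrier)
    (hT : ∀ N : ℕ, ∀ x ∈ toeplitz E, PsiPhi E N x ∈ toeplitz E) (x : toeplitz E) :
    Tendsto (fun N => V E N (hT N) x) atTop (𝓝 (CuntzPimsner.p E x)) := by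
  rw [Metric.tendsto_atTop]
  intro ε hε
  obtain ⟨w, hw, hxw⟩ := Metric.mem_closure_iff.1 (toeplitz_le_closure E x.2) (ε / 3)
    (by positivity)
  set w' : toeplitz E := ⟨w, wordSpan_le_toeplitz E hw⟩ with hw'
  have hxw' : ‖x - w'‖ < ε / 3 := by rwa [dist_eq_norm] at hxw
  obtain ⟨N₀, hN₀⟩ := Metric.tendsto_atTop.1 (tendsto_V_of_mem_wordSpan E hE hT hw) (ε / 3)
    (by positivity)
  refine ⟨N₀, fun N hN => ?_⟩
  have h1 := hN₀ N hN
  rw [dist_eq_norm] at h1 ⊢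
  -- The three terms are each below ε/3: V_N and p are contractions, which controls the outer two
  -- uniformly in N, and the middle one converges because w' lies in the span of the words.
  have h2 : V E N (hT N) x - CuntzPimsner.p E x
      = V E N (hT N) (x - w') + (V E N (hT N) w' - CuntzPimsner.p E w')
        - CuntzPimsner.p E (x - w') := by
    have h3 : V E N (hT N) (x - w') = V E N (hT N) x - V E N (hT N) w' :=
      (vHom E N (hT N)).map_sub x w'
    rw [h3, _root_.map_sub]
    abel
  rw [h2]
  have h4 := norm_V_le E N (hT N) (x - w')
  have h5 := norm_p_le E (x - w')
  have h6 := norm_sub_le (V E N (hT N) (x - w') + (V E N (hT N) w' - CuntzPimsner.p E w'))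
    (CuntzPimsner.p E (x - w'))
  have h7 := norm_add_le (V E N (hT N) (x - w')) (V E N (hT N) w' - CuntzPimsner.p E w')
  linarith

end Quotient

end CStarCorrespondence

end

theorem mainTheorem6 (A : Type u) [CStarAlgebra A] [PartialOrder A] [StarOrderedRing A]
    (E : CStarCorrespondence A) :
    (∀ N : ℕ,
      (∀ x, HilbertModule.Adjointable.HasStrictSum (E.amplify N x) (((N : ℂ) + 1) • E.Psi N x)) ∧
      (∃ f : CompletelyPositiveMap (HilbertModule.Adjointable E.fock E.fock)
          (HilbertModule.Adjointable E.fock E.fock), ∀ x, f x = E.PsiPhi N x) ∧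
      (∀ x, ‖E.PsiPhi N x‖ ≤ ‖x‖)) ∧
    (Module.Finite Aᵐᵒᵖ E.carrier →
      (∀ x ∈ HilbertModule.Adjointable.compacts E.fock, x ∈ E.toeplitz) ∧
      ∃ hT : ∀ N : ℕ, ∀ x ∈ E.toeplitz, E.PsiPhi N x ∈ E.toeplitz,
        (∀ (N m n : ℕ) (μ : E.tpow m) (ν : E.tpow n),
          E.V N (hT N) (E.t μ * star (E.t ν)) =
            if m ≤ N ∧ n ≤ N then
              (((min (N - m) (N - n) : ℕ) + 1 : ℂ) / ((N : ℂ) + 1)) • (E.s μ * star (E.s ν))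
            else 0) ∧
        (∀ x : E.toeplitz,
          Tendsto (fun N => E.V N (hT N) x) atTop (𝓝 (CStarCorrespondence.CuntzPimsner.p E x)))) :=
  ⟨fun N => ⟨E.hasStrictSum_amplify N, ⟨E.psiPhiCP N, fun _ => rfl⟩, E.norm_PsiPhi_le N⟩,
    fun hE => ⟨fun _ hx => E.compacts_le_toeplitz hE hx,
      fun N _ hx => E.PsiPhi_mem_toeplitz hE N hx,
      fun N _ _ μ ν => E.V_create_eq_ite hE N _ μ ν,
      fun x => E.tendsto_V hE _ x⟩⟩
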